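/- Fix $\alpha\in(0,1)$, let $\mathbb T$ be the unit circle and $e_n(w)=\mathrm{Im}(w^n)$, and let $$X=\Big\{h\in C^{1+\alpha}(\mathbb T):\ h(w)=\sum_{n\ge2}a_nw^n,\ a_n\in\mathbb R\Big\},\qquad Y=\Big\{g\in C^{\alpha}(\mathbb T):\ g=\sum_{n\ge1}g_ne_n,\ g_n\in\mathbb R\Big\}.$$ For $Q\in(0,1)$ and a small $f\in X$ put $\Phi(w)=w+Q/w+f(w)$, $\Omega=\frac{1-Q^2}{4}$ and $$F(Q,f)(w)=\mathrm{Im}\left\{\left(2\Omega\,\overline{\Phi(w)}+\frac1{2\pi i}\int_{\mathbb T}\frac{\overline{\Phi(\xi)}-\overline{\Phi(w)}}{\Phi(\xi)-\Phi(w)}\,\Phi'(\xi)\,d\xi\right)w\,\Phi'(w)\right\}.$$ For every integer $m\ge3$ the equation $1+Q^m-\frac{1-Q^2}{2}m=0$ has exactly one solution $Q_m$ in $(0,1)$; let $\mathcal S=\{Q_m:\ m\ge3\}$. For every $Q\in(0,1)$ the linearized operator $\mathcal L_Q=\partial_fF(Q,0):X\to Y$, $\mathcal L_Qh(w)=\frac{d}{dt}F(Q,t\,h)(w)\big|_{t=0}$,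 exists as a Fréchet derivative, and the following holds. 1. If $Q\in(0,1)$ and $h(w)=\sum_{n\ge2}a_nw^n\in X$, then $\mathcal L_Qh=\sum_{n\ge1}g_{n+1}e_n$ with $$g_2=\tfrac12(1+Q)^2a_2,\qquad g_3=2Q^2a_3,\qquad g_{n+1}=\Big(1+Q^n-\tfrac{1-Q^2}{2}n\Big)\big(a_{n+1}-Q\,a_{n-1}\big)\quad(n\ge3).$$ 2. For $Q\in(0,1)$, the kernel of $\mathcal L_Q$ is nontrivial if and only if $Q\in\mathcal S$. If $Q=Q_m$, then it is the one-dimensional space spanned by $v_m(w)=\dfrac{w^{m+1}}{1-Qw^2}$. 3. If $Q=Q_m$ with $m\ge3$, then the range $R(\mathcal L_Q)$ has codimension one in $Y$ and equals $$\Big\{g\in C^\alpha(\mathbb T):\ g=\sum_{n\ge1,\ n\ne m}g_{n+1}e_n,\ g_{n+1}\in\mathbb R\Big\}.$$ 4. If $Q=Q_m$ with $m\ge3$ then, with $v_m$ held fixed, the derivative $\partial_Q\mathcal L_Qv_m$ at $Q=Q_m$ exists in $Y$ (in the norm of $C^\alpha(\mathbb T)$) and $\partial_Q\mathcal L_Qv_m\notin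 R(\mathcal L_{Q_m})$. -/

import Mathlib

open Filter Topology
open scoped NNReal ENNReal

namespace RotatingPatch

noncomputable section

/-- The complex derivative `h'(w)` of a function on the unit circle, taken along the circle:
since `d/dθ h(w e^{iθ}) = i w h'(w)` at `θ = 0`, one divides the angular derivative by `i w`. -/
def circleDeriv (h : Circle → ℂ) (w : Circle) : ℂ :=
  deriv (fun θ : ℝ => h (w * Circle.exp θ)) 0 / (Complex.I * (w : ℂ))

/-- The normalized contour integral `(1 / (2πi)) ∫_𝕋 f(ξ) dξ`. -/
def circleMean (f : Circle → ℂ) : ℂ :=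
  (2 * (Real.pi : ℂ) * Complex.I)⁻¹ *
    ∫ θ in (0 : ℝ)..(2 * Real.pi), f (Circle.exp θ) * (Complex.I * (Circle.exp θ : ℂ))

/-- `α_Q(w) = w + Q / w`, the parametrization of the ellipse. -/
def ellipse (Q : ℝ) (w : Circle) : ℂ := (w : ℂ) + (Q : ℂ) / (w : ℂ)

/-- The functional `G(Ω, Φ)` of the boundary equation of rotating patches. -/
def G (Ω : ℝ) (Φ : Circle → ℂ) (w : Circle) : ℂ :=
  (2 * (Ω : ℂ) * (starRingEnd ℂ) (Φ w) +
      circleMean (fun ξ =>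
        ((starRingEnd ℂ) (Φ ξ) - (starRingEnd ℂ) (Φ w)) / (Φ ξ - Φ w) * circleDeriv Φ ξ)) *
    (w : ℂ) * circleDeriv Φ w

/-- `F(Q, f) = Im G((1 - Q²) / 4, α_Q + f)`. -/
def F (Q : ℝ) (f : Circle → ℂ) (w : Circle) : ℝ :=
  (G ((1 - Q ^ 2) / 4) (fun ξ => ellipse Q ξ + f ξ) w).im

/-- The `C^α(𝕋)` norm `‖g‖_∞ + [g]_α` (it is `∞` if `g` is not `α`-Hölder). -/
def holderENorm {E : Type*} [NormedAddCommGroup E] (α : ℝ≥0) (g : Circle → E) : ℝ≥0∞ :=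
  (⨆ w, ‖g w‖ₑ) + eHolderNorm α g

/-- The `C^{1+α}(𝕋)` norm `‖h‖_∞ + ‖h'‖_{C^α}`. -/
def c1HolderENorm (α : ℝ≥0) (h : Circle → ℂ) : ℝ≥0∞ :=
  (⨆ w, ‖h w‖ₑ) + holderENorm α (circleDeriv h)

/-- `h ∈ C^{1+α}(𝕋)`. -/
def IsC1Holder (α : ℝ≥0) (h : Circle → ℂ) : Prop :=
  (∀ w : Circle, DifferentiableAt ℝ (fun θ : ℝ => h (w * Circle.exp θ)) 0) ∧
    MemHolder α (circleDeriv h)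

/-- `h(w) = ∑_{n ≥ 2} a_n w^n` on the circle; `a 0` and `a 1` play no role. (For
`h ∈ C^{1+α}` with `α > 0` the Fourier series is absolutely convergent.) -/
def HasPowerSeries (a : ℕ → ℝ) (h : Circle → ℂ) : Prop :=
  ∀ w : Circle, HasSum (fun n : ℕ => (a (n + 2) : ℂ) * (w : ℂ) ^ (n + 2)) (h w)

/-- `e_n(w) = Im (w^n)`. -/
def eMode (n : ℕ) (w : Circle) : ℝ := ((w : ℂ) ^ n).im

/-- `g = ∑_{n ≥ 1} c_n e_n` on the circle: the series is the Fourier series of `g` and its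
partial sums converge to `g` at every point; `c 0` plays no role. -/
def HasSineSeries (c : ℕ → ℝ) (g : Circle → ℝ) : Prop :=
  (∀ w : Circle,
    Tendsto (fun N : ℕ => ∑ n ∈ Finset.range N, c (n + 1) * eMode (n + 1) w) atTop (𝓝 (g w))) ∧
  ∀ n : ℕ, 1 ≤ n →
    (1 / Real.pi) * ∫ θ in (0 : ℝ)..(2 * Real.pi),
      g (Circle.exp θ) * eMode n (Circle.exp θ) = c n

theorem circleDeriv_add {h k : Circle → ℂ}
    (hh : ∀ w : Circle, DifferentiableAt ℝ (fun θ : ℝ => h (w * Circle.exp θ)) 0)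
    (hk : ∀ w : Circle, DifferentiableAt ℝ (fun θ : ℝ => k (w * Circle.exp θ)) 0) :
    circleDeriv (h + k) = circleDeriv h + circleDeriv k := by
  funext w
  have h1 := deriv_add (hh w) (hk w)
  simp only [circleDeriv, Pi.add_apply, ← add_div]
  congr 1

theorem circleDeriv_smul (t : ℝ) {h : Circle → ℂ}
    (hh : ∀ w : Circle, DifferentiableAt ℝ (fun θ : ℝ => h (w * Circle.exp θ)) 0) :
    circleDeriv (t • h) = t • circleDeriv h := by
  funext w
  have h1 := deriv_const_smul t (hh w)
  simp only [circleDeriv, Pi.smul_apply, ← smul_div_assoc]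
  congr 1

theorem circleDeriv_zero : circleDeriv 0 = 0 := by
  funext w
  simp [circleDeriv]

theorem HasSineSeries.add {c d : ℕ → ℝ} {g k : Circle → ℝ} (hg : Continuous g)
    (hk : Continuous k) (h1 : HasSineSeries c g) (h2 : HasSineSeries d k) :
    HasSineSeries (c + d) (g + k) := by
  have he : ∀ n, Continuous fun θ : ℝ => eMode n (Circle.exp θ) := by
    intro n
    unfold eMode
    fun_prop
  refine ⟨fun w => ?_, fun n hn => ?_⟩
  · have := (h1.1 w).add (h2.1 w)
    simpa [add_mul, Finset.sum_add_distrib] using this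
  · have i1 : IntervalIntegrable (fun θ : ℝ => g (Circle.exp θ) * eMode n (Circle.exp θ))
        MeasureTheory.volume 0 (2 * Real.pi) :=
      ((hg.comp Circle.exp.continuous).mul (he n)).intervalIntegrable _ _
    have i2 : IntervalIntegrable (fun θ : ℝ => k (Circle.exp θ) * eMode n (Circle.exp θ))
        MeasureTheory.volume 0 (2 * Real.pi) :=
      ((hk.comp Circle.exp.continuous).mul (he n)).intervalIntegrable _ _
    simp only [Pi.add_apply, add_mul]
    rw [intervalIntegral.integral_add i1 i2, mul_add, h1.2 n hn, h2.2 n hn]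

theorem HasSineSeries.smul {c : ℕ → ℝ} {g : Circle → ℝ} (t : ℝ) (h1 : HasSineSeries c g) :
    HasSineSeries (t • c) (t • g) := by
  refine ⟨fun w => ?_, fun n hn => ?_⟩
  · have := (h1.1 w).const_mul t
    simpa [Finset.mul_sum, mul_assoc] using this
  · simp only [Pi.smul_apply, smul_eq_mul, mul_assoc]
    rw [intervalIntegral.integral_const_mul, ← h1.2 n hn]
    ring

/-- The space `X` of functions `h ∈ C^{1+α}(𝕋)` with `h(w) = ∑_{n ≥ 2} a_n w^n`, `a_n` real. -/
def spaceX (α : ℝ≥0) : Submodule ℝ (Circle → ℂ) where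
  carrier := {h | IsC1Holder α h ∧ ∃ a : ℕ → ℝ, HasPowerSeries a h}
  add_mem' := by
    rintro h k ⟨⟨h1, h2⟩, a, ha⟩ ⟨⟨k1, k2⟩, b, hb⟩
    refine ⟨⟨fun w => (h1 w).add (k1 w), ?_⟩, a + b, fun w => ?_⟩
    · rw [circleDeriv_add h1 k1]
      exact h2.add k2
    · simpa [add_mul] using (ha w).add (hb w)
  zero_mem' := by
    refine ⟨⟨fun w => by simp, ?_⟩, 0, fun w => by simp⟩
    rw [circleDeriv_zero]
    exact memHolder_zero
  smul_mem' := by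
    rintro t h ⟨⟨h1, h2⟩, a, ha⟩
    refine ⟨⟨fun w => (h1 w).const_smul t, ?_⟩, t • a, fun w => ?_⟩
    · rw [circleDeriv_smul t h1]
      exact h2.smul
    · simpa [mul_assoc] using (ha w).mul_left (t : ℂ)

/-- The space `Y` of real functions `g ∈ C^α(𝕋)` with `g = ∑_{n ≥ 1} g_n e_n`, `g_n` real.
(For `α > 0` continuity is automatic.) -/
def spaceY (α : ℝ≥0) : Submodule ℝ (Circle → ℝ) where
  carrier := {g | Continuous g ∧ MemHolder α g ∧ ∃ c : ℕ → ℝ, HasSineSeries c g}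
  add_mem' := by
    rintro g k ⟨g0, g1, c, hc⟩ ⟨k0, k1, d, hd⟩
    exact ⟨g0.add k0, g1.add k1, c + d, hc.add g0 k0 hd⟩
  zero_mem' := ⟨continuous_const, memHolder_zero, 0,
    fun w => by simp, fun n _ => by simp⟩
  smul_mem' := by
    rintro t g ⟨g0, g1, c, hc⟩
    exact ⟨g0.const_smul t, g1.smul, t • c, hc.smul t⟩

/-- `L = ∂_f F(Q, 0) : X → Y`. The bounded linear map `L` is the Fréchet derivative at `0` of
`f ↦ F(Q, f)`, for the norms of `C^{1+α}` and `C^α`, and (for every `h` and every point `w`)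
`L h (w) = d/dt F(Q, t h)(w)` at `t = 0`. -/
def IsLinearization (α : ℝ≥0) (Q : ℝ) (L : spaceX α →ₗ[ℝ] spaceY α) : Prop :=
  (∃ C : ℝ≥0, ∀ h : spaceX α,
      holderENorm α (L h : Circle → ℝ) ≤ C * c1HolderENorm α (h : Circle → ℂ)) ∧
  (∀ ε : ℝ≥0, 0 < ε → ∃ δ : ℝ≥0, 0 < δ ∧ ∀ h : spaceX α,
      c1HolderENorm α (h : Circle → ℂ) < δ →
        holderENorm α (F Q (h : Circle → ℂ) - F Q 0 - (L h : Circle → ℝ)) ≤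
          ε * c1HolderENorm α (h : Circle → ℂ)) ∧
  ∀ (h : spaceX α) (w : Circle),
    HasDerivAt (fun t : ℝ => F Q (t • (h : Circle → ℂ)) w) ((L h : Circle → ℝ) w) 0

/-- `f_m(Q) = 1 + Q^m - (1 - Q²) m / 2`. -/
def dispersion (m : ℕ) (Q : ℝ) : ℝ := 1 + Q ^ m - (1 - Q ^ 2) / 2 * m

/-- The set `𝒮` of those `Q ∈ (0, 1)` that solve `f_m(Q) = 0` for some `m ≥ 3`. -/
def dispersionSet : Set ℝ :=
  {Q | 0 < Q ∧ Q < 1 ∧ ∃ m : ℕ, 3 ≤ m ∧ dispersion m Q = 0}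

/-- `w^{m+1} / (1 - Q w²)`. -/
def kernelVector (m : ℕ) (Q : ℝ) (w : Circle) : ℂ :=
  (w : ℂ) ^ (m + 1) / (1 - (Q : ℂ) * (w : ℂ) ^ 2)

end

end RotatingPatch

/-!
The integral kernel `conj(Φ(ξ) - Φ(w)) / (Φ(ξ) - Φ(w))` at `Φ = w + Q/w + f` depends on `f` only
through the difference quotient `(f(ξ) - f(w)) / (ξ - w)`, and it has an exact expansion into a
constant, a linear and a quadratic part (`kernel_eq`). All parts are bounded off the diagonal and
Lipschitz in `w` up to a factor `1 / |w - ξ|` (`KernelBound`, a class stable under products and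
inverses). Since `|w - ξ|^{-α}` is integrable on the circle for `α < 1`, such kernels map bounded
functions to `C^α` functions (`KernelBound.exists_operator_bound`). Hence the linear part of `F` is
bounded from `C^{1+α}` to `C^α`, and the remainder is quadratically small
(`exists_expansion_bound`); this is Fréchet differentiability.

The Cauchy formula evaluates the integrals in the linear part. With
`p(w) = (1/w - Q w) h(w) = ∑ b_n w^n`, `b_n = a_{n+1} - Q a_{n-1}`, one finds
`L_Q h = Im (p(w) + p(Q w) - (1 - Q²)/2 · w p'(w))` (`linearPart_eq`), so that `L_Q` multiplies
`b_n` by `f_n(Q) = 1 + Q^n - (1 - Q²) n / 2` (`boundedSeries_linSymbol`). The pointwise convergence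
of the Fourier series of a Hölder function comes from a telescoping identity for the partial sums,
whose remainder is a Fourier coefficient of the integrable function `(φ(ξ) - φ(w)) / (ξ - w)`
(`HolderBound.sum_fourierCoef`).

The map `a ↦ b` is inverted by a two-term recursion, which on functions is multiplication by
`w / (1 - Q w²)` (`exists_resolvent`). As `f_1, f_2 > 0` and `f_n(Q)` is strictly decreasing in `n`,
at most one `f_m(Q)` vanishes; the kernel is then the solution of the recursion for `b = δ_m`, that
is `w^{m+1} / (1 - Q w²)` (`ker_linOp_eq_span`).

For the range one has to solve `f_n b_n = c_n` for a Hölder sine series with coefficients `c_n`,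
`c_m = 0`. By Privalov's theorem (`HolderBound.exists_cauchyProjection`) `∑ c_n w^n` is again
Hölder. The expansion `n / f_n = -1/τ - 1/(τ² n) + O(1/n²)`, `τ = (1 - Q²)/2`, exhibits `∑ n b_n w^n`
as a combination of this function, its antiderivative and a Lipschitz remainder
(`BoundedSeries.exists_antideriv`), so `∑ b_n w^n` is in `C^{1+α}` without any multiplier theorem
(`mem_range_linOp_of_coef_eq_zero`).

For the fixed vector `v_m` the coefficients of `L_q v_m` are `f_n(q) (δ_{nm} - (q - Q) a_{n-1})` with
`a_n` decaying geometrically. They can be differentiated in `q` in an absolutely convergent norm, and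
the coefficient of index `m` of the derivative at `Q` is `f_m'(Q) > 0`, so the derivative is not in
the range (`exists_hasDeriv_linOp`).
-/

namespace RotatingPatch

open MeasureTheory

/-! ### Integration over the circle -/

/-- Integrability over the circle, expressed in the angular variable. -/
def CircleInt {E : Type*} [NormedAddCommGroup E] (f : Circle → E) : Prop :=
  IntervalIntegrable (fun θ : ℝ => f (Circle.exp θ)) volume 0 (2 * Real.pi)

/-- Measurability of a function on the circle, expressed in the angular variable. -/
def CircleMeas {E : Type*} [MeasurableSpace E] (f : Circle → E) : Prop :=
  Measurable fun θ : ℝ => f (Circle.exp θ)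

theorem continuous_circle_coe : Continuous fun w : Circle => (w : ℂ) :=
  continuous_subtype_val

theorem circle_dist (w ξ : Circle) : dist w ξ = ‖(w : ℂ) - ξ‖ := by
  exact dist_eq_norm (w : ℂ) ξ

theorem circle_dist_le_two (w ξ : Circle) : dist w ξ ≤ 2 := by
  rw [circle_dist]
  refine (norm_sub_le _ _).trans ?_
  simp only [Circle.norm_coe]
  norm_num

theorem circleMean_eq (f : Circle → ℂ) :
    circleMean f = (2 * (Real.pi : ℂ))⁻¹ *
      ∫ θ in (0 : ℝ)..(2 * Real.pi), f (Circle.exp θ) * (Circle.exp θ : ℂ) := by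
  have h : ∀ θ : ℝ, f (Circle.exp θ) * (Complex.I * (Circle.exp θ : ℂ)) =
      Complex.I * (f (Circle.exp θ) * (Circle.exp θ : ℂ)) := fun θ => by ring
  simp only [circleMean, h, intervalIntegral.integral_const_mul]
  have := Complex.I_ne_zero
  field_simp

theorem measure_exp_preimage (w : Circle) : volume {θ : ℝ | Circle.exp θ = w} = 0 := by
  have h : {θ : ℝ | Circle.exp θ = w} ⊆
      Set.range (fun m : ℤ => (w : ℂ).arg + m * (2 * Real.pi)) := by
    intro θ hθ
    rw [Set.mem_ofPred_eq, ← Circle.exp_arg w, Circle.exp_eq_exp] at hθ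
    obtain ⟨m, hm⟩ := hθ
    exact ⟨m, hm.symm⟩
  exact ((Set.countable_range _).mono h).measure_zero _

theorem ae_exp_ne (w : Circle) : ∀ᵐ θ : ℝ, Circle.exp θ ≠ w :=
  measure_eq_zero_iff_ae_notMem.1 (measure_exp_preimage w)

theorem circleMean_congr (w : Circle) {f g : Circle → ℂ} (h : ∀ ξ, ξ ≠ w → f ξ = g ξ) :
    circleMean f = circleMean g := by
  simp only [circleMean]
  congr 1
  refine intervalIntegral.integral_congr_ae ?_
  filter_upwards [ae_exp_ne w] with θ hθ _
  rw [h _ hθ]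

theorem CircleInt.of_le {f : Circle → ℂ} {ρ : Circle → ℝ} (w : Circle) (hm : CircleMeas f)
    (hρ : CircleInt ρ) (h : ∀ ξ, ξ ≠ w → ‖f ξ‖ ≤ ρ ξ) : CircleInt f := by
  refine IntervalIntegrable.mono_fun hρ
    hm.aestronglyMeasurable ?_
  refine ae_restrict_of_ae ?_
  filter_upwards [ae_exp_ne w] with θ hθ
  exact (h _ hθ).trans (le_abs_self _)

theorem CircleInt.of_bounded {f : Circle → ℂ} {C : ℝ} (hm : CircleMeas f)
    (h : ∀ ξ, ‖f ξ‖ ≤ C) : CircleInt f :=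
  CircleInt.of_le (ρ := fun _ => C) 1 hm intervalIntegrable_const (fun ξ _ => h ξ)

theorem CircleInt.of_continuous {f : Circle → ℂ} (hf : Continuous f) : CircleInt f :=
  (hf.comp Circle.exp.continuous).intervalIntegrable _ _

theorem CircleInt.mul_coe {f : Circle → ℂ} (hf : CircleInt f) :
    CircleInt (fun ξ => f ξ * (ξ : ℂ)) := by
  refine IntervalIntegrable.mul_continuousOn hf (Continuous.continuousOn ?_)
  exact continuous_circle_coe.comp Circle.exp.continuous

theorem CircleInt.add {f g : Circle → ℂ} (hf : CircleInt f) (hg : CircleInt g) :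
    CircleInt (fun ξ => f ξ + g ξ) := IntervalIntegrable.add hf hg

theorem CircleInt.const_mul {f : Circle → ℝ} (hf : CircleInt f) (c : ℝ) :
    CircleInt (fun ξ => c * f ξ) := IntervalIntegrable.const_mul hf c

theorem CircleInt.sub {f g : Circle → ℂ} (hf : CircleInt f) (hg : CircleInt g) :
    CircleInt (fun ξ => f ξ - g ξ) := IntervalIntegrable.sub hf hg

theorem CircleInt.mul_continuous {f g : Circle → ℂ} (hf : CircleInt f) (hg : Continuous g) :
    CircleInt (fun ξ => f ξ * g ξ) :=
  IntervalIntegrable.mul_continuousOn hf (hg.comp Circle.exp.continuous).continuousOn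

theorem circleMean_add {f g : Circle → ℂ} (hf : CircleInt f) (hg : CircleInt g) :
    circleMean (fun ξ => f ξ + g ξ) = circleMean f + circleMean g := by
  simp only [circleMean_eq, add_mul]
  rw [intervalIntegral.integral_add hf.mul_coe hg.mul_coe, mul_add]

theorem circleMean_sub {f g : Circle → ℂ} (hf : CircleInt f) (hg : CircleInt g) :
    circleMean (fun ξ => f ξ - g ξ) = circleMean f - circleMean g := by
  simp only [circleMean_eq, sub_mul]
  rw [intervalIntegral.integral_sub hf.mul_coe hg.mul_coe, mul_sub]

theorem circleMean_const_mul (c : ℂ) (f : Circle → ℂ) :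
    circleMean (fun ξ => c * f ξ) = c * circleMean f := by
  simp only [circleMean_eq, mul_assoc, intervalIntegral.integral_const_mul]
  ring

theorem circleMean_mul_const (c : ℂ) (f : Circle → ℂ) :
    circleMean (fun ξ => f ξ * c) = circleMean f * c := by
  simp only [mul_comm _ c, circleMean_const_mul]

theorem norm_circleMean_le {f : Circle → ℂ} {ρ : Circle → ℝ} (w : Circle)
    (hρ : CircleInt ρ) (h : ∀ ξ, ξ ≠ w → ‖f ξ‖ ≤ ρ ξ) :
    ‖circleMean f‖ ≤ (2 * Real.pi)⁻¹ * ∫ θ in (0 : ℝ)..(2 * Real.pi), ρ (Circle.exp θ) := by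
  rw [circleMean_eq, norm_mul]
  have h1 : ‖(2 * (Real.pi : ℂ))⁻¹‖ = (2 * Real.pi)⁻¹ := by
    rw [norm_inv, norm_mul, Complex.norm_real, Real.norm_of_nonneg Real.pi_pos.le]
    norm_num
  rw [h1]
  refine mul_le_mul_of_nonneg_left ?_ (by positivity)
  refine intervalIntegral.norm_integral_le_of_norm_le (by positivity) ?_ hρ
  filter_upwards [ae_exp_ne w] with θ hθ _
  rw [norm_mul, Circle.norm_coe, mul_one]
  exact h _ hθ

theorem norm_circleMean_le_of_bounded {f : Circle → ℂ} {C : ℝ} (h : ∀ ξ, ‖f ξ‖ ≤ C) :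
    ‖circleMean f‖ ≤ C := by
  refine (norm_circleMean_le (ρ := fun _ => C) 1 intervalIntegrable_const
    (fun ξ _ => h ξ)).trans (le_of_eq ?_)
  rw [intervalIntegral.integral_const, smul_eq_mul, sub_zero]
  field_simp

/-- A function series that converges absolutely and uniformly may be averaged term by term. -/
theorem circleMean_hasSum {c : ℕ → ℂ} {e : ℕ → Circle → ℂ} {f ρ : Circle → ℂ}
    (hc : Summable fun n => ‖c n‖) (he : ∀ n, Continuous (e n)) (he1 : ∀ n ξ, ‖e n ξ‖ ≤ 1)
    (hf : ∀ ξ, HasSum (fun n => c n * e n ξ) (f ξ)) (hρ : Continuous ρ) :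
    HasSum (fun n => c n * circleMean (fun ξ => e n ξ * ρ ξ))
      (circleMean (fun ξ => f ξ * ρ ξ)) := by
  obtain ⟨B, hB⟩ := isCompact_univ.exists_bound_of_continuousOn hρ.continuousOn
  have h1 : HasSum (fun n => ∫ θ in (0 : ℝ)..(2 * Real.pi),
      c n * (e n (Circle.exp θ) * ρ (Circle.exp θ) * (Circle.exp θ : ℂ)))
      (∫ θ in (0 : ℝ)..(2 * Real.pi), f (Circle.exp θ) * ρ (Circle.exp θ) * (Circle.exp θ : ℂ)) := by
    refine intervalIntegral.hasSum_integral_of_dominated_convergence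
      (bound := fun n _ => ‖c n‖ * B) ?_ ?_ ?_ ?_ ?_
    · intro n
      refine Continuous.aestronglyMeasurable ?_
      have := (he n).comp Circle.exp.continuous
      have := hρ.comp Circle.exp.continuous
      have := continuous_circle_coe.comp Circle.exp.continuous
      simp only [Function.comp_def] at *
      fun_prop
    · intro n
      refine Eventually.of_forall fun θ _ => ?_
      rw [norm_mul, norm_mul, norm_mul, Circle.norm_coe, mul_one]
      refine mul_le_mul_of_nonneg_left ?_ (norm_nonneg _)
      calc _ ≤ 1 * B := mul_le_mul (he1 _ _) (hB _ trivial) (norm_nonneg _) zero_le_one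
        _ = B := one_mul B
    · exact Eventually.of_forall fun θ _ => hc.mul_right B
    · exact intervalIntegrable_const
    · refine Eventually.of_forall fun θ _ => ?_
      have := (hf (Circle.exp θ)).mul_right (ρ (Circle.exp θ) * (Circle.exp θ : ℂ))
      simpa only [mul_assoc] using this
  have h2 := h1.mul_left (2 * (Real.pi : ℂ))⁻¹
  simp only [intervalIntegral.integral_const_mul] at h2
  simp only [circleMean_eq]
  have e := fun (n : ℕ) (z : ℂ) => mul_left_comm (2 * (Real.pi : ℂ))⁻¹ (c n) z
  simpa only [e] using h2

theorem circleMean_zpow (n : ℤ) :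
    circleMean (fun ξ => (ξ : ℂ) ^ n) = if n = -1 then 1 else 0 := by
  rw [circleMean_eq]
  have h : ∀ θ : ℝ, (Circle.exp θ : ℂ) ^ n * (Circle.exp θ : ℂ) =
      Complex.exp (((n + 1 : ℤ) : ℂ) * Complex.I * θ) := by
    intro θ
    rw [← zpow_add_one₀ (Circle.coe_ne_zero _), Circle.coe_exp, ← Complex.exp_int_mul]
    congr 1
    ring
  simp only [h]
  split_ifs with hn
  · subst hn
    have := Real.pi_ne_zero
    simp
    field_simp
  · have h0 : ((n + 1 : ℤ) : ℂ) * Complex.I ≠ 0 := by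
      refine mul_ne_zero ?_ Complex.I_ne_zero
      exact_mod_cast fun h' => hn (by omega)
    rw [integral_exp_mul_complex h0]
    have : ((n + 1 : ℤ) : ℂ) * Complex.I * ((2 * Real.pi : ℝ) : ℂ) =
        ((n + 1 : ℤ) : ℂ) * (2 * Real.pi * Complex.I) := by
      push_cast; ring
    rw [this, Complex.exp_int_mul_two_pi_mul_I]
    simp

/-! ### Integrals of radially decreasing functions of the chordal distance -/

theorem exp_dist_exp (φ θ : ℝ) :
    dist (Circle.exp φ) (Circle.exp θ) = 2 * |Real.sin ((θ - φ) / 2)| := by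
  rw [dist_comm, circle_dist]
  have h : (Circle.exp θ : ℂ) - Circle.exp φ =
      Circle.exp φ * (Complex.exp (Complex.I * ((θ - φ : ℝ) : ℂ)) - 1) := by
    simp only [Circle.coe_exp, mul_sub, mul_one, ← Complex.exp_add]
    congr 2
    push_cast; ring
  rw [h, norm_mul, Circle.norm_coe, one_mul, Complex.norm_exp_I_mul_ofReal_sub_one]
  simp

theorem two_div_pi_mul_le_dist {φ θ : ℝ} (h : |θ - φ| ≤ Real.pi) :
    2 / Real.pi * |θ - φ| ≤ dist (Circle.exp φ) (Circle.exp θ) := by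
  rw [exp_dist_exp]
  have h1 : |Real.sin ((θ - φ) / 2)| = Real.sin (|θ - φ| / 2) := by
    have h2 : 0 ≤ Real.sin (|θ - φ| / 2) :=
      Real.sin_nonneg_of_nonneg_of_le_pi (by positivity) (by linarith [Real.pi_pos])
    rw [← abs_of_nonneg h2]
    rcases abs_cases (θ - φ) with ⟨h3, _⟩ | ⟨h3, _⟩
    · rw [h3]
    · rw [h3, neg_div, Real.sin_neg, abs_neg]
  have := Real.mul_le_sin (x := |θ - φ| / 2) (by positivity) (by linarith)
  rw [h1]
  linarith

/-- An average over the circle of a decreasing function of the distance to a fixed point is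
controlled by a one-dimensional integral, uniformly in the point. -/
theorem circleInt_radial {ρ : ℝ → ℝ} (hm : Measurable ρ) (h0 : ∀ x, 0 ≤ ρ x)
    (ha : AntitoneOn ρ (Set.Ioi 0))
    (hi : IntervalIntegrable (fun θ => ρ (2 / Real.pi * θ)) volume 0 Real.pi) (w : Circle) :
    CircleInt (fun ξ => ρ (dist w ξ)) ∧
      ∫ θ in (0 : ℝ)..(2 * Real.pi), ρ (dist w (Circle.exp θ)) ≤
        2 * ∫ θ in (0 : ℝ)..Real.pi, ρ (2 / Real.pi * θ) := by
  have hpi := Real.pi_pos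
  set g : ℝ → ℝ := fun θ => ρ (dist (Circle.exp 0) (Circle.exp θ)) with hg
  have hgm : Measurable g := hm.comp (Continuous.measurable (by fun_prop))
  have hle : ∀ θ ∈ Set.Ioc 0 Real.pi, g θ ≤ ρ (2 / Real.pi * θ) := by
    intro θ hθ
    have h1 : 2 / Real.pi * |θ - 0| ≤ dist (Circle.exp 0) (Circle.exp θ) :=
      two_div_pi_mul_le_dist (by rw [sub_zero, abs_of_pos hθ.1]; exact hθ.2)
    rw [sub_zero, abs_of_pos hθ.1] at h1
    have h2 : 0 < 2 / Real.pi * θ := mul_pos (by positivity) hθ.1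
    exact ha h2 (h2.trans_le h1) h1
  have hg1 : IntervalIntegrable g volume 0 Real.pi := by
    refine hi.mono_fun hgm.aestronglyMeasurable ?_
    rw [Set.uIoc_of_le hpi.le]
    refine (ae_restrict_iff' measurableSet_Ioc).2 (Eventually.of_forall fun θ hθ => ?_)
    simp only [Real.norm_of_nonneg (h0 _), hg]
    exact hle θ hθ
  have heven : ∀ θ, g (-θ) = g θ := by
    intro θ
    simp only [hg, exp_dist_exp, sub_zero, neg_div, Real.sin_neg, abs_neg]
  have hg2 : IntervalIntegrable g volume (-Real.pi) 0 := by
    have := ((IntervalIntegrable.iff_comp_neg (by simp)).1 hg1).symm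
    simpa [heven] using this
  have hint : ∫ θ in (-Real.pi)..0, g θ = ∫ θ in (0 : ℝ)..Real.pi, g θ := by
    have := intervalIntegral.integral_comp_neg (a := 0) (b := Real.pi) g
    simp only [heven, neg_zero] at this
    exact this.symm
  have hper : Function.Periodic g (2 * Real.pi) := by
    intro θ
    simp only [hg, Circle.periodic_exp θ]
  have hall : ∀ a b, IntervalIntegrable g volume a b := by
    refine hper.intervalIntegrable (t := -Real.pi) (by positivity) ?_
    have : -Real.pi + 2 * Real.pi = Real.pi := by ring
    rw [this]
    exact hg2.trans hg1
  have hshift : ∀ θ, ρ (dist w (Circle.exp θ)) = g (θ - (w : ℂ).arg) := by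
    intro θ
    conv_lhs => rw [← Circle.exp_arg w]
    simp only [hg, exp_dist_exp, sub_zero]
  refine ⟨?_, ?_⟩
  · have := (hall (0 - (w : ℂ).arg) (2 * Real.pi - (w : ℂ).arg)).comp_sub_right (w : ℂ).arg
    simp only [sub_add_cancel] at this
    simpa only [CircleInt, hshift] using this
  · simp only [hshift]
    rw [intervalIntegral.integral_comp_sub_right g]
    have h1 := hper.intervalIntegral_add_eq (0 - (w : ℂ).arg) (-Real.pi)
    have e1 : 0 - (w : ℂ).arg + 2 * Real.pi = 2 * Real.pi - (w : ℂ).arg := by ring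
    have e2 : -Real.pi + 2 * Real.pi = Real.pi := by ring
    rw [e1, e2] at h1
    rw [h1, ← intervalIntegral.integral_add_adjacent_intervals hg2 hg1, hint, two_mul]
    have : ∫ θ in (0 : ℝ)..Real.pi, g θ ≤ ∫ θ in (0 : ℝ)..Real.pi, ρ (2 / Real.pi * θ) := by
      refine intervalIntegral.integral_mono_ae_restrict hpi.le hg1 hi ?_
      rw [← restrict_Ioc_eq_restrict_Icc]
      exact (ae_restrict_iff' measurableSet_Ioc).2 (Eventually.of_forall hle)
    linarith

theorem rpow_neg_antitoneOn {s : ℝ} (hs : 0 ≤ s) :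
    AntitoneOn (fun x : ℝ => x ^ (-s)) (Set.Ioi 0) := by
  intro x hx y _ hxy
  exact Real.rpow_le_rpow_of_nonpos hx hxy (neg_nonpos.2 hs)

/-- The weakly singular kernels `|w - ξ|^{-s}`, `0 ≤ s < 1`, are integrable uniformly in `w`. -/
theorem circleInt_rpow {s : ℝ} (hs : 0 ≤ s) (hs1 : s < 1) :
    (∀ w : Circle, CircleInt (fun ξ => |dist w ξ| ^ (-s))) ∧
      ∃ K : ℝ, 0 ≤ K ∧ ∀ w : Circle,
        (2 * Real.pi)⁻¹ * ∫ θ in (0 : ℝ)..(2 * Real.pi), |dist w (Circle.exp θ)| ^ (-s) ≤ K := by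
  have hpi := Real.pi_pos
  have hi : IntervalIntegrable (fun θ => |2 / Real.pi * θ| ^ (-s)) volume 0 Real.pi := by
    have h1 : IntervalIntegrable (fun x : ℝ => x ^ (-s)) volume 0 2 :=
      intervalIntegral.intervalIntegrable_rpow' (by linarith)
    have h2 := h1.comp_mul_left (c := 2 / Real.pi)
    have e1 : (2 : ℝ) / (2 / Real.pi) = Real.pi := by field_simp
    rw [zero_div, e1] at h2
    refine h2.congr fun θ hθ => ?_
    rw [Set.uIoc_of_le hpi.le] at hθ
    have : 0 < 2 / Real.pi * θ := mul_pos (by positivity) hθ.1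
    simp only [abs_of_pos this]
  have key := fun w => circleInt_radial (ρ := fun x => |x| ^ (-s)) (by fun_prop)
    (fun x => by positivity) (by
      intro x hx y hy hxy
      simp only [abs_of_pos (Set.mem_Ioi.1 hx), abs_of_pos (Set.mem_Ioi.1 hy)]
      exact rpow_neg_antitoneOn hs hx hy hxy) hi w
  refine ⟨fun w => (key w).1, (2 * Real.pi)⁻¹ * (2 * ∫ θ in (0 : ℝ)..Real.pi,
    |2 / Real.pi * θ| ^ (-s)), ?_, fun w => ?_⟩
  · refine mul_nonneg (by positivity) (mul_nonneg zero_le_two ?_)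
    exact intervalIntegral.integral_nonneg hpi.le fun θ _ => by positivity
  · exact mul_le_mul_of_nonneg_left (key w).2 (by positivity)

/-! ### Hölder bounds -/

/-- `g` is bounded by `A` and `α`-Hölder with constant `A`. Working with one real constant keeps
the estimates of products and quotients algebraic. -/
def HolderBound {E : Type*} [NormedAddCommGroup E] (α A : ℝ) (g : Circle → E) : Prop :=
  (∀ w, ‖g w‖ ≤ A) ∧ ∀ w w', ‖g w - g w'‖ ≤ A * dist w w' ^ α

namespace HolderBound

variable {E : Type*} [NormedAddCommGroup E] {α A B : ℝ}

theorem nonneg {g : Circle → E} (h : HolderBound α A g) : 0 ≤ A :=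
  (norm_nonneg _).trans (h.1 1)

theorem mono {g : Circle → E} (h : HolderBound α A g) (hAB : A ≤ B) : HolderBound α B g :=
  ⟨fun w => (h.1 w).trans hAB, fun w w' => (h.2 w w').trans
    (mul_le_mul_of_nonneg_right hAB (Real.rpow_nonneg dist_nonneg _))⟩

theorem add {g k : Circle → E} (hg : HolderBound α A g) (hk : HolderBound α B k) :
    HolderBound α (A + B) (fun w => g w + k w) := by
  refine ⟨fun w => (norm_add_le _ _).trans (add_le_add (hg.1 w) (hk.1 w)), fun w w' => ?_⟩
  rw [add_sub_add_comm, add_mul]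
  exact (norm_add_le _ _).trans (add_le_add (hg.2 w w') (hk.2 w w'))

theorem neg {g : Circle → E} (hg : HolderBound α A g) : HolderBound α A (fun w => -g w) := by
  refine ⟨fun w => by rw [norm_neg]; exact hg.1 w, fun w w' => ?_⟩
  rw [← neg_sub', norm_neg]
  exact hg.2 w w'

theorem sub {g k : Circle → E} (hg : HolderBound α A g) (hk : HolderBound α B k) :
    HolderBound α (A + B) (fun w => g w - k w) := by
  simpa only [sub_eq_add_neg] using hg.add hk.neg

theorem mul {g k : Circle → ℂ} (hg : HolderBound α A g) (hk : HolderBound α B k) :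
    HolderBound α (2 * A * B) (fun w => g w * k w) := by
  have hA := hg.nonneg
  have hB := hk.nonneg
  refine ⟨fun w => ?_, fun w w' => ?_⟩
  · rw [norm_mul]
    calc _ ≤ A * B := mul_le_mul (hg.1 w) (hk.1 w) (norm_nonneg _) hA
      _ ≤ _ := by nlinarith [mul_nonneg hA hB]
  · have e : g w * k w - g w' * k w' = g w * (k w - k w') + (g w - g w') * k w' := by ring
    have hd : 0 ≤ dist w w' ^ α := Real.rpow_nonneg dist_nonneg _
    rw [e]
    refine (norm_add_le _ _).trans ?_
    rw [norm_mul, norm_mul]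
    have h1 := mul_le_mul (hg.1 w) (hk.2 w w') (norm_nonneg _) hA
    have h2 := mul_le_mul (hg.2 w w') (hk.1 w') (norm_nonneg _) (mul_nonneg hA hd)
    nlinarith

theorem const (c : ℂ) : HolderBound α ‖c‖ (fun _ => c) := by
  refine ⟨fun _ => le_rfl, fun w w' => ?_⟩
  rw [sub_self, norm_zero]
  exact mul_nonneg (norm_nonneg _) (Real.rpow_nonneg dist_nonneg _)

theorem conj {g : Circle → ℂ} (hg : HolderBound α A g) :
    HolderBound α A (fun w => (starRingEnd ℂ) (g w)) := by
  refine ⟨fun w => by rw [RCLike.norm_conj]; exact hg.1 w, fun w w' => ?_⟩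
  rw [← map_sub, RCLike.norm_conj]
  exact hg.2 w w'

theorem im {g : Circle → ℂ} (hg : HolderBound α A g) : HolderBound α A (fun w => (g w).im) := by
  refine ⟨fun w => (Complex.abs_im_le_norm _).trans (hg.1 w), fun w w' => ?_⟩
  rw [← Complex.sub_im]
  exact (Complex.abs_im_le_norm _).trans (hg.2 w w')

theorem ofReal {g : Circle → ℝ} (hg : HolderBound α A g) :
    HolderBound α A (fun w => (g w : ℂ)) := by
  refine ⟨fun w => by rw [Complex.norm_real]; exact hg.1 w, fun w w' => ?_⟩
  rw [← Complex.ofReal_sub, Complex.norm_real]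
  exact hg.2 w w'

theorem inv {g : Circle → ℂ} (hg : HolderBound α A g) {c : ℝ} (hc : 0 < c)
    (h : ∀ w, c ≤ ‖g w‖) : HolderBound α (1 / c + A / c ^ 2) (fun w => (g w)⁻¹) := by
  have hA := hg.nonneg
  have hi : ∀ w, ‖(g w)⁻¹‖ ≤ 1 / c := fun w => by
    rw [norm_inv, one_div]
    exact inv_anti₀ hc (h w)
  refine ⟨fun w => (hi w).trans (by have : 0 ≤ A / c ^ 2 := by positivity
                                    linarith), fun w w' => ?_⟩
  have h0 : ∀ w, g w ≠ 0 := fun w => norm_pos_iff.1 (hc.trans_le (h w))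
  have e : (g w)⁻¹ - (g w')⁻¹ = (g w)⁻¹ * (g w')⁻¹ * (g w' - g w) := by
    have := h0 w
    have := h0 w'
    field_simp
  have hd : 0 ≤ dist w w' ^ α := Real.rpow_nonneg dist_nonneg _
  rw [e, norm_mul, norm_mul, norm_sub_rev]
  have h1 : ‖(g w)⁻¹‖ * ‖(g w')⁻¹‖ ≤ 1 / c * (1 / c) :=
    mul_le_mul (hi w) (hi w') (norm_nonneg _) (by positivity)
  have h2 := mul_le_mul h1 (hg.2 w w') (norm_nonneg _) (by positivity)
  refine h2.trans ?_
  have h3 : 1 / c * (1 / c) * (A * dist w w' ^ α) = A / c ^ 2 * dist w w' ^ α := by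
    field_simp
  rw [h3]
  refine mul_le_mul_of_nonneg_right ?_ hd
  have : 0 ≤ 1 / c := by positivity
  linarith

theorem of_lipschitz (hα0 : 0 ≤ α) (hα1 : α ≤ 1) {g : Circle → E} (h1 : ∀ w, ‖g w‖ ≤ A)
    (h2 : ∀ w w', ‖g w - g w'‖ ≤ A * dist w w') : HolderBound α (2 * A) g := by
  have hA : 0 ≤ A := (norm_nonneg _).trans (h1 1)
  refine ⟨fun w => (h1 w).trans (by linarith), fun w w' => (h2 w w').trans ?_⟩
  rw [mul_right_comm, mul_comm]
  refine mul_le_mul_of_nonneg_right ?_ hA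
  have h3 := circle_dist_le_two w w'
  have h0 : (0 : ℝ) ≤ dist w w' := dist_nonneg
  have h4 : dist w w' / 2 ≤ (dist w w' / 2) ^ α :=
    Real.self_le_rpow_of_le_one (by positivity) (by linarith) hα1
  have h5 : (dist w w' / 2) ^ α ≤ dist w w' ^ α :=
    Real.rpow_le_rpow (by positivity) (by linarith) hα0
  linarith

theorem coe (hα0 : 0 ≤ α) (hα1 : α ≤ 1) : HolderBound α 2 (fun w : Circle => (w : ℂ)) := by
  have := of_lipschitz (A := 1) hα0 hα1 (g := fun w : Circle => (w : ℂ)) (fun w => (Circle.norm_coe w).le)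
    (fun w w' => by rw [circle_dist, one_mul])
  simpa using this

theorem inv_coe (hα0 : 0 ≤ α) (hα1 : α ≤ 1) :
    HolderBound α 2 (fun w : Circle => (w : ℂ)⁻¹) := by
  have := (coe hα0 hα1).conj
  simpa only [← Circle.coe_inv_eq_conj, Circle.coe_inv] using this

theorem continuous (hα : 0 < α) {g : Circle → E} (h : HolderBound α A g) : Continuous g := by
  rw [continuous_iff_continuousAt]
  intro w
  rw [ContinuousAt, tendsto_iff_norm_sub_tendsto_zero]
  have h1 : Tendsto (fun w' : Circle => A * dist w' w ^ α) (𝓝 w) (𝓝 (A * dist w w ^ α)) := by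
    refine Tendsto.const_mul _ (Tendsto.rpow_const ?_ (Or.inr hα.le))
    exact (continuous_id.dist continuous_const).tendsto w
  rw [dist_self, Real.zero_rpow hα.ne', mul_zero] at h1
  exact squeeze_zero (fun _ => norm_nonneg _) (fun w' => h.2 w' w) h1

theorem holderWith {α : ℝ≥0} {g : Circle → E} (h : HolderBound α A g) :
    HolderWith A.toNNReal α g := by
  intro w w'
  rw [edist_dist, edist_dist, ENNReal.ofReal_rpow_of_nonneg dist_nonneg α.coe_nonneg,
    ← ENNReal.ofReal, ← ENNReal.ofReal_mul h.nonneg, dist_eq_norm]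
  exact ENNReal.ofReal_le_ofReal (h.2 w w')

theorem memHolder {α : ℝ≥0} {g : Circle → E} (h : HolderBound α A g) : MemHolder α g :=
  ⟨_, h.holderWith⟩

theorem holderENorm_le {α : ℝ≥0} {g : Circle → E} (h : HolderBound α A g) :
    holderENorm α g ≤ ENNReal.ofReal (2 * A) := by
  rw [two_mul, ENNReal.ofReal_add h.nonneg h.nonneg]
  refine add_le_add (iSup_le fun w => ?_) h.holderWith.eHolderNorm_le
  rw [← ofReal_norm]
  exact ENNReal.ofReal_le_ofReal (h.1 w)

theorem of_holderENorm_ne_top {α : ℝ≥0} {g : Circle → E} (h : holderENorm α g ≠ ⊤) :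
    HolderBound α (holderENorm α g).toReal g := by
  have h1 : (⨆ w, ‖g w‖ₑ) ≤ holderENorm α g := le_self_add
  have h2 : eHolderNorm α g ≤ holderENorm α g := le_add_self
  refine ⟨fun w => ?_, fun w w' => ?_⟩
  · have h3 : ‖g w‖ₑ ≤ holderENorm α g := (le_iSup (fun w => ‖g w‖ₑ) w).trans h1
    have := ENNReal.toReal_mono h h3
    simpa using this
  · have h3 : MemHolder α g := eHolderNorm_ne_top.1 (ne_top_of_le_ne_top h h2)
    have h4 := h3.holderWith.dist_le w w'
    rw [dist_eq_norm] at h4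
    refine h4.trans (mul_le_mul_of_nonneg_right ?_ (Real.rpow_nonneg dist_nonneg _))
    exact ENNReal.toReal_mono h h2

end HolderBound

theorem exists_holderBound {E : Type*} [NormedAddCommGroup E] {α : ℝ≥0} {g : Circle → E}
    (hc : Continuous g) (hg : MemHolder α g) : ∃ A, HolderBound α A g := by
  obtain ⟨C, hC⟩ := hg
  obtain ⟨B, hB⟩ := isCompact_univ.exists_bound_of_continuousOn hc.continuousOn
  refine ⟨max B C, fun w => (hB w trivial).trans (le_max_left _ _), fun w w' => ?_⟩
  have h4 := hC.dist_le w w'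
  rw [dist_eq_norm] at h4
  exact h4.trans (mul_le_mul_of_nonneg_right (le_max_right _ _) (Real.rpow_nonneg dist_nonneg _))

/-! ### Kernels of order zero -/

/-- A kernel `k(w, ξ)` which is bounded and whose increment in `w` is controlled by
`|w - w'| / |w - ξ|`. Such kernels form an algebra, closed under conjugation and under inversion
away from zero, and the corresponding operators map bounded functions to Hölder functions. -/
structure KernelBound (A : ℝ) (k : Circle → Circle → ℂ) : Prop where
  meas : ∀ w, CircleMeas (k w)
  bound : ∀ w ξ, ‖k w ξ‖ ≤ A
  diff : ∀ w w' ξ, ξ ≠ w → ‖k w ξ - k w' ξ‖ ≤ A * (dist w w' / dist w ξ)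

namespace KernelBound

variable {A B : ℝ} {k l : Circle → Circle → ℂ}

theorem nonneg (h : KernelBound A k) : 0 ≤ A := (norm_nonneg _).trans (h.bound 1 1)

theorem mono (h : KernelBound A k) (hAB : A ≤ B) : KernelBound B k :=
  ⟨h.meas, fun w ξ => (h.bound w ξ).trans hAB, fun w w' ξ hξ => (h.diff w w' ξ hξ).trans
    (mul_le_mul_of_nonneg_right hAB (by positivity))⟩

theorem add (hk : KernelBound A k) (hl : KernelBound B l) :
    KernelBound (A + B) (fun w ξ => k w ξ + l w ξ) := by
  refine ⟨fun w => (hk.meas w).add (hl.meas w),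
    fun w ξ => (norm_add_le _ _).trans (add_le_add (hk.bound w ξ) (hl.bound w ξ)),
    fun w w' ξ hξ => ?_⟩
  rw [add_sub_add_comm, add_mul]
  exact (norm_add_le _ _).trans (add_le_add (hk.diff w w' ξ hξ) (hl.diff w w' ξ hξ))

theorem neg (hk : KernelBound A k) : KernelBound A (fun w ξ => -k w ξ) := by
  refine ⟨fun w => (hk.meas w).neg, fun w ξ => by rw [norm_neg]; exact hk.bound w ξ,
    fun w w' ξ hξ => ?_⟩
  rw [← neg_sub', norm_neg]
  exact hk.diff w w' ξ hξ

theorem sub (hk : KernelBound A k) (hl : KernelBound B l) :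
    KernelBound (A + B) (fun w ξ => k w ξ - l w ξ) := by
  simpa only [sub_eq_add_neg] using hk.add hl.neg

theorem mul (hk : KernelBound A k) (hl : KernelBound B l) :
    KernelBound (2 * A * B) (fun w ξ => k w ξ * l w ξ) := by
  have hA := hk.nonneg
  have hB := hl.nonneg
  refine ⟨fun w => (hk.meas w).mul (hl.meas w), fun w ξ => ?_, fun w w' ξ hξ => ?_⟩
  · rw [norm_mul]
    calc _ ≤ A * B := mul_le_mul (hk.bound w ξ) (hl.bound w ξ) (norm_nonneg _) hA
      _ ≤ _ := by nlinarith [mul_nonneg hA hB]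
  · have e : k w ξ * l w ξ - k w' ξ * l w' ξ =
        k w ξ * (l w ξ - l w' ξ) + (k w ξ - k w' ξ) * l w' ξ := by ring
    have hd : 0 ≤ dist w w' / dist w ξ := by positivity
    rw [e]
    refine (norm_add_le _ _).trans ?_
    rw [norm_mul, norm_mul]
    have h1 := mul_le_mul (hk.bound w ξ) (hl.diff w w' ξ hξ) (norm_nonneg _) hA
    have h2 := mul_le_mul (hk.diff w w' ξ hξ) (hl.bound w' ξ) (norm_nonneg _) (mul_nonneg hA hd)
    nlinarith

theorem conj (hk : KernelBound A k) : KernelBound A (fun w ξ => (starRingEnd ℂ) (k w ξ)) := by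
  refine ⟨fun w => ?_, fun w ξ => by rw [RCLike.norm_conj]; exact hk.bound w ξ,
    fun w w' ξ hξ => ?_⟩
  · exact Complex.continuous_conj.measurable.comp (hk.meas w)
  · rw [← map_sub, RCLike.norm_conj]
    exact hk.diff w w' ξ hξ

theorem inv (hk : KernelBound A k) {c : ℝ} (hc : 0 < c) (h : ∀ w ξ, c ≤ ‖k w ξ‖) :
    KernelBound (1 / c + A / c ^ 2) (fun w ξ => (k w ξ)⁻¹) := by
  have hA := hk.nonneg
  have hi : ∀ w ξ, ‖(k w ξ)⁻¹‖ ≤ 1 / c := fun w ξ => by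
    rw [norm_inv, one_div]
    exact inv_anti₀ hc (h w ξ)
  refine ⟨fun w => (hk.meas w).inv, fun w ξ => (hi w ξ).trans (by
    have : 0 ≤ A / c ^ 2 := by positivity
    linarith), fun w w' ξ hξ => ?_⟩
  have h0 : ∀ w ξ, k w ξ ≠ 0 := fun w ξ => norm_pos_iff.1 (hc.trans_le (h w ξ))
  have e : (k w ξ)⁻¹ - (k w' ξ)⁻¹ = (k w ξ)⁻¹ * (k w' ξ)⁻¹ * (k w' ξ - k w ξ) := by
    have := h0 w ξ
    have := h0 w' ξ
    field_simp
  have hd : 0 ≤ dist w w' / dist w ξ := by positivity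
  rw [e, norm_mul, norm_mul, norm_sub_rev]
  have h1 : ‖(k w ξ)⁻¹‖ * ‖(k w' ξ)⁻¹‖ ≤ 1 / c * (1 / c) :=
    mul_le_mul (hi w ξ) (hi w' ξ) (norm_nonneg _) (by positivity)
  have h2 := mul_le_mul h1 (hk.diff w w' ξ hξ) (norm_nonneg _) (by positivity)
  refine h2.trans ?_
  have h3 : 1 / c * (1 / c) * (A * (dist w w' / dist w ξ)) =
      A / c ^ 2 * (dist w w' / dist w ξ) := by
    ring
  rw [h3]
  refine mul_le_mul_of_nonneg_right ?_ hd
  have : 0 ≤ 1 / c := by positivity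
  linarith

/-- Kernels that are Lipschitz in the first variable; the factor `2` is the diameter of the
circle. -/
theorem of_lipschitz (hm : ∀ w, CircleMeas (k w)) (hb : ∀ w ξ, ‖k w ξ‖ ≤ A)
    (hd : ∀ w w' ξ, ‖k w ξ - k w' ξ‖ ≤ A * dist w w') : KernelBound (2 * A) k := by
  have hA : 0 ≤ A := (norm_nonneg _).trans (hb 1 1)
  refine ⟨hm, fun w ξ => (hb w ξ).trans (by linarith), fun w w' ξ hξ => (hd w w' ξ).trans ?_⟩
  have h0 : 0 < dist w ξ := dist_pos.2 hξ.symm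
  rw [mul_div_assoc', le_div_iff₀ h0]
  have h1 := circle_dist_le_two w ξ
  have h2 : 0 ≤ A * dist w w' := by positivity
  nlinarith

/-- The difference quotient of a Lipschitz function. -/
theorem quotient {f : Circle → ℂ} {ℓ : ℝ} (hm : CircleMeas f) (h0 : 0 ≤ ℓ)
    (hf : ∀ w ξ, ‖f ξ - f w‖ ≤ ℓ * dist w ξ) :
    KernelBound (2 * ℓ) (fun w ξ => (f ξ - f w) / ((ξ : ℂ) - w)) := by
  have hb : ∀ w ξ : Circle, ‖(f ξ - f w) / ((ξ : ℂ) - w)‖ ≤ ℓ := by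
    intro w ξ
    rcases eq_or_ne ξ w with rfl | h
    · simpa using h0
    · have h1 : 0 < dist w ξ := dist_pos.2 h.symm
      rw [norm_div, norm_sub_rev (ξ : ℂ), ← circle_dist, div_le_iff₀ h1]
      exact hf w ξ
  refine ⟨fun w => ?_, fun w ξ => (hb w ξ).trans (by linarith), fun w w' ξ hξ => ?_⟩
  · refine Measurable.div (hm.sub measurable_const) (Measurable.sub ?_ measurable_const)
    exact (continuous_circle_coe.comp Circle.exp.continuous).measurable
  · have h1 : (ξ : ℂ) - w ≠ 0 := sub_ne_zero.2 fun h => hξ (Circle.coe_injective h)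
    have e : (f ξ - f w) / ((ξ : ℂ) - w) - (f ξ - f w') / ((ξ : ℂ) - w') =
        (f w' - f w) / ((ξ : ℂ) - w) +
          (f ξ - f w') / ((ξ : ℂ) - w') * (((w : ℂ) - w') / ((ξ : ℂ) - w)) := by
      rcases eq_or_ne ξ w' with rfl | h
      · simp
      · have h2 : (ξ : ℂ) - w' ≠ 0 := sub_ne_zero.2 fun h' => h (Circle.coe_injective h')
        field_simp
        ring
    rw [e]
    refine (norm_add_le _ _).trans ?_
    have e1 : ‖(ξ : ℂ) - w‖ = dist w ξ := by rw [norm_sub_rev, circle_dist]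
    rw [norm_mul, norm_div _ ((ξ : ℂ) - w), norm_div _ ((ξ : ℂ) - w), e1, ← circle_dist w w']
    have h3 : 0 < dist w ξ := dist_pos.2 hξ.symm
    have h4 : ‖f w' - f w‖ / dist w ξ ≤ ℓ * (dist w w' / dist w ξ) := by
      rw [mul_div_assoc']
      exact div_le_div_of_nonneg_right (hf w w') h3.le
    have h5 := mul_le_mul_of_nonneg_right (hb w' ξ) (by positivity : 0 ≤ dist w w' / dist w ξ)
    linarith

/-- Averaging against a kernel of order zero maps bounded functions to Hölder functions. The
increment of the kernel is at most `2A (|w - w'| / |w - ξ|)^α`, which is integrable in `ξ`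
because `α < 1`. -/
theorem exists_operator_bound {α : ℝ} (hα0 : 0 ≤ α) (hα1 : α < 1) :
    ∃ K : ℝ, 0 ≤ K ∧ ∀ (A B : ℝ) (k : Circle → Circle → ℂ) (φ : Circle → ℂ), KernelBound A k →
      CircleMeas φ → (∀ ξ, ‖φ ξ‖ ≤ B) →
        HolderBound α (K * A * B) (fun w => circleMean fun ξ => k w ξ * φ ξ) := by
  obtain ⟨hint, K, hK0, hK⟩ := circleInt_rpow hα0 hα1
  refine ⟨1 + 2 * K, by positivity, fun A B k φ hk hφm hφ => ?_⟩
  have hA := hk.nonneg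
  have hB : 0 ≤ B := (norm_nonneg _).trans (hφ 1)
  have hAB := mul_nonneg hA hB
  have hb : ∀ w ξ, ‖k w ξ * φ ξ‖ ≤ A * B := fun w ξ => by
    rw [norm_mul]
    exact mul_le_mul (hk.bound w ξ) (hφ ξ) (norm_nonneg _) hA
  have hi : ∀ w, CircleInt fun ξ => k w ξ * φ ξ := fun w =>
    CircleInt.of_bounded ((hk.meas w).mul hφm) (hb w)
  refine ⟨fun w => (norm_circleMean_le_of_bounded (hb w)).trans ?_, fun w w' => ?_⟩
  · nlinarith [mul_nonneg hK0 hAB]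
  · have hd : 0 ≤ dist w w' ^ α := Real.rpow_nonneg dist_nonneg _
    rw [← circleMean_sub (hi w) (hi w')]
    have h1 : ∀ ξ, ξ ≠ w → ‖k w ξ * φ ξ - k w' ξ * φ ξ‖ ≤
        2 * A * B * dist w w' ^ α * |dist w ξ| ^ (-α) := by
      intro ξ hξ
      have h3 : 0 < dist w ξ := dist_pos.2 hξ.symm
      have h4 : ‖k w ξ - k w' ξ‖ ≤ 2 * A * (dist w w' / dist w ξ) ^ α := by
        rcases le_total (dist w w' / dist w ξ) 1 with h | h
        · have h5 := Real.self_le_rpow_of_le_one (by positivity) h hα1.le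
          have h6 := hk.diff w w' ξ hξ
          have h7 := mul_le_mul_of_nonneg_left h5 hA
          have h8 : 0 ≤ A * (dist w w' / dist w ξ) ^ α := by positivity
          linarith
        · have h5 := Real.one_le_rpow h hα0
          have h6 := (norm_sub_le (k w ξ) (k w' ξ)).trans
            (add_le_add (hk.bound w ξ) (hk.bound w' ξ))
          nlinarith
      rw [← sub_mul, norm_mul]
      have h5 := mul_le_mul h4 (hφ ξ) (norm_nonneg _) (by positivity)
      refine h5.trans (le_of_eq ?_)
      rw [Real.div_rpow dist_nonneg dist_nonneg, abs_of_pos h3, Real.rpow_neg h3.le]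
      ring
    have h2 := norm_circleMean_le (ρ := fun ξ => 2 * A * B * dist w w' ^ α * |dist w ξ| ^ (-α))
      w ((hint w).const_mul (2 * A * B * dist w w' ^ α)) h1
    refine h2.trans ?_
    rw [intervalIntegral.integral_const_mul]
    have h3 := mul_le_mul_of_nonneg_left (hK w)
      (by positivity : 0 ≤ 2 * A * B * dist w w' ^ α)
    have h4 : 0 ≤ A * B * dist w w' ^ α := by positivity
    nlinarith

end KernelBound

/-! ### Differentiation along the circle -/

/-- `h'` is the complex derivative of `h` along the circle, at every point. -/
def HasCircleDeriv (h h' : Circle → ℂ) : Prop :=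
  ∀ w : Circle, HasDerivAt (fun θ : ℝ => h (w * Circle.exp θ)) (h' w * (Complex.I * (w : ℂ))) 0

theorem I_mul_coe_ne_zero (w : Circle) : Complex.I * (w : ℂ) ≠ 0 :=
  mul_ne_zero Complex.I_ne_zero (Circle.coe_ne_zero w)

theorem hasCircleDeriv_of_angular {h h' : Circle → ℂ}
    (H : ∀ θ : ℝ, HasDerivAt (fun θ : ℝ => h (Circle.exp θ))
      (h' (Circle.exp θ) * (Complex.I * (Circle.exp θ : ℂ))) θ) : HasCircleDeriv h h' := by
  intro w
  have h1 := H (w : ℂ).arg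
  rw [← add_zero (w : ℂ).arg] at h1
  have h2 := h1.comp_const_add (w : ℂ).arg 0
  simpa only [Circle.exp_add, Circle.exp_arg, Circle.exp_zero, mul_one] using h2

namespace HasCircleDeriv

variable {h h' k k' : Circle → ℂ}

theorem angular (H : HasCircleDeriv h h') (θ : ℝ) :
    HasDerivAt (fun θ : ℝ => h (Circle.exp θ))
      (h' (Circle.exp θ) * (Complex.I * (Circle.exp θ : ℂ))) θ := by
  have h1 := H (Circle.exp θ)
  rw [← sub_self θ] at h1
  have h2 := h1.comp_sub_const θ θ
  simpa only [← Circle.exp_add, add_sub_cancel] using h2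

theorem circleDeriv_eq (H : HasCircleDeriv h h') : circleDeriv h = h' := by
  funext w
  rw [circleDeriv, (H w).deriv, mul_div_assoc, div_self (I_mul_coe_ne_zero w), mul_one]

theorem of_differentiable
    (H : ∀ w : Circle, DifferentiableAt ℝ (fun θ : ℝ => h (w * Circle.exp θ)) 0) :
    HasCircleDeriv h (circleDeriv h) := by
  intro w
  rw [circleDeriv, div_mul_cancel₀ _ (I_mul_coe_ne_zero w)]
  exact (H w).hasDerivAt

theorem differentiable (H : HasCircleDeriv h h') (w : Circle) :
    DifferentiableAt ℝ (fun θ : ℝ => h (w * Circle.exp θ)) 0 := (H w).differentiableAt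

theorem add (H : HasCircleDeriv h h') (K : HasCircleDeriv k k') :
    HasCircleDeriv (fun w => h w + k w) (fun w => h' w + k' w) := by
  intro w
  rw [add_mul]
  exact (H w).add (K w)

theorem const (c : ℂ) : HasCircleDeriv (fun _ => c) (fun _ => 0) := by
  intro w
  rw [zero_mul]
  exact hasDerivAt_const _ _

theorem mul (H : HasCircleDeriv h h') (K : HasCircleDeriv k k') :
    HasCircleDeriv (fun w => h w * k w) (fun w => h' w * k w + h w * k' w) := by
  intro w
  refine ((H w).mul (K w)).congr_deriv ?_
  simp only [Circle.exp_zero, mul_one]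
  ring

theorem const_mul (c : ℂ) (H : HasCircleDeriv h h') :
    HasCircleDeriv (fun w => c * h w) (fun w => c * h' w) := by
  simpa using (const c).mul H

theorem inv (H : HasCircleDeriv h h') (h0 : ∀ w, h w ≠ 0) :
    HasCircleDeriv (fun w => (h w)⁻¹) (fun w => -h' w / h w ^ 2) := by
  intro w
  refine ((H w).fun_inv (by simpa using h0 w)).congr_deriv ?_
  simp only [Circle.exp_zero, mul_one]
  ring

theorem coe : HasCircleDeriv (fun w => (w : ℂ)) (fun _ => 1) := by
  refine hasCircleDeriv_of_angular fun θ => ?_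
  simp only [Circle.coe_exp, one_mul]
  have h1 : HasDerivAt (fun θ : ℝ => (θ : ℂ) * Complex.I) Complex.I θ := by
    simpa using (Complex.ofRealCLM.hasDerivAt (x := θ)).mul_const Complex.I
  convert h1.cexp using 1
  ring

theorem continuous (H : HasCircleDeriv h h') : Continuous h := by
  rw [continuous_iff_continuousAt]
  intro w
  have h1 : ContinuousAt (fun z : Circle => h (Circle.exp ((z / w : Circle) : ℂ).arg * w)) w := by
    have h2 : ContinuousAt (fun θ : ℝ => h (w * Circle.exp θ)) 0 := (H w).continuousAt
    have h3 : ContinuousAt (fun z : Circle => ((z / w : Circle) : ℂ).arg) w := by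
      refine ContinuousAt.comp (f := fun z : Circle => ((z / w : Circle) : ℂ)) (g := Complex.arg)
        (x := w) ?_ ?_
      · refine Complex.continuousAt_arg ?_
        rw [div_self', Circle.coe_one]
        exact Complex.one_mem_slitPlane
      · exact (continuous_circle_coe.comp (continuous_id.div' continuous_const)).continuousAt
    have h4 : ((w / w : Circle) : ℂ).arg = 0 := by
      rw [div_self', Circle.coe_one, Complex.arg_one]
    rw [← h4] at h2
    have h5 := ContinuousAt.comp (x := w) h2 h3
    simpa only [Function.comp_def, mul_comm w] using h5
  simpa only [Circle.exp_arg, div_mul_cancel] using h1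

/-- The average of a derivative vanishes. -/
theorem circleMean_eq_zero (H : HasCircleDeriv h h') (hc : Continuous h') : circleMean h' = 0 := by
  rw [circleMean, intervalIntegral.integral_eq_sub_of_hasDerivAt (fun θ _ => H.angular θ)]
  · simp [Circle.exp_two_pi]
  · refine Continuous.intervalIntegrable ?_ _ _
    have h1 := hc.comp Circle.exp.continuous
    have h2 := continuous_circle_coe.comp Circle.exp.continuous
    exact h1.mul (continuous_const.mul h2)

/-- The mean value inequality; the chord is at least `2 / π` times the arc. -/
theorem lipschitz (H : HasCircleDeriv h h') {B : ℝ} (hB : ∀ w, ‖h' w‖ ≤ B) (w ξ : Circle) :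
    ‖h ξ - h w‖ ≤ Real.pi / 2 * B * dist w ξ := by
  have hB0 : 0 ≤ B := (norm_nonneg _).trans (hB 1)
  set φ := ((ξ / w : Circle) : ℂ).arg with hφ
  have e : ξ = w * Circle.exp φ := by rw [hφ, Circle.exp_arg, mul_div_cancel]
  have hd : ∀ θ : ℝ, HasDerivAt (fun θ : ℝ => h (w * Circle.exp θ))
      (h' (w * Circle.exp θ) * (Complex.I * ((w * Circle.exp θ : Circle) : ℂ))) θ := by
    intro θ
    have h1 := H.angular ((w : ℂ).arg + θ)
    have h2 := h1.comp_const_add (w : ℂ).arg θ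
    simpa only [Circle.exp_add, Circle.exp_arg] using h2
  have h1 := Convex.norm_image_sub_le_of_norm_hasDerivWithin_le (s := Set.univ)
    (x := (0 : ℝ)) (y := φ) (C := B) (fun θ _ => (hd θ).hasDerivWithinAt) (fun θ _ => by
      rw [norm_mul, norm_mul, Circle.norm_coe, Complex.norm_I, mul_one, mul_one]
      exact hB _) convex_univ trivial trivial
  rw [← e, Circle.exp_zero, mul_one, sub_zero] at h1
  have h2 : 2 / Real.pi * |φ| ≤ dist w ξ := by
    have h3 := two_div_pi_mul_le_dist (φ := 0) (θ := φ)
      (by rw [sub_zero]; exact Complex.abs_arg_le_pi _)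
    rw [sub_zero] at h3
    refine h3.trans (le_of_eq ?_)
    rw [e, circle_dist, circle_dist, Circle.exp_zero, Circle.coe_one, Circle.coe_mul,
      ← mul_one_sub, norm_mul, Circle.norm_coe, one_mul]
  refine h1.trans ?_
  rw [Real.norm_eq_abs]
  have hpi := Real.pi_pos
  rw [div_mul_eq_mul_div, div_le_iff₀ hpi] at h2
  have := mul_le_mul_of_nonneg_left h2 hB0
  linarith

/-- A function with bounded derivative is Hölder. -/
theorem holderBound (H : HasCircleDeriv h h') {α N : ℝ} (hα0 : 0 ≤ α) (hα1 : α ≤ 1)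
    (hN : ∀ w, ‖h w‖ ≤ N) (hN' : ∀ w, ‖h' w‖ ≤ N) : HolderBound α (Real.pi * N) h := by
  have h0 : 0 ≤ N := (norm_nonneg _).trans (hN 1)
  have h2 := Real.pi_gt_three
  have := HolderBound.of_lipschitz (A := Real.pi / 2 * N) hα0 hα1 (g := h)
    (fun w => (hN w).trans (by nlinarith)) (fun w w' => by
      rw [norm_sub_rev]
      exact H.lipschitz hN' w w')
  exact this.mono (le_of_eq (by ring))

end HasCircleDeriv

theorem IsC1Holder.hasCircleDeriv {α : ℝ≥0} {h : Circle → ℂ} (hh : IsC1Holder α h) :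
    HasCircleDeriv h (circleDeriv h) := HasCircleDeriv.of_differentiable hh.1

theorem HasCircleDeriv.isC1Holder {α : ℝ≥0} {A : ℝ} {h h' : Circle → ℂ} (H : HasCircleDeriv h h')
    (hb : HolderBound α A h') : IsC1Holder α h :=
  ⟨H.differentiable, by rw [H.circleDeriv_eq]; exact hb.memHolder⟩

theorem IsC1Holder.continuous_deriv {α : ℝ≥0} (hα : 0 < α) {h : Circle → ℂ}
    (hh : IsC1Holder α h) : Continuous (circleDeriv h) := by
  obtain ⟨C, hC⟩ := hh.2
  exact hC.continuous hα

theorem IsC1Holder.c1HolderENorm_ne_top {α : ℝ≥0} (hα : 0 < α) {h : Circle → ℂ}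
    (hh : IsC1Holder α h) : c1HolderENorm α h ≠ ⊤ := by
  obtain ⟨A, hA⟩ := exists_holderBound (hh.continuous_deriv hα) hh.2
  obtain ⟨B, hB⟩ := isCompact_univ.exists_bound_of_continuousOn
    hh.hasCircleDeriv.continuous.continuousOn
  refine ENNReal.add_ne_top.2 ⟨?_, ne_top_of_le_ne_top ENNReal.ofReal_ne_top hA.holderENorm_le⟩
  refine ne_top_of_le_ne_top (b := ENNReal.ofReal B) ENNReal.ofReal_ne_top (iSup_le fun w => ?_)
  rw [← ofReal_norm]
  exact ENNReal.ofReal_le_ofReal (hB w trivial)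

theorem IsC1Holder.norm_le {α : ℝ≥0} (hα : 0 < α) {h : Circle → ℂ} (hh : IsC1Holder α h)
    (w : Circle) : ‖h w‖ ≤ (c1HolderENorm α h).toReal := by
  have h1 : ‖h w‖ₑ ≤ c1HolderENorm α h := (le_iSup (fun w => ‖h w‖ₑ) w).trans le_self_add
  simpa using ENNReal.toReal_mono (hh.c1HolderENorm_ne_top hα) h1

theorem IsC1Holder.holderBound_deriv {α : ℝ≥0} (hα : 0 < α) {h : Circle → ℂ}
    (hh : IsC1Holder α h) : HolderBound α (c1HolderENorm α h).toReal (circleDeriv h) := by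
  have h1 : holderENorm α (circleDeriv h) ≤ c1HolderENorm α h := le_add_self
  have h2 := hh.c1HolderENorm_ne_top hα
  exact (HolderBound.of_holderENorm_ne_top (ne_top_of_le_ne_top h2 h1)).mono
    (ENNReal.toReal_mono h2 h1)

/-! ### Expansion of the functional at the ellipse -/

theorem CircleMeas.of_continuous {f : Circle → ℂ} (hf : Continuous f) : CircleMeas f :=
  (hf.comp Circle.exp.continuous).measurable

/-- The derivative `1 - Q / w²` of the parametrization of the ellipse. -/
noncomputable def ellipseDeriv (Q : ℝ) (w : Circle) : ℂ := 1 - (Q : ℂ) * ((w : ℂ) ^ 2)⁻¹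

theorem hasCircleDeriv_inv_coe :
    HasCircleDeriv (fun w => (w : ℂ)⁻¹) (fun w => -((w : ℂ) ^ 2)⁻¹) := by
  have := HasCircleDeriv.coe.inv fun w => Circle.coe_ne_zero w
  simpa only [neg_div, one_div] using this

theorem hasCircleDeriv_ellipse (Q : ℝ) : HasCircleDeriv (ellipse Q) (ellipseDeriv Q) := by
  have h1 := HasCircleDeriv.coe.add (hasCircleDeriv_inv_coe.const_mul (Q : ℂ))
  have e1 : ellipse Q = fun w : Circle => (w : ℂ) + (Q : ℂ) * (w : ℂ)⁻¹ := by
    funext w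
    rw [ellipse, div_eq_mul_inv]
  have e2 : ellipseDeriv Q = fun w : Circle => (1 : ℂ) + (Q : ℂ) * -((w : ℂ) ^ 2)⁻¹ := by
    funext w
    rw [ellipseDeriv]
    ring
  rw [e1, e2]
  exact h1

theorem continuous_inv_coe : Continuous fun w : Circle => (w : ℂ)⁻¹ :=
  continuous_circle_coe.inv₀ fun w => Circle.coe_ne_zero w

theorem continuous_ellipseDeriv (Q : ℝ) : Continuous (ellipseDeriv Q) := by
  have h1 := continuous_circle_coe
  have h2 : Continuous fun w : Circle => ((w : ℂ) ^ 2)⁻¹ :=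
    (h1.pow 2).inv₀ fun w => pow_ne_zero 2 (Circle.coe_ne_zero w)
  unfold ellipseDeriv
  fun_prop

/-- `1 / (ξ w)`; on the circle, `conj ξ - conj w = -(ξ - w) / (ξ w)`. -/
noncomputable def invProd (w ξ : Circle) : ℂ := (ξ : ℂ)⁻¹ * (w : ℂ)⁻¹

/-- The difference quotient `1 - Q / (ξ w)` of the parametrization of the ellipse. -/
noncomputable def ellipseQuot (Q : ℝ) (w ξ : Circle) : ℂ := 1 - (Q : ℂ) * invProd w ξ

/-- The difference quotient of `f`, with value `0` on the diagonal. -/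
noncomputable def diffQuot (f : Circle → ℂ) (w ξ : Circle) : ℂ := (f ξ - f w) / ((ξ : ℂ) - w)

/-- The kernel `conj(Φ(ξ) - Φ(w)) / (Φ(ξ) - Φ(w))` of the ellipse `Φ`. -/
noncomputable def kern0 (Q : ℝ) (w ξ : Circle) : ℂ :=
  -(invProd w ξ * ((starRingEnd ℂ) (ellipseQuot Q w ξ) * (ellipseQuot Q w ξ)⁻¹))

/-- The part of the kernel which is linear in the perturbation `f`. -/
noncomputable def kern1 (Q : ℝ) (f : Circle → ℂ) (w ξ : Circle) : ℂ :=
  -(invProd w ξ * ((starRingEnd ℂ) (diffQuot f w ξ) * (ellipseQuot Q w ξ)⁻¹ -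
    (starRingEnd ℂ) (ellipseQuot Q w ξ) * diffQuot f w ξ *
      ((ellipseQuot Q w ξ)⁻¹ * (ellipseQuot Q w ξ)⁻¹)))

/-- The remainder of the kernel, which is quadratic in the perturbation `f`. -/
noncomputable def kern2 (Q : ℝ) (f : Circle → ℂ) (w ξ : Circle) : ℂ :=
  -(invProd w ξ * (diffQuot f w ξ *
    ((starRingEnd ℂ) (ellipseQuot Q w ξ) * diffQuot f w ξ -
      ellipseQuot Q w ξ * (starRingEnd ℂ) (diffQuot f w ξ)) *
    ((ellipseQuot Q w ξ)⁻¹ * (ellipseQuot Q w ξ)⁻¹) * (ellipseQuot Q w ξ + diffQuot f w ξ)⁻¹))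

theorem conj_coe (w : Circle) : (starRingEnd ℂ) (w : ℂ) = (w : ℂ)⁻¹ := by
  rw [← Circle.coe_inv_eq_conj, Circle.coe_inv]

theorem coe_sub_ne_zero {w ξ : Circle} (h : ξ ≠ w) : (ξ : ℂ) - w ≠ 0 :=
  sub_ne_zero.2 fun h' => h (Circle.coe_injective h')

theorem norm_invProd (w ξ : Circle) : ‖invProd w ξ‖ = 1 := by
  rw [invProd, norm_mul, norm_inv, norm_inv, Circle.norm_coe, Circle.norm_coe]
  norm_num

theorem one_sub_le_norm_ellipseQuot {Q : ℝ} (hQ0 : 0 < Q) (w ξ : Circle) :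
    1 - Q ≤ ‖ellipseQuot Q w ξ‖ := by
  have h1 := norm_sub_norm_le (1 : ℂ) ((Q : ℂ) * invProd w ξ)
  rwa [norm_mul, norm_invProd, Complex.norm_real, Real.norm_of_nonneg hQ0.le, norm_one,
    mul_one] at h1

theorem ellipseQuot_ne_zero {Q : ℝ} (hQ0 : 0 < Q) (hQ1 : Q < 1) (w ξ : Circle) :
    ellipseQuot Q w ξ ≠ 0 := by
  have := one_sub_le_norm_ellipseQuot hQ0 w ξ
  exact norm_pos_iff.1 (by linarith)

theorem ellipse_sub (Q : ℝ) (w ξ : Circle) :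
    ellipse Q ξ - ellipse Q w = ((ξ : ℂ) - w) * ellipseQuot Q w ξ := by
  have h1 := Circle.coe_ne_zero w
  have h2 := Circle.coe_ne_zero ξ
  simp only [ellipse, ellipseQuot, invProd]
  field_simp
  ring

/-- The kernel is the sum of its constant, linear and quadratic parts. -/
theorem kernel_eq {Q : ℝ} (hQ0 : 0 < Q) (hQ1 : Q < 1) (f : Circle → ℂ) {w ξ : Circle} (h : ξ ≠ w)
    (hne : ellipseQuot Q w ξ + diffQuot f w ξ ≠ 0) :
    ((starRingEnd ℂ) (ellipse Q ξ + f ξ) - (starRingEnd ℂ) (ellipse Q w + f w)) /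
      ((ellipse Q ξ + f ξ) - (ellipse Q w + f w)) =
    kern0 Q w ξ + kern1 Q f w ξ + kern2 Q f w ξ := by
  have h1 := coe_sub_ne_zero h
  have h2 := ellipseQuot_ne_zero hQ0 hQ1 w ξ
  have e1 : (ellipse Q ξ + f ξ) - (ellipse Q w + f w) =
      ((ξ : ℂ) - w) * (ellipseQuot Q w ξ + diffQuot f w ξ) := by
    rw [mul_add, ← ellipse_sub, diffQuot, mul_div_cancel₀ _ h1]
    ring
  have e2 : (starRingEnd ℂ) ((ξ : ℂ) - w) = -(((ξ : ℂ) - w) * invProd w ξ) := by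
    have h3 := Circle.coe_ne_zero w
    have h4 := Circle.coe_ne_zero ξ
    rw [map_sub, conj_coe, conj_coe, invProd]
    field_simp
    ring
  rw [← map_sub, e1, map_mul, e2, map_add, kern0, kern1, kern2]
  generalize (starRingEnd ℂ) (ellipseQuot Q w ξ) = b
  generalize (starRingEnd ℂ) (diffQuot f w ξ) = v
  generalize ellipseQuot Q w ξ = a at *
  generalize diffQuot f w ξ = u at *
  generalize invProd w ξ = c at *
  generalize (ξ : ℂ) - w = d at *
  field_simp
  ring

theorem kernelBound_const (c : ℂ) : KernelBound ‖c‖ (fun _ _ => c) := by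
  refine ⟨fun _ => measurable_const, fun _ _ => le_rfl, fun w w' ξ _ => ?_⟩
  rw [sub_self, norm_zero]
  positivity

theorem kernelBound_invProd : KernelBound (2 * 1) invProd := by
  refine KernelBound.of_lipschitz (fun w => ?_) (fun w ξ => (norm_invProd w ξ).le)
    fun w w' ξ => ?_
  · exact CircleMeas.of_continuous (continuous_inv_coe.mul continuous_const)
  · rw [invProd, invProd, ← mul_sub, norm_mul, norm_inv, Circle.norm_coe, inv_one, ← conj_coe,
      ← conj_coe, ← map_sub, RCLike.norm_conj, circle_dist]

/-- The three parts of the kernel are of order zero, with constants that are of degree zero, one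
and two in the Lipschitz constant of the perturbation. -/
theorem exists_kern_bound {Q : ℝ} (hQ0 : 0 < Q) (hQ1 : Q < 1) :
    ∃ C : ℝ, 0 ≤ C ∧ KernelBound C (kern0 Q) ∧ ∀ (f : Circle → ℂ) (ℓ : ℝ), CircleMeas f →
      0 ≤ ℓ → (∀ w ξ, ‖f ξ - f w‖ ≤ ℓ * dist w ξ) →
        KernelBound (C * ℓ) (kern1 Q f) ∧
          (ℓ ≤ (1 - Q) / 4 → KernelBound (C * ℓ ^ 2) (kern2 Q f) ∧
            ∀ w ξ, ellipseQuot Q w ξ + diffQuot f w ξ ≠ 0) := by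
  have hE := kernelBound_invProd
  obtain ⟨a, ha⟩ : ∃ a, KernelBound a (ellipseQuot Q) :=
    ⟨_, (kernelBound_const 1).sub ((kernelBound_const (Q : ℂ)).mul hE)⟩
  obtain ⟨b, hb⟩ : ∃ b, KernelBound b (fun w ξ => (ellipseQuot Q w ξ)⁻¹) :=
    ⟨_, ha.inv (sub_pos.2 hQ1) (one_sub_le_norm_ellipseQuot hQ0)⟩
  have ha0 := ha.nonneg
  have hb0 := hb.nonneg
  set c : ℝ := (1 - Q) / 2 with hc
  have hc0 : 0 < c := by rw [hc]; linarith
  set e : ℝ := 1 / c + (a + 1) / c ^ 2 with he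
  have he0 : 0 ≤ e := by positivity
  set C0 : ℝ := 2 * (2 * 1) * (2 * a * b) with hC0
  set C1 : ℝ := 2 * (2 * 1) * (2 * 2 * b + 2 * (2 * a * 2) * (2 * b * b)) with hC1
  set C2 : ℝ := 2 * (2 * 1) * (2 * (2 * (2 * 2 * (2 * a * 2 + 2 * a * 2)) * (2 * b * b)) * e)
    with hC2
  have hC0' : 0 ≤ C0 := by positivity
  have hC1' : 0 ≤ C1 := by positivity
  have hC2' : 0 ≤ C2 := by positivity
  refine ⟨C0 + C1 + C2, by positivity, ?_, fun f ℓ hf hℓ hL => ?_⟩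
  · have h := (hE.mul (ha.conj.mul hb)).neg
    exact h.mono (by linarith)
  have hu : KernelBound (2 * ℓ) (diffQuot f) := KernelBound.quotient hf hℓ hL
  refine ⟨?_, fun hℓ1 => ?_⟩
  · have h := (hE.mul ((hu.conj.mul hb).sub ((ha.conj.mul hu).mul (hb.mul hb)))).neg
    refine h.mono ?_
    have e1 : 2 * (2 * 1) * (2 * (2 * ℓ) * b + 2 * (2 * a * (2 * ℓ)) * (2 * b * b)) = C1 * ℓ := by
      rw [hC1]; ring
    rw [e1]
    exact mul_le_mul_of_nonneg_right (by linarith) hℓ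
  · have hlow : ∀ w ξ, c ≤ ‖ellipseQuot Q w ξ + diffQuot f w ξ‖ := by
      intro w ξ
      have h1 := one_sub_le_norm_ellipseQuot hQ0 w ξ
      have h2 := hu.bound w ξ
      have h3 := norm_sub_norm_le (ellipseQuot Q w ξ) (-diffQuot f w ξ)
      rw [norm_neg, sub_neg_eq_add] at h3
      rw [hc]
      linarith
    refine ⟨?_, fun w ξ => norm_pos_iff.1 (hc0.trans_le (hlow w ξ))⟩
    have hs : KernelBound (a + 1) (fun w ξ => ellipseQuot Q w ξ + diffQuot f w ξ) :=
      (ha.add hu).mono (by linarith)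
    have hi := hs.inv hc0 hlow
    have h := (hE.mul (((hu.mul ((ha.conj.mul hu).sub (ha.mul hu.conj))).mul (hb.mul hb)).mul
      hi)).neg
    refine h.mono ?_
    have e1 : 2 * (2 * 1) * (2 * (2 * (2 * (2 * ℓ) * (2 * a * (2 * ℓ) + 2 * a * (2 * ℓ))) *
        (2 * b * b)) * (1 / c + (a + 1) / c ^ 2)) = C2 * ℓ ^ 2 := by
      rw [hC2, he]; ring
    rw [e1]
    exact mul_le_mul_of_nonneg_right (by linarith) (by positivity)

/-- The coefficient `2 Ω = (1 - Q²) / 2`, in the form in which it occurs in `G`. -/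
noncomputable def twoOmega (Q : ℝ) : ℂ := 2 * (((1 - Q ^ 2) / 4 : ℝ) : ℂ)

/-- The part of order zero of the bracket in the functional. -/
noncomputable def bracket0 (Q : ℝ) (w : Circle) : ℂ :=
  twoOmega Q * (starRingEnd ℂ) (ellipse Q w) +
    circleMean fun ξ => kern0 Q w ξ * ellipseDeriv Q ξ

/-- The part of order one of the bracket in the functional, for a perturbation `f` with
derivative `f'`. -/
noncomputable def bracket1 (Q : ℝ) (f f' : Circle → ℂ) (w : Circle) : ℂ :=
  twoOmega Q * (starRingEnd ℂ) (f w) +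
    ((circleMean fun ξ => kern1 Q f w ξ * ellipseDeriv Q ξ) +
      circleMean fun ξ => kern0 Q w ξ * f' ξ)

/-- The terms of order at least two of the bracket in the functional. -/
noncomputable def bracket2 (Q : ℝ) (f f' : Circle → ℂ) (w : Circle) : ℂ :=
  (circleMean fun ξ => kern1 Q f w ξ * f' ξ) +
    circleMean fun ξ => kern2 Q f w ξ * (ellipseDeriv Q ξ + f' ξ)

/-- The linear part in `f` of `F(Q, f)`, as it comes out of the expansion of the kernel. -/
noncomputable def linearPart (Q : ℝ) (f f' : Circle → ℂ) (w : Circle) : ℝ :=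
  ((bracket0 Q w * f' w + bracket1 Q f f' w * ellipseDeriv Q w) * (w : ℂ)).im

theorem F_eq {Q : ℝ} (hQ0 : 0 < Q) (hQ1 : Q < 1) {f f' : Circle → ℂ} (H : HasCircleDeriv f f')
    (hf' : Continuous f') {A0 A1 A2 : ℝ} (h0 : KernelBound A0 (kern0 Q))
    (h1 : KernelBound A1 (kern1 Q f)) (h2 : KernelBound A2 (kern2 Q f))
    (hne : ∀ w ξ, ellipseQuot Q w ξ + diffQuot f w ξ ≠ 0) (w : Circle) :
    F Q f w = ((bracket0 Q w + bracket1 Q f f' w + bracket2 Q f f' w) * (w : ℂ) *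
      (ellipseDeriv Q w + f' w)).im := by
  have hd : circleDeriv (fun ξ => ellipse Q ξ + f ξ) = fun ξ => ellipseDeriv Q ξ + f' ξ :=
    ((hasCircleDeriv_ellipse Q).add H).circleDeriv_eq
  have hc := continuous_ellipseDeriv Q
  have hi : ∀ {A : ℝ} {k : Circle → Circle → ℂ} {g : Circle → ℂ}, KernelBound A k →
      Continuous g → CircleInt fun ξ => k w ξ * g ξ := fun hk hg =>
    (CircleInt.of_bounded (hk.meas w) (hk.bound w)).mul_continuous hg
  have hc' : Continuous fun ξ => ellipseDeriv Q ξ + f' ξ := hc.add hf'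
  have e : (circleMean fun ξ => ((starRingEnd ℂ) (ellipse Q ξ + f ξ) -
      (starRingEnd ℂ) (ellipse Q w + f w)) / ((ellipse Q ξ + f ξ) - (ellipse Q w + f w)) *
        (ellipseDeriv Q ξ + f' ξ)) =
      (circleMean fun ξ => kern0 Q w ξ * ellipseDeriv Q ξ) +
      ((circleMean fun ξ => kern1 Q f w ξ * ellipseDeriv Q ξ) +
        circleMean fun ξ => kern0 Q w ξ * f' ξ) +
      ((circleMean fun ξ => kern1 Q f w ξ * f' ξ) +
        circleMean fun ξ => kern2 Q f w ξ * (ellipseDeriv Q ξ + f' ξ)) := by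
    rw [← circleMean_add (hi h1 hc) (hi h0 hf'), ← circleMean_add (hi h0 hc)
      ((hi h1 hc).add (hi h0 hf')), ← circleMean_add (hi h1 hf') (hi h2 hc'),
      ← circleMean_add ((hi h0 hc).add ((hi h1 hc).add (hi h0 hf')))
      ((hi h1 hf').add (hi h2 hc'))]
    refine circleMean_congr w fun ξ hξ => ?_
    rw [kernel_eq hQ0 hQ1 f hξ (hne w ξ)]
    ring
  simp only [F, G, hd, e]
  congr 1
  simp only [bracket0, bracket1, bracket2, twoOmega, map_add]
  ring

theorem kern1_zero (Q : ℝ) : kern1 Q 0 = 0 := by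
  funext w ξ
  simp [kern1, diffQuot]

theorem kern2_zero (Q : ℝ) : kern2 Q 0 = 0 := by
  funext w ξ
  simp [kern2, diffQuot]

theorem F_zero_eq {Q : ℝ} (hQ0 : 0 < Q) (hQ1 : Q < 1) (w : Circle) :
    F Q 0 w = (bracket0 Q w * (w : ℂ) * ellipseDeriv Q w).im := by
  obtain ⟨C, hC, h0, -⟩ := exists_kern_bound hQ0 hQ1
  have hz : KernelBound ‖(0 : ℂ)‖ 0 := kernelBound_const 0
  have h := F_eq hQ0 hQ1 (f := 0) (f' := 0) (HasCircleDeriv.const 0) continuous_const h0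
    (by rw [kern1_zero]; exact hz) (by rw [kern2_zero]; exact hz)
    (fun w ξ => by simpa [diffQuot] using ellipseQuot_ne_zero hQ0 hQ1 w ξ) w
  have hm : (circleMean fun _ => 0) = 0 := by simp [circleMean]
  simpa [bracket1, bracket2, kern1_zero, kern2_zero, hm] using h

/-- The linear part is bounded from `C^{1+α}` to `C^α`, and the remainder is quadratic. -/
theorem exists_expansion_bound {Q : ℝ} (hQ0 : 0 < Q) (hQ1 : Q < 1) {α : ℝ} (hα0 : 0 < α)
    (hα1 : α < 1) :
    ∃ C δ : ℝ, 0 ≤ C ∧ 0 < δ ∧ ∀ (f f' : Circle → ℂ) (N : ℝ), HasCircleDeriv f f' →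
      (∀ w, ‖f w‖ ≤ N) → HolderBound α N f' →
        HolderBound α (C * N) (linearPart Q f f') ∧
          (N ≤ δ → HolderBound α (C * N ^ 2)
            (fun w => F Q f w - F Q 0 w - linearPart Q f f' w)) := by
  obtain ⟨C, hC, h0, h12⟩ := exists_kern_bound hQ0 hQ1
  obtain ⟨K, hK, hop⟩ := KernelBound.exists_operator_bound hα0.le hα1
  have hc := continuous_ellipseDeriv Q
  have hpi := Real.pi_pos
  have hw : HolderBound α 2 (fun w : Circle => (w : ℂ)) := HolderBound.coe hα0.le hα1.le
  have hwi : HolderBound α 2 (fun w : Circle => (w : ℂ)⁻¹) := HolderBound.inv_coe hα0.le hα1.le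
  obtain ⟨E, hE⟩ : ∃ E, HolderBound α E (ellipse Q) :=
    ⟨_, hw.add ((HolderBound.const (Q : ℂ)).mul hwi)⟩
  obtain ⟨D, hD⟩ : ∃ D, HolderBound α D (ellipseDeriv Q) := by
    have := (HolderBound.const (α := α) (1 : ℂ)).sub
      ((HolderBound.const (Q : ℂ)).mul (hwi.mul hwi))
    simp only [← sq, inv_pow] at this
    exact ⟨_, this⟩
  have hE0 := hE.nonneg
  have hD0 := hD.nonneg
  obtain ⟨B0, hB0⟩ : ∃ B, HolderBound α B (bracket0 Q) :=
    ⟨_, ((HolderBound.const (twoOmega Q)).mul hE.conj).add (hop C D _ _ h0 (.of_continuous hc) hD.1)⟩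
  have hB00 := hB0.nonneg
  set t := ‖twoOmega Q‖ with ht
  have ht0 : 0 ≤ t := norm_nonneg _
  set B1 : ℝ := 2 * t * Real.pi + (K * (C * (Real.pi / 2)) * D + K * C) with hB1
  set B2 : ℝ := K * (C * (Real.pi / 2)) + K * (C * (Real.pi / 2) ^ 2) * (D + 1) with hB2
  have hB1' : 0 ≤ B1 := by positivity
  have hB2' : 0 ≤ B2 := by positivity
  set C1 : ℝ := 2 * (2 * B0 * 1 + 2 * B1 * D) * 2 with hC1
  set C2 : ℝ := 2 * (2 * B1 * 2 + 2 * B2 * (D + 1) * 2) with hC2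
  have hC1' : 0 ≤ C1 := by positivity
  have hC2' : 0 ≤ C2 := by positivity
  set δ : ℝ := min 1 ((1 - Q) / 4 / (Real.pi / 2)) with hδ
  have hδ0 : 0 < δ := lt_min one_pos (div_pos (by linarith) (by positivity))
  refine ⟨C1 + C2, δ, by positivity, hδ0, fun f f' N H hN hN' => ?_⟩
  have hN0 : 0 ≤ N := (norm_nonneg _).trans (hN 1)
  have hfc := H.continuous
  have hfc' := hN'.continuous hα0
  have hf := H.holderBound hα0.le hα1.le hN hN'.1
  obtain ⟨k1, k2⟩ := h12 f (Real.pi / 2 * N) (.of_continuous hfc) (by positivity)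
    (H.lipschitz hN'.1)
  have hb1 : HolderBound α (B1 * N) (bracket1 Q f f') := by
    have := ((HolderBound.const (twoOmega Q)).mul hf.conj).add
      ((hop _ D _ _ k1 (.of_continuous hc) hD.1).add (hop C N _ _ h0 (.of_continuous hfc') hN'.1))
    refine this.mono (le_of_eq ?_)
    rw [hB1]
    ring
  refine ⟨?_, fun hNδ => ?_⟩
  · have := (((hB0.mul hN').add (hb1.mul hD)).mul hw).im
    refine this.mono ?_
    have e : 2 * (2 * B0 * N + 2 * (B1 * N) * D) * 2 = C1 * N := by rw [hC1]; ring
    rw [e]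
    exact mul_le_mul_of_nonneg_right (by linarith) hN0
  · have hN1 : N ≤ 1 := hNδ.trans (min_le_left _ _)
    have hN2 : Real.pi / 2 * N ≤ (1 - Q) / 4 := by
      have := hNδ.trans (min_le_right _ _)
      rw [le_div_iff₀ (by positivity)] at this
      linarith
    obtain ⟨k2, hne⟩ := k2 hN2
    have hc' : Continuous fun w => ellipseDeriv Q w + f' w := hc.add hfc'
    have hD' : HolderBound α (D + 1) (fun w => ellipseDeriv Q w + f' w) :=
      (hD.add hN').mono (by linarith)
    have hb2 : HolderBound α (B2 * N ^ 2) (bracket2 Q f f') := by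
      have := (hop _ N _ _ k1 (.of_continuous hfc') hN'.1).add
        (hop _ (D + 1) _ _ k2 (.of_continuous hc') hD'.1)
      refine this.mono (le_of_eq ?_)
      rw [hB2]
      ring
    have key : ∀ w, F Q f w - F Q 0 w - linearPart Q f f' w =
        ((bracket1 Q f f' w * f' w + bracket2 Q f f' w * (ellipseDeriv Q w + f' w)) *
          (w : ℂ)).im := by
      intro w
      rw [F_eq hQ0 hQ1 H hfc' h0 k1 k2 hne, F_zero_eq hQ0 hQ1, linearPart, ← Complex.sub_im,
        ← Complex.sub_im]
      congr 1
      ring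
    simp only [key]
    have := (((hb1.mul hN').add (hb2.mul hD')).mul hw).im
    refine this.mono ?_
    have e : 2 * (2 * (B1 * N) * N + 2 * (B2 * N ^ 2) * (D + 1)) * 2 = C2 * N ^ 2 := by
      rw [hC2]; ring
    rw [e]
    exact mul_le_mul_of_nonneg_right (by linarith) (by positivity)

/-! ### Fourier series of Hölder functions -/

/-- The `n`-th complex Fourier coefficient. -/
noncomputable def fourierCoef (φ : Circle → ℂ) (n : ℤ) : ℂ :=
  circleMean fun ξ => φ ξ * (ξ : ℂ) ^ (-n - 1)

theorem continuous_coe_zpow (n : ℤ) : Continuous fun w : Circle => (w : ℂ) ^ n :=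
  continuous_circle_coe.zpow₀ n fun w => Or.inl (Circle.coe_ne_zero w)

theorem norm_coe_zpow (w : Circle) (n : ℤ) : ‖(w : ℂ) ^ n‖ = 1 := by
  rw [norm_zpow, Circle.norm_coe, one_zpow]

/-- The Riemann-Lebesgue lemma on the circle. -/
theorem tendsto_fourierCoef (φ : Circle → ℂ) :
    Tendsto (fun n : ℤ => fourierCoef φ n) cofinite (𝓝 0) := by
  have hpi := Real.pi_pos
  set f : ℝ → ℂ := (Set.Ioc 0 (2 * Real.pi)).indicator fun θ => φ (Circle.exp θ) with hf
  have h1 := Real.tendsto_integral_exp_smul_cocompact f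
  have h2 : Tendsto (fun n : ℤ => (n : ℝ) * (2 * Real.pi)⁻¹) cofinite (cocompact ℝ) :=
    (tendsto_cocompact_mul_right₀ (by positivity)).comp Int.tendsto_coe_cofinite
  have h3 := (h1.comp h2).const_mul (2 * (Real.pi : ℂ))⁻¹
  rw [mul_zero] at h3
  refine h3.congr fun n => ?_
  rw [fourierCoef, circleMean_eq, intervalIntegral.integral_of_le (by positivity),
    ← integral_indicator measurableSet_Ioc]
  simp only [Function.comp_def]
  congr 1
  refine integral_congr_ae (Eventually.of_forall fun θ => ?_)
  simp only [hf]
  by_cases hθ : θ ∈ Set.Ioc 0 (2 * Real.pi)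
  · rw [Set.indicator_of_mem hθ, Set.indicator_of_mem hθ, mul_assoc,
      ← zpow_add_one₀ (Circle.coe_ne_zero _), sub_add_cancel, Circle.smul_def, smul_eq_mul,
      mul_comm, Real.fourierChar_apply, Circle.coe_exp, ← Complex.exp_int_mul]
    congr 2
    push_cast
    field_simp
  · rw [Set.indicator_of_notMem hθ, Set.indicator_of_notMem hθ, smul_zero]

theorem HolderBound.norm_diffQuot_le {α A : ℝ} {φ : Circle → ℂ} (h : HolderBound α A φ)
    (w ξ : Circle) (hξ : ξ ≠ w) : ‖diffQuot φ w ξ‖ ≤ A * |dist w ξ| ^ (-(1 - α)) := by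
  have h1 : 0 < dist w ξ := dist_pos.2 hξ.symm
  have h2 := h.2 ξ w
  rw [dist_comm] at h2
  rw [diffQuot, norm_div, norm_sub_rev (ξ : ℂ), ← circle_dist, abs_of_pos h1,
    div_le_iff₀ h1, mul_assoc, ← Real.rpow_add_one h1.ne', neg_sub, sub_add_cancel]
  exact h2

theorem circleMeas_diffQuot {φ : Circle → ℂ} (h : Continuous φ) (w : Circle) :
    CircleMeas (diffQuot φ w) := by
  have h1 := (h.comp Circle.exp.continuous).measurable
  have h2 := (continuous_circle_coe.comp Circle.exp.continuous).measurable
  exact (h1.sub measurable_const).div (h2.sub measurable_const)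

theorem HolderBound.circleInt_diffQuot {α A : ℝ} (hα0 : 0 < α) (hα1 : α < 1) {φ : Circle → ℂ}
    (h : HolderBound α A φ) (w : Circle) : CircleInt (diffQuot φ w) := by
  have h1 := (circleInt_rpow (s := 1 - α) (by linarith) (by linarith)).1 w
  exact CircleInt.of_le w (circleMeas_diffQuot (h.continuous hα0) w) (h1.const_mul A)
    (h.norm_diffQuot_le w)

/-- The identity behind the convergence of Fourier series of Hölder functions: multiplied by
`w ^ n`, it makes the partial sums of the Fourier series of `φ` telescope. -/
theorem HolderBound.fourierCoef_eq {α A : ℝ} (hα0 : 0 < α) (hα1 : α < 1) {φ : Circle → ℂ}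
    (h : HolderBound α A φ) (w : Circle) (n : ℤ) :
    fourierCoef φ n = (if n = 0 then φ w else 0) +
      (fourierCoef (diffQuot φ w) (n - 1) - w * fourierCoef (diffQuot φ w) n) := by
  have hi := h.circleInt_diffQuot hα0 hα1 w
  have hz := continuous_coe_zpow
  have e0 : (if n = 0 then φ w else 0) = circleMean fun ξ => φ w * (ξ : ℂ) ^ (-n - 1) := by
    rw [circleMean_const_mul, circleMean_zpow]
    by_cases hn : n = 0
    · simp [hn]
    · rw [if_neg hn, if_neg (by omega), mul_zero]
  have i1 := hi.mul_continuous (hz (-(n - 1) - 1))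
  have i0 : CircleInt fun ξ => φ w * (ξ : ℂ) ^ (-n - 1) :=
    CircleInt.of_continuous (continuous_const.mul (hz _))
  have i2 := (hi.mul_continuous (hz (-n - 1))).mul_continuous (continuous_const (y := (w : ℂ)))
  rw [e0, mul_comm (w : ℂ), fourierCoef, fourierCoef, fourierCoef, ← circleMean_mul_const,
    ← circleMean_sub i1 i2,
    ← circleMean_add i0 (i1.sub i2)]
  refine circleMean_congr w fun ξ hξ => ?_
  have h1 : φ ξ = φ w + diffQuot φ w ξ * ((ξ : ℂ) - w) := by
    rw [diffQuot, div_mul_cancel₀ _ (coe_sub_ne_zero hξ)]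
    ring
  have h2 : (ξ : ℂ) ^ (-(n - 1) - 1) = (ξ : ℂ) ^ (-n - 1) * ξ := by
    rw [← zpow_add_one₀ (Circle.coe_ne_zero _)]
    congr 1
    ring
  rw [h2, h1]
  ring

theorem HolderBound.sum_fourierCoef {α A : ℝ} (hα0 : 0 < α) (hα1 : α < 1) {φ : Circle → ℂ}
    (h : HolderBound α A φ) (w : Circle) (N : ℕ) :
    ∑ n ∈ Finset.range (N + 1), fourierCoef φ n * (w : ℂ) ^ n =
      φ w + circleMean (diffQuot φ w) - w ^ (N + 1) * fourierCoef (diffQuot φ w) N := by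
  have e : circleMean (diffQuot φ w) = fourierCoef (diffQuot φ w) (-1) := by
    simp [fourierCoef]
  induction N with
  | zero =>
    rw [Finset.sum_range_one, h.fourierCoef_eq hα0 hα1 w, e]
    simp
    ring
  | succ N ih =>
    rw [Finset.sum_range_succ, ih, h.fourierCoef_eq hα0 hα1 w ((N + 1 : ℕ) : ℤ), if_neg (by omega)]
    have : ((N + 1 : ℕ) : ℤ) - 1 = N := by omega
    rw [this]
    ring

/-- The bounded pointwise convergence `∑_{n ≥ 1} c_n w^n = H(w)`, which is what integration term
by term needs; `c 0` plays no role. -/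
def BoundedSeries (c : ℕ → ℂ) (H : Circle → ℂ) : Prop :=
  (∀ w : Circle, Tendsto (fun N : ℕ => ∑ n ∈ Finset.range N, c (n + 1) * (w : ℂ) ^ (n + 1)) atTop
    (𝓝 (H w))) ∧
  ∃ C : ℝ, ∀ (w : Circle) (N : ℕ), ‖∑ n ∈ Finset.range N, c (n + 1) * (w : ℂ) ^ (n + 1)‖ ≤ C

/-- The nonnegative half of the Fourier series of a Hölder function `φ` converges boundedly to
`φ(w) + (2πi)⁻¹ ∫ (φ(ξ) - φ(w)) / (ξ - w) dξ`. -/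
theorem HolderBound.boundedSeries {α A : ℝ} (hα0 : 0 < α) (hα1 : α < 1) {φ : Circle → ℂ}
    (h : HolderBound α A φ) (h0 : fourierCoef φ 0 = 0) :
    BoundedSeries (fun n => fourierCoef φ n) fun w => φ w + circleMean (diffQuot φ w) := by
  have e : ∀ (w : Circle) (N : ℕ), ∑ n ∈ Finset.range N,
      fourierCoef φ ((n + 1 : ℕ) : ℤ) * (w : ℂ) ^ (n + 1) =
        φ w + circleMean (diffQuot φ w) - w ^ (N + 1) * fourierCoef (diffQuot φ w) N := by
    intro w N
    have := h.sum_fourierCoef hα0 hα1 w N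
    rw [Finset.sum_range_succ'] at this
    simpa [h0] using this
  obtain ⟨hi, K, hK0, hK⟩ := circleInt_rpow (s := 1 - α) (by linarith) (by linarith)
  have hb : ∀ (w : Circle) (n : ℤ), ‖fourierCoef (diffQuot φ w) n‖ ≤ A * K := by
    intro w n
    refine (norm_circleMean_le (ρ := fun ξ => A * |dist w ξ| ^ (-(1 - α))) w
      ((hi w).const_mul A) fun ξ hξ => ?_).trans ?_
    · rw [norm_mul, norm_coe_zpow, mul_one]
      exact h.norm_diffQuot_le w ξ hξ
    · rw [intervalIntegral.integral_const_mul, mul_left_comm]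
      exact mul_le_mul_of_nonneg_left (hK w) h.nonneg
  refine ⟨fun w => ?_, A + A * K + A * K, fun w N => ?_⟩
  · simp only [e]
    have h1 : Tendsto (fun N : ℕ => (w : ℂ) ^ (N + 1) * fourierCoef (diffQuot φ w) N) atTop
        (𝓝 0) := by
      have h2 := (tendsto_fourierCoef (diffQuot φ w)).comp
        (Nat.cofinite_eq_atTop ▸ Nat.cast_injective.tendsto_cofinite : Tendsto
          (fun N : ℕ => (N : ℤ)) atTop cofinite)
      rw [tendsto_zero_iff_norm_tendsto_zero] at h2 ⊢
      refine h2.congr fun N => ?_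
      rw [norm_mul, norm_pow, Circle.norm_coe, one_pow, one_mul, Function.comp]
    simpa using tendsto_const_nhds.sub h1
  · rw [e]
    refine (norm_sub_le _ _).trans (add_le_add ((norm_add_le _ _).trans
      (add_le_add (h.1 w) ?_)) ?_)
    · simpa [fourierCoef] using hb w (-1)
    · rw [norm_mul, norm_pow, Circle.norm_coe, one_pow, one_mul]
      exact hb w N

/-- The Cauchy integral of the difference quotient vanishes for functions without negative
frequencies. -/
theorem HolderBound.circleMean_diffQuot_eq_zero {α A : ℝ} (hα0 : 0 < α) (hα1 : α < 1)
    {φ : Circle → ℂ} (h : HolderBound α A φ) (hneg : ∀ n : ℤ, n < 0 → fourierCoef φ n = 0)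
    (w : Circle) : circleMean (diffQuot φ w) = 0 := by
  have e : circleMean (diffQuot φ w) = fourierCoef (diffQuot φ w) (-1) := by
    simp [fourierCoef]
  have h1 : ∀ k : ℕ, ‖fourierCoef (diffQuot φ w) (-1 - (k : ℤ))‖ = ‖circleMean (diffQuot φ w)‖ := by
    intro k
    induction k with
    | zero => simp [e]
    | succ k ih =>
      have h2 := h.fourierCoef_eq hα0 hα1 w (-1 - (k : ℤ))
      rw [hneg _ (by omega), if_neg (by omega), zero_add, eq_comm, sub_eq_zero] at h2
      rw [← ih, show (-1 - ((k + 1 : ℕ) : ℤ)) = -1 - (k : ℤ) - 1 by push_cast; ring, h2, norm_mul,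
        Circle.norm_coe, one_mul]
  have h2 : Function.Injective fun k : ℕ => -1 - (k : ℤ) := fun a b hab => by
    simp only at hab
    omega
  have h3 := ((tendsto_fourierCoef (diffQuot φ w)).comp
    (Nat.cofinite_eq_atTop ▸ h2.tendsto_cofinite : Tendsto (fun k : ℕ => -1 - (k : ℤ)) atTop
      cofinite)).norm
  simp only [Function.comp_def, h1, norm_zero] at h3
  exact norm_eq_zero.1 (tendsto_nhds_unique tendsto_const_nhds h3)

theorem HolderBound.circleMean_diffQuot_eq_neg {α A : ℝ} (hα0 : 0 < α) (hα1 : α < 1)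
    {φ : Circle → ℂ} (h : HolderBound α A φ) (hpos : ∀ n : ℕ, fourierCoef φ n = 0)
    (w : Circle) : circleMean (diffQuot φ w) = -φ w := by
  have h1 := (h.boundedSeries hα0 hα1 (hpos 0)).1 w
  simp only [hpos, zero_mul, Finset.sum_const_zero] at h1
  have := tendsto_nhds_unique tendsto_const_nhds h1
  linear_combination -this

namespace BoundedSeries

variable {c d : ℕ → ℂ} {H K : Circle → ℂ}

theorem add (hH : BoundedSeries c H) (hK : BoundedSeries d K) :
    BoundedSeries (fun n => c n + d n) fun w => H w + K w := by
  obtain ⟨h1, C, hC⟩ := hH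
  obtain ⟨k1, D, hD⟩ := hK
  refine ⟨fun w => ?_, C + D, fun w N => ?_⟩
  · simpa only [add_mul, Finset.sum_add_distrib] using (h1 w).add (k1 w)
  · simp only [add_mul, Finset.sum_add_distrib]
    exact (norm_add_le _ _).trans (add_le_add (hC w N) (hD w N))

theorem const_mul (a : ℂ) (hH : BoundedSeries c H) :
    BoundedSeries (fun n => a * c n) fun w => a * H w := by
  obtain ⟨h1, C, hC⟩ := hH
  refine ⟨fun w => ?_, ‖a‖ * C, fun w N => ?_⟩
  · simpa only [mul_assoc, Finset.mul_sum] using (h1 w).const_mul a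
  · simp only [mul_assoc, ← Finset.mul_sum]
    rw [norm_mul]
    exact mul_le_mul_of_nonneg_left (hC w N) (norm_nonneg _)

theorem congr (hH : BoundedSeries c H) (hcd : ∀ n, c (n + 1) = d (n + 1)) : BoundedSeries d H := by
  simpa only [BoundedSeries, hcd] using hH

theorem of_summable (hc : Summable fun n => ‖c (n + 1)‖)
    (hH : ∀ w : Circle, HasSum (fun n => c (n + 1) * (w : ℂ) ^ (n + 1)) (H w)) :
    BoundedSeries c H := by
  refine ⟨fun w => (hH w).tendsto_sum_nat, ∑' n, ‖c (n + 1)‖, fun w N => ?_⟩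
  refine (norm_sum_le _ _).trans ?_
  simp only [norm_mul, norm_pow, Circle.norm_coe, one_pow, mul_one]
  exact hc.sum_le_tsum _ fun _ _ => norm_nonneg _

/-- If `∑ c_n w^n = H(w)` boundedly with `H` continuous, then `∑ (c_n / n) w^n` is an
antiderivative of `H(w) / w`. -/
theorem hasCircleDeriv (hH : BoundedSeries c H) (hc : Continuous H) {P : Circle → ℂ}
    (hP : ∀ w : Circle, HasSum (fun n : ℕ => c (n + 1) / (n + 1) * (w : ℂ) ^ (n + 1)) (P w)) :
    HasCircleDeriv P fun w => H w * (w : ℂ)⁻¹ := by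
  obtain ⟨h1, C, hC⟩ := hH
  have hcont : Continuous fun t : ℝ => Complex.I * H (Circle.exp t) :=
    continuous_const.mul (hc.comp Circle.exp.continuous)
  have hsum : ∀ N, Continuous fun t : ℝ => Complex.I * ∑ n ∈ Finset.range N,
      c (n + 1) * (Circle.exp t : ℂ) ^ (n + 1) := by
    intro N
    have := continuous_circle_coe.comp Circle.exp.continuous
    simp only [Function.comp_def] at this
    fun_prop
  have hterm : ∀ (N : ℕ) (θ : ℝ), ∫ t in (0 : ℝ)..θ, Complex.I * ∑ n ∈ Finset.range N,
      c (n + 1) * (Circle.exp t : ℂ) ^ (n + 1) =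
        (∑ n ∈ Finset.range N, c (n + 1) / (n + 1) * (Circle.exp θ : ℂ) ^ (n + 1)) -
          ∑ n ∈ Finset.range N, c (n + 1) / (n + 1) * ((1 : Circle) : ℂ) ^ (n + 1) := by
    intro N θ
    have hd : ∀ t : ℝ, HasDerivAt (fun t : ℝ => ∑ n ∈ Finset.range N,
        c (n + 1) / (n + 1) * (Circle.exp t : ℂ) ^ (n + 1))
        (Complex.I * ∑ n ∈ Finset.range N, c (n + 1) * (Circle.exp t : ℂ) ^ (n + 1)) t := by
      intro t
      rw [Finset.mul_sum]
      refine HasDerivAt.fun_sum fun n _ => ?_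
      have h2 := ((HasCircleDeriv.coe.angular t).fun_pow (n + 1)).const_mul
        (c (n + 1) / ((n : ℂ) + 1))
      refine h2.congr_deriv ?_
      have : (n : ℂ) + 1 ≠ 0 := by exact_mod_cast n.succ_ne_zero
      push_cast
      field_simp
      simp [pow_succ, mul_assoc]
    rw [intervalIntegral.integral_eq_sub_of_hasDerivAt (fun t _ => hd t)
      ((hsum N).intervalIntegrable _ _), Circle.exp_zero]
  have hint : ∀ θ : ℝ, P (Circle.exp θ) =
      P 1 + ∫ t in (0 : ℝ)..θ, Complex.I * H (Circle.exp t) := by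
    intro θ
    have h2 : Tendsto (fun N : ℕ => ∫ t in (0 : ℝ)..θ, Complex.I * ∑ n ∈ Finset.range N,
        c (n + 1) * (Circle.exp t : ℂ) ^ (n + 1)) atTop
        (𝓝 (∫ t in (0 : ℝ)..θ, Complex.I * H (Circle.exp t))) := by
      refine intervalIntegral.tendsto_integral_filter_of_dominated_convergence (fun _ => C)
        (Eventually.of_forall fun N => (hsum N).aestronglyMeasurable)
        (Eventually.of_forall fun N => Eventually.of_forall fun t _ => ?_)
        intervalIntegrable_const (Eventually.of_forall fun t _ => (h1 _).const_mul _)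
      rw [norm_mul, Complex.norm_I, one_mul]
      exact hC _ _
    simp only [hterm] at h2
    have h3 := (hP (Circle.exp θ)).tendsto_sum_nat.sub (hP 1).tendsto_sum_nat
    have h4 := tendsto_nhds_unique h2 h3
    rw [h4]
    ring
  refine hasCircleDeriv_of_angular fun θ => ?_
  have h2 := (intervalIntegral.integral_hasDerivAt_right (hcont.intervalIntegrable 0 θ)
    hcont.stronglyMeasurable.stronglyMeasurableAtFilter hcont.continuousAt).const_add (P 1)
  refine (h2.congr_of_eventuallyEq (Eventually.of_forall hint)).congr_deriv ?_
  have := Circle.coe_ne_zero (Circle.exp θ)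
  field_simp

end BoundedSeries

/-! ### Sine series -/

theorem eMode_exp (n : ℕ) (θ : ℝ) : eMode n (Circle.exp θ) = Real.sin (n * θ) := by
  rw [eMode, Circle.coe_exp, ← Complex.exp_nat_mul, ← mul_assoc, ← Complex.ofReal_natCast,
    ← Complex.ofReal_mul, Complex.exp_ofReal_mul_I_im]

theorem continuous_eMode (n : ℕ) : Continuous (eMode n) :=
  Complex.continuous_im.comp (continuous_circle_coe.pow n)

theorem abs_eMode_le (n : ℕ) (w : Circle) : |eMode n w| ≤ 1 := by
  refine (Complex.abs_im_le_norm _).trans ?_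
  rw [norm_pow, Circle.norm_coe, one_pow]

theorem integral_cos_int_mul (m : ℤ) :
    ∫ θ in (0 : ℝ)..(2 * Real.pi), Real.cos (m * θ) = if m = 0 then 2 * Real.pi else 0 := by
  split_ifs with hm
  · simp [hm]
  · have h0 : (m : ℝ) ≠ 0 := by exact_mod_cast hm
    rw [intervalIntegral.integral_comp_mul_left (fun x => Real.cos x) h0, integral_cos, mul_zero,
      Real.sin_zero, sub_zero, ← mul_assoc, show (m : ℝ) * 2 * Real.pi = ((2 * m : ℤ) : ℝ) *
        Real.pi by push_cast; ring, Real.sin_int_mul_pi, smul_zero]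

theorem integral_eMode_mul_eMode {n k : ℕ} (hn : 1 ≤ n) :
    ∫ θ in (0 : ℝ)..(2 * Real.pi), eMode n (Circle.exp θ) * eMode k (Circle.exp θ) =
      if n = k then Real.pi else 0 := by
  have e : ∀ θ : ℝ, eMode n (Circle.exp θ) * eMode k (Circle.exp θ) =
      (Real.cos (((n - k : ℤ) : ℝ) * θ) - Real.cos (((n + k : ℤ) : ℝ) * θ)) / 2 := by
    intro θ
    rw [eMode_exp, eMode_exp]
    push_cast
    rw [sub_mul, add_mul, Real.cos_sub, Real.cos_add]
    ring
  have hi : ∀ m : ℤ, IntervalIntegrable (fun θ : ℝ => Real.cos (m * θ)) volume 0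
      (2 * Real.pi) := fun m => Continuous.intervalIntegrable (by fun_prop) _ _
  simp only [e]
  rw [intervalIntegral.integral_div, intervalIntegral.integral_sub (hi _) (hi _),
    integral_cos_int_mul, integral_cos_int_mul, if_neg (by omega : ¬ ((n : ℤ) + k = 0))]
  by_cases h : n = k
  · simp [h]
  · rw [if_neg (by omega), if_neg h]
    simp

theorem BoundedSeries.hasSineSeries {c : ℕ → ℝ} {H : Circle → ℂ}
    (hH : BoundedSeries (fun n => (c n : ℂ)) H) : HasSineSeries c fun w => (H w).im := by
  obtain ⟨h1, C, hC⟩ := hH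
  have e : ∀ (w : Circle) (N : ℕ),
      (∑ n ∈ Finset.range N, (c (n + 1) : ℂ) * (w : ℂ) ^ (n + 1)).im =
        ∑ n ∈ Finset.range N, c (n + 1) * eMode (n + 1) w := by
    intro w N
    rw [Complex.im_sum]
    exact Finset.sum_congr rfl fun n _ => Complex.im_ofReal_mul _ _
  have h2 : ∀ w : Circle, Tendsto (fun N : ℕ => ∑ n ∈ Finset.range N, c (n + 1) * eMode (n + 1) w)
      atTop (𝓝 (H w).im) := by
    intro w
    simpa only [Function.comp_def, e] using (Complex.continuous_im.tendsto _).comp (h1 w)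
  refine ⟨h2, fun k hk => ?_⟩
  have hcm : ∀ n, Continuous fun θ : ℝ => eMode n (Circle.exp θ) := fun n =>
    (continuous_eMode n).comp Circle.exp.continuous
  have h3 : Tendsto (fun N : ℕ => ∫ θ in (0 : ℝ)..(2 * Real.pi),
      (∑ n ∈ Finset.range N, c (n + 1) * eMode (n + 1) (Circle.exp θ)) * eMode k (Circle.exp θ))
      atTop (𝓝 (∫ θ in (0 : ℝ)..(2 * Real.pi), (H (Circle.exp θ)).im * eMode k (Circle.exp θ))) := by
    refine intervalIntegral.tendsto_integral_filter_of_dominated_convergence (fun _ => C)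
      (Eventually.of_forall fun N => Continuous.aestronglyMeasurable (by fun_prop))
      (Eventually.of_forall fun N => Eventually.of_forall fun θ _ => ?_)
      intervalIntegrable_const (Eventually.of_forall fun θ _ => (h2 _).mul_const _)
    rw [norm_mul, ← e]
    have h4 := (Complex.abs_im_le_norm _).trans (hC (Circle.exp θ) N)
    calc _ ≤ C * 1 := mul_le_mul h4 (abs_eMode_le _ _) (abs_nonneg _)
          ((norm_nonneg _).trans (hC 1 0))
      _ = C := mul_one C
  have h4 : ∀ᶠ N : ℕ in atTop, ∫ θ in (0 : ℝ)..(2 * Real.pi),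
      (∑ n ∈ Finset.range N, c (n + 1) * eMode (n + 1) (Circle.exp θ)) * eMode k (Circle.exp θ) =
        c k * Real.pi := by
    filter_upwards [eventually_ge_atTop k] with N hN
    simp only [Finset.sum_mul, mul_assoc]
    rw [intervalIntegral.integral_finsetSum fun n _ =>
      Continuous.intervalIntegrable (by fun_prop) _ _]
    simp only [intervalIntegral.integral_const_mul]
    rw [Finset.sum_eq_single (k - 1)]
    · rw [integral_eMode_mul_eMode (by omega), if_pos (by omega)]
      congr 2
      omega
    · intro n _ hn
      rw [integral_eMode_mul_eMode (by omega), if_neg (by omega), mul_zero]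
    · intro h
      exact absurd (Finset.mem_range.2 (by omega)) h
  have h5 := tendsto_nhds_unique (h3.congr' h4) tendsto_const_nhds
  have := Real.pi_ne_zero
  rw [h5]
  field_simp

theorem HasSineSeries.unique {c d : ℕ → ℝ} {g k : Circle → ℝ} (hg : HasSineSeries c g)
    (hk : HasSineSeries d k) (h : ∀ n, 1 ≤ n → c n = d n) : g = k := by
  funext w
  refine tendsto_nhds_unique (hg.1 w) ?_
  have := hk.1 w
  simpa only [h _ (Nat.le_add_left 1 _)] using this

theorem HasSineSeries.coef_eq {c d : ℕ → ℝ} {g : Circle → ℝ} (hc : HasSineSeries c g)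
    (hd : HasSineSeries d g) {n : ℕ} (hn : 1 ≤ n) : c n = d n := by
  rw [← hc.2 n hn, hd.2 n hn]

/-! ### Absolutely convergent series and Cauchy integrals -/

/-- The absolutely convergent expansion `p(w) = ∑_{n ≥ 1} c_n w^n`; `c 0` plays no role. -/
def AbsSeries (c : ℕ → ℂ) (p : Circle → ℂ) : Prop :=
  (Summable fun n => ‖c (n + 1)‖) ∧
    ∀ w : Circle, HasSum (fun n => c (n + 1) * (w : ℂ) ^ (n + 1)) (p w)

theorem circleMean_cauchy {z : ℂ} (hz : ‖z‖ < 1) (n : ℤ) :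
    (circleMean fun ξ => ((ξ : ℂ) - z)⁻¹ * (ξ : ℂ) ^ n) = if 0 ≤ n then z ^ n.toNat else 0 := by
  have h1 := circleMean_hasSum (c := fun k => z ^ k) (e := fun k ξ => (ξ : ℂ) ^ (-(k : ℤ) - 1))
    (f := fun ξ => ((ξ : ℂ) - z)⁻¹) (ρ := fun ξ => (ξ : ℂ) ^ n)
    (by simpa using summable_geometric_of_lt_one (norm_nonneg z) hz)
    (fun k => continuous_coe_zpow _) (fun k ξ => (norm_coe_zpow _ _).le) (fun ξ => by
      have h0 := Circle.coe_ne_zero ξ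
      have h2 : ‖z / (ξ : ℂ)‖ < 1 := by rwa [norm_div, Circle.norm_coe, div_one]
      have h3 := (hasSum_geometric_of_norm_lt_one h2).mul_right (ξ : ℂ)⁻¹
      have e : (1 - z / (ξ : ℂ))⁻¹ * (ξ : ℂ)⁻¹ = ((ξ : ℂ) - z)⁻¹ := by
        rw [← mul_inv, sub_mul, one_mul, div_mul_cancel₀ _ h0]
      rw [e] at h3
      refine h3.congr_fun fun k => ?_
      rw [div_pow, zpow_sub_one₀ h0, zpow_neg, zpow_natCast, div_eq_mul_inv, mul_assoc])
    (continuous_coe_zpow n)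
  have e : ∀ k : ℕ, z ^ k * (circleMean fun ξ => (ξ : ℂ) ^ (-(k : ℤ) - 1) * (ξ : ℂ) ^ n) =
      if 0 ≤ n ∧ k = n.toNat then z ^ n.toNat else 0 := by
    intro k
    simp only [← zpow_add₀ (Circle.coe_ne_zero _), circleMean_zpow]
    by_cases hk : 0 ≤ n ∧ k = n.toNat
    · rw [if_pos hk, if_pos (by omega), hk.2, mul_one]
    · rw [if_neg hk, if_neg (by omega), mul_zero]
  simp only [e] at h1
  refine h1.unique ?_
  by_cases hn : 0 ≤ n
  · simpa only [hn, true_and, if_true] using hasSum_ite_eq n.toNat (z ^ n.toNat)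
  · simpa only [hn, false_and, if_false] using hasSum_zero

theorem coe_sub_ne_zero_of_norm_lt {z : ℂ} (hz : ‖z‖ < 1) (ξ : Circle) : (ξ : ℂ) - z ≠ 0 := by
  refine sub_ne_zero.2 fun h => ?_
  rw [← h, Circle.norm_coe] at hz
  exact lt_irrefl _ hz

theorem continuous_inv_coe_sub {z : ℂ} (hz : ‖z‖ < 1) :
    Continuous fun ξ : Circle => ((ξ : ℂ) - z)⁻¹ :=
  (continuous_circle_coe.sub continuous_const).inv₀ (coe_sub_ne_zero_of_norm_lt hz)

namespace AbsSeries

variable {c : ℕ → ℂ} {p : Circle → ℂ}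

theorem circleMean (hp : AbsSeries c p) {ρ : Circle → ℂ} (hρ : Continuous ρ) :
    HasSum (fun n => c (n + 1) * circleMean fun ξ => (ξ : ℂ) ^ (n + 1) * ρ ξ)
      (circleMean fun ξ => p ξ * ρ ξ) :=
  circleMean_hasSum hp.1 (fun n => continuous_circle_coe.pow (n + 1))
    (fun n ξ => by rw [norm_pow, Circle.norm_coe, one_pow]) hp.2 hρ

theorem boundedSeries (hp : AbsSeries c p) : BoundedSeries c p :=
  BoundedSeries.of_summable hp.1 hp.2

theorem continuous (hp : AbsSeries c p) : Continuous p := by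
  have e : p = fun w : Circle => ∑' n, c (n + 1) * (w : ℂ) ^ (n + 1) :=
    funext fun w => ((hp.2 w).tsum_eq).symm
  rw [e]
  refine continuous_tsum (fun n => continuous_const.mul (continuous_circle_coe.pow _)) hp.1
    fun n w => ?_
  rw [norm_mul, norm_pow, Circle.norm_coe, one_pow, mul_one]

theorem fourierCoef_succ (hp : AbsSeries c p) (k : ℕ) :
    fourierCoef p ((k + 1 : ℕ) : ℤ) = c (k + 1) := by
  have h1 := hp.circleMean (continuous_coe_zpow (-((k + 1 : ℕ) : ℤ) - 1))
  refine h1.unique ?_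
  have e : ∀ n : ℕ, c (n + 1) * (RotatingPatch.circleMean fun ξ =>
      (ξ : ℂ) ^ (n + 1) * (ξ : ℂ) ^ (-((k + 1 : ℕ) : ℤ) - 1)) = if n = k then c (k + 1) else 0 := by
    intro n
    simp only [← zpow_natCast, ← zpow_add₀ (Circle.coe_ne_zero _), circleMean_zpow]
    by_cases h : n = k
    · rw [if_pos h, if_pos (by omega), h, mul_one]
    · rw [if_neg h, if_neg (by omega), mul_zero]
  simp only [e]
  exact hasSum_ite_eq k _

theorem fourierCoef_nonpos (hp : AbsSeries c p) {k : ℤ} (hk : k ≤ 0) : fourierCoef p k = 0 := by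
  have h1 := hp.circleMean (continuous_coe_zpow (-k - 1))
  refine h1.unique ?_
  have e : ∀ n : ℕ, c (n + 1) * (RotatingPatch.circleMean fun ξ =>
      (ξ : ℂ) ^ (n + 1) * (ξ : ℂ) ^ (-k - 1)) = 0 := by
    intro n
    simp only [← zpow_natCast, ← zpow_add₀ (Circle.coe_ne_zero _), circleMean_zpow]
    rw [if_neg (by omega), mul_zero]
  simp only [e]
  exact hasSum_zero

theorem hasSum_conj (hp : AbsSeries c p) (ξ : Circle) :
    HasSum (fun n : ℕ => (starRingEnd ℂ) (c (n + 1)) * (ξ : ℂ) ^ (-((n + 1 : ℕ) : ℤ)))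
      ((starRingEnd ℂ) (p ξ)) := by
  have h1 := (hp.2 ξ).map (starRingEnd ℂ) Complex.continuous_conj
  refine h1.congr_fun fun n => ?_
  rw [Function.comp, map_mul, map_pow, conj_coe, zpow_neg, zpow_natCast, inv_pow]

theorem circleMean_conj (hp : AbsSeries c p) {ρ : Circle → ℂ} (hρ : Continuous ρ) :
    HasSum (fun n : ℕ => (starRingEnd ℂ) (c (n + 1)) *
      RotatingPatch.circleMean fun ξ => (ξ : ℂ) ^ (-((n + 1 : ℕ) : ℤ)) * ρ ξ)
      (RotatingPatch.circleMean fun ξ => (starRingEnd ℂ) (p ξ) * ρ ξ) :=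
  circleMean_hasSum (by simpa using hp.1) (fun n => continuous_coe_zpow _)
    (fun n ξ => (norm_coe_zpow _ _).le) hp.hasSum_conj hρ

theorem fourierCoef_conj (hp : AbsSeries c p) (k : ℕ) :
    fourierCoef (fun w => (starRingEnd ℂ) (p w)) k = 0 := by
  have h1 := hp.circleMean_conj (continuous_coe_zpow (-(k : ℤ) - 1))
  refine h1.unique ?_
  have e : ∀ n : ℕ, (starRingEnd ℂ) (c (n + 1)) * (RotatingPatch.circleMean fun ξ =>
      (ξ : ℂ) ^ (-((n + 1 : ℕ) : ℤ)) * (ξ : ℂ) ^ (-(k : ℤ) - 1)) = 0 := by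
    intro n
    simp only [← zpow_add₀ (Circle.coe_ne_zero _), circleMean_zpow]
    rw [if_neg (by omega), mul_zero]
  simp only [e]
  exact hasSum_zero

/-- The Cauchy integral of `p` is the sum of the series inside the disc. -/
theorem hasSum_cauchy (hp : AbsSeries c p) {z : ℂ} (hz : ‖z‖ < 1) :
    HasSum (fun n => c (n + 1) * z ^ (n + 1))
      (RotatingPatch.circleMean fun ξ => p ξ * ((ξ : ℂ) - z)⁻¹) := by
  refine (hp.circleMean (continuous_inv_coe_sub hz)).congr_fun fun n => ?_
  have := circleMean_cauchy hz ((n + 1 : ℕ) : ℤ)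
  rw [if_pos (by omega), Int.toNat_natCast] at this
  rw [← this]
  congr 2
  funext ξ
  rw [zpow_natCast, mul_comm]

theorem circleMean_conj_cauchy (hp : AbsSeries c p) {z : ℂ} (hz : ‖z‖ < 1) :
    (RotatingPatch.circleMean fun ξ =>
      (starRingEnd ℂ) (p ξ) * ((ξ : ℂ)⁻¹ * ((ξ : ℂ) - z)⁻¹)) = 0 := by
  have hρ : Continuous fun ξ : Circle => (ξ : ℂ)⁻¹ * ((ξ : ℂ) - z)⁻¹ :=
    continuous_inv_coe.mul (continuous_inv_coe_sub hz)
  refine (hp.circleMean_conj hρ).unique ?_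
  have e : ∀ n : ℕ, (starRingEnd ℂ) (c (n + 1)) * (RotatingPatch.circleMean fun ξ =>
      (ξ : ℂ) ^ (-((n + 1 : ℕ) : ℤ)) * ((ξ : ℂ)⁻¹ * ((ξ : ℂ) - z)⁻¹)) = 0 := by
    intro n
    have := circleMean_cauchy hz (-((n + 1 : ℕ) : ℤ) - 1)
    rw [if_neg (by omega)] at this
    have e1 : (fun ξ : Circle => (ξ : ℂ) ^ (-((n + 1 : ℕ) : ℤ)) * ((ξ : ℂ)⁻¹ * ((ξ : ℂ) - z)⁻¹)) =
        fun ξ : Circle => ((ξ : ℂ) - z)⁻¹ * (ξ : ℂ) ^ (-((n + 1 : ℕ) : ℤ) - 1) := by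
      funext ξ
      rw [zpow_sub_one₀ (Circle.coe_ne_zero ξ)]
      ring
    rw [e1, this, mul_zero]
  simp only [e]
  exact hasSum_zero

end AbsSeries

/-! ### The linearized operator in closed form -/

theorem norm_mul_coe {Q : ℝ} (hQ0 : 0 < Q) (w : Circle) : ‖(Q : ℂ) * w‖ = Q := by
  rw [norm_mul, Circle.norm_coe, mul_one, Complex.norm_real, Real.norm_of_nonneg hQ0.le]

theorem norm_mul_inv_coe {Q : ℝ} (hQ0 : 0 < Q) (w : Circle) : ‖(Q : ℂ) * (w : ℂ)⁻¹‖ = Q := by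
  rw [norm_mul, norm_inv, Circle.norm_coe, inv_one, mul_one, Complex.norm_real,
    Real.norm_of_nonneg hQ0.le]

theorem conj_ellipseQuot (Q : ℝ) (w ξ : Circle) :
    (starRingEnd ℂ) (ellipseQuot Q w ξ) = 1 - Q * (ξ * w) := by
  simp only [ellipseQuot, invProd, map_sub, map_mul, map_one, map_inv₀, conj_coe,
    Complex.conj_ofReal, inv_inv]

theorem ellipseQuot_eq (Q : ℝ) (w ξ : Circle) :
    ellipseQuot Q w ξ = (ξ : ℂ)⁻¹ * ((ξ : ℂ) - Q * (w : ℂ)⁻¹) := by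
  have := Circle.coe_ne_zero ξ
  rw [ellipseQuot, invProd]
  field_simp

theorem kern0_eq {Q : ℝ} (hQ0 : 0 < Q) (hQ1 : Q < 1) (w ξ : Circle) :
    kern0 Q w ξ = ((Q : ℂ) * ξ - (w : ℂ)⁻¹) * ((ξ : ℂ) - Q * (w : ℂ)⁻¹)⁻¹ := by
  have h1 := Circle.coe_ne_zero ξ
  have h2 := Circle.coe_ne_zero w
  have h3 := coe_sub_ne_zero_of_norm_lt (by rwa [norm_mul_inv_coe hQ0]) ξ (z := Q * (w : ℂ)⁻¹)
  rw [kern0, conj_ellipseQuot, ellipseQuot_eq, invProd]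
  generalize (ξ : ℂ) - Q * (w : ℂ)⁻¹ = d at *
  field_simp
  ring

theorem bracket0_eq {Q : ℝ} (hQ0 : 0 < Q) (hQ1 : Q < 1) (w : Circle) :
    bracket0 Q w = (1 - (Q : ℂ) ^ 2) / 2 * (Q * w - (w : ℂ)⁻¹) := by
  have hz : ‖(Q : ℂ) * (w : ℂ)⁻¹‖ < 1 := by rwa [norm_mul_inv_coe hQ0]
  set a : ℂ := Q * (w : ℂ)⁻¹ with ha
  have hM := circleMean_cauchy hz
  have hi : ∀ n : ℤ, CircleInt fun ξ : Circle => ((ξ : ℂ) - a)⁻¹ * (ξ : ℂ) ^ n := fun n =>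
    CircleInt.of_continuous ((continuous_inv_coe_sub hz).mul (continuous_coe_zpow n))
  have hi' : ∀ (b : ℂ) (n : ℤ), CircleInt fun ξ : Circle =>
      b * (((ξ : ℂ) - a)⁻¹ * (ξ : ℂ) ^ n) := fun b n => CircleInt.of_continuous
    (continuous_const.mul ((continuous_inv_coe_sub hz).mul (continuous_coe_zpow n)))
  have e : (fun ξ => kern0 Q w ξ * ellipseDeriv Q ξ) = fun ξ : Circle =>
      ((Q : ℂ) * (((ξ : ℂ) - a)⁻¹ * (ξ : ℂ) ^ (1 : ℤ)) -
        (w : ℂ)⁻¹ * (((ξ : ℂ) - a)⁻¹ * (ξ : ℂ) ^ (0 : ℤ))) -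
      ((Q : ℂ) ^ 2 * (((ξ : ℂ) - a)⁻¹ * (ξ : ℂ) ^ (-1 : ℤ)) -
        (Q : ℂ) * (w : ℂ)⁻¹ * (((ξ : ℂ) - a)⁻¹ * (ξ : ℂ) ^ (-2 : ℤ))) := by
    funext ξ
    have h1 := Circle.coe_ne_zero ξ
    have h2 : (Q : ℂ) = a * w := by
      rw [ha, mul_assoc, inv_mul_cancel₀ (Circle.coe_ne_zero w), mul_one]
    rw [kern0_eq hQ0 hQ1, ellipseDeriv, ← ha, zpow_one, zpow_zero, zpow_neg_one, zpow_neg,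
      zpow_ofNat, h2]
    field_simp
  rw [bracket0, e, circleMean_sub ((hi' _ _).sub (hi' _ _)) ((hi' _ _).sub (hi' _ _)),
    circleMean_sub (hi' _ _) (hi' _ _), circleMean_sub (hi' _ _) (hi' _ _)]
  simp only [circleMean_const_mul, hM]
  have h2 := Circle.coe_ne_zero w
  simp only [ellipse, twoOmega, map_add, map_div₀, conj_coe, Complex.conj_ofReal, ha]
  norm_num
  field_simp
  ring

/-- The order one part of the bracket. The integrand is the sum of difference quotients of `f` and
of its conjugate, whose Cauchy integrals are `0` and `-conj f(w)`, of an exact derivative, and of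
terms that the Cauchy integral formula evaluates. -/
theorem bracket1_eq {Q : ℝ} (hQ0 : 0 < Q) (hQ1 : Q < 1) {c : ℕ → ℂ} {f f' : Circle → ℂ}
    (hf : AbsSeries c f) (H : HasCircleDeriv f f') (hf' : Continuous f') (w : Circle) :
    bracket1 Q f f' w * (ellipseDeriv Q w * w) =
      ((1 - (Q : ℂ) ^ 2) / 2 - 1) * (w - Q * (w : ℂ)⁻¹) * (starRingEnd ℂ) (f w) +
      ((Q : ℂ) ^ 2 * (w : ℂ)⁻¹ - w / Q) *
        (circleMean fun ξ => f ξ * ((ξ : ℂ) - Q * (w : ℂ)⁻¹)⁻¹) +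
      (1 - (Q : ℂ) ^ 2) * (w : ℂ)⁻¹ * f w := by
  have hz : ‖(Q : ℂ) * (w : ℂ)⁻¹‖ < 1 := by rwa [norm_mul_inv_coe hQ0]
  set a : ℂ := Q * (w : ℂ)⁻¹ with ha
  set fa : ℂ := circleMean fun ξ => f ξ * ((ξ : ℂ) - a)⁻¹ with hfa
  have hw0 := Circle.coe_ne_zero w
  have hQ0' : (Q : ℂ) ≠ 0 := by exact_mod_cast hQ0.ne'
  have ha0 : a ≠ 0 := mul_ne_zero hQ0' (inv_ne_zero hw0)
  have hwa := coe_sub_ne_zero_of_norm_lt hz w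
  have hcf := hf.continuous
  have hci := continuous_inv_coe
  have hca := continuous_inv_coe_sub hz
  have hcconj : Continuous fun ξ => (starRingEnd ℂ) (f ξ) := Complex.continuous_conj.comp hcf
  -- a Hölder bound with exponent `1 / 2` is enough for the two Cauchy integrals
  obtain ⟨B, hB⟩ := isCompact_univ.exists_bound_of_continuousOn hcf.continuousOn
  obtain ⟨B', hB'⟩ := isCompact_univ.exists_bound_of_continuousOn hf'.continuousOn
  have hh := H.holderBound (α := 1 / 2) (N := max B B') (by norm_num) (by norm_num)
    (fun w => (hB w trivial).trans (le_max_left _ _))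
    (fun w => (hB' w trivial).trans (le_max_right _ _))
  have hT1 := hh.circleMean_diffQuot_eq_zero (by norm_num) (by norm_num)
    (fun n hn => hf.fourierCoef_nonpos hn.le) w
  have hT2 := hh.conj.circleMean_diffQuot_eq_neg (by norm_num) (by norm_num)
    hf.fourierCoef_conj w
  have i1 := hh.circleInt_diffQuot (by norm_num) (by norm_num) w
  have i2 := hh.conj.circleInt_diffQuot (by norm_num) (by norm_num) w
  -- the exact derivative
  set ψ' : Circle → ℂ := fun ξ => ((w : ℂ)⁻¹ - Q * a) * (((ξ : ℂ) - a)⁻¹ * ((ξ : ℂ) - a)⁻¹) *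
    (f ξ - f w) + ((Q : ℂ) * ξ - (w : ℂ)⁻¹) * ((ξ : ℂ) - a)⁻¹ * f' ξ with hψ'
  have cψ' : Continuous ψ' := by
    have := continuous_circle_coe
    rw [hψ']
    fun_prop
  have hψ : circleMean ψ' = 0 := by
    have d1 := HasCircleDeriv.coe.add (HasCircleDeriv.const (-a))
    have d2 := d1.inv fun ξ => by
      rw [← sub_eq_add_neg]
      exact coe_sub_ne_zero_of_norm_lt hz ξ
    have d3 := (HasCircleDeriv.coe.const_mul (Q : ℂ)).add (HasCircleDeriv.const (-(w : ℂ)⁻¹))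
    have d4 := (d3.mul d2).mul (H.add (HasCircleDeriv.const (-f w)))
    refine HasCircleDeriv.circleMean_eq_zero (h := fun ξ =>
      ((Q : ℂ) * ξ + -(w : ℂ)⁻¹) * ((ξ : ℂ) + -a)⁻¹ * (f ξ + -f w)) ?_ cψ'
    intro ξ
    have h1 := coe_sub_ne_zero_of_norm_lt hz ξ
    refine (d4 ξ).congr_deriv ?_
    congr 1
    rw [hψ']
    simp only [← sub_eq_add_neg]
    field_simp
    ring
  set R : ℂ := ((Q : ℂ) * w - (w : ℂ)⁻¹) * ((w : ℂ) - a)⁻¹ with hR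
  set A : ℂ := a⁻¹ with hA
  set B : ℂ := Q * a - a⁻¹ with hB
  set ρ : Circle → ℂ := fun ξ => A * (w : ℂ)⁻¹ * (ξ : ℂ)⁻¹ +
    B * ((w : ℂ) - a)⁻¹ * ((ξ : ℂ) - a)⁻¹ with hρ
  have cρ : Continuous ρ := by
    rw [hρ]
    fun_prop
  have cσ : Continuous fun ξ : Circle => a * (((starRingEnd ℂ) (f ξ) - (starRingEnd ℂ) (f w)) *
      ((ξ : ℂ)⁻¹ * ((ξ : ℂ) - a)⁻¹)) := by fun_prop
  have cτ : Continuous fun ξ : Circle => (f ξ - f w) * ρ ξ := by fun_prop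
  obtain ⟨C, hC, k0, k1⟩ := exists_kern_bound hQ0 hQ1
  obtain ⟨k1, -⟩ := k1 f (Real.pi / 2 * max B' 0) (CircleMeas.of_continuous hcf)
    (by have := Real.pi_pos; positivity)
    (H.lipschitz fun w => (hB' w trivial).trans (le_max_left _ _))
  have e : (circleMean fun ξ => kern1 Q f w ξ * ellipseDeriv Q ξ) +
      (circleMean fun ξ => kern0 Q w ξ * f' ξ) =
      circleMean fun ξ => ((diffQuot (fun ξ => (starRingEnd ℂ) (f ξ)) w ξ +
        a * (((starRingEnd ℂ) (f ξ) - (starRingEnd ℂ) (f w)) *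
          ((ξ : ℂ)⁻¹ * ((ξ : ℂ) - a)⁻¹))) + ψ' ξ) -
        (diffQuot f w ξ * R - (f ξ - f w) * ρ ξ) := by
    rw [← circleMean_add
      ((CircleInt.of_bounded (k1.meas w) (k1.bound w)).mul_continuous (continuous_ellipseDeriv Q))
      ((CircleInt.of_bounded (k0.meas w) (k0.bound w)).mul_continuous hf')]
    refine circleMean_congr w fun ξ hξ => ?_
    have h1 := coe_sub_ne_zero hξ
    have h2 := Circle.coe_ne_zero ξ
    have h3 := coe_sub_ne_zero_of_norm_lt hz ξ
    have h4 : (Q : ℂ) = a * w := by rw [ha, mul_assoc, inv_mul_cancel₀ hw0, mul_one]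
    have h5 : (ξ : ℂ)⁻¹ - (w : ℂ)⁻¹ = -(((ξ : ℂ) - w) * ((ξ : ℂ)⁻¹ * (w : ℂ)⁻¹)) := by
      field_simp
      ring
    rw [kern0_eq hQ0 hQ1, ← ha, kern1, conj_ellipseQuot, ellipseQuot_eq, ← ha, diffQuot, diffQuot,
      map_div₀, map_sub, map_sub, conj_coe, conj_coe, h5, invProd, ellipseDeriv, hψ', hρ, hR, hA,
      hB]
    simp only
    rw [h4]
    generalize (starRingEnd ℂ) (f ξ) - (starRingEnd ℂ) (f w) = v
    generalize f ξ - f w = u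
    field_simp
    ring
  have m1 : (circleMean fun ξ : Circle =>
      a * (((starRingEnd ℂ) (f ξ) - (starRingEnd ℂ) (f w)) *
        ((ξ : ℂ)⁻¹ * ((ξ : ℂ) - a)⁻¹))) = 0 := by
    have h1 := circleMean_cauchy hz (-1)
    rw [if_neg (by norm_num)] at h1
    have e1 : (fun ξ : Circle => ((ξ : ℂ) - a)⁻¹ * (ξ : ℂ) ^ (-1 : ℤ)) =
        fun ξ : Circle => (ξ : ℂ)⁻¹ * ((ξ : ℂ) - a)⁻¹ := by
      funext ξ
      rw [zpow_neg_one, mul_comm]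
    rw [e1] at h1
    rw [circleMean_const_mul]
    simp only [sub_mul]
    rw [circleMean_sub (CircleInt.of_continuous (by fun_prop))
      (CircleInt.of_continuous (by fun_prop)), hf.circleMean_conj_cauchy hz,
      circleMean_const_mul, h1]
    simp
  have m2 : (circleMean fun ξ => (f ξ - f w) * ρ ξ) =
      B * ((w : ℂ) - a)⁻¹ * fa - f w * (A * (w : ℂ)⁻¹ + B * ((w : ℂ) - a)⁻¹) := by
    have h1 : (circleMean fun ξ => f ξ * (ξ : ℂ)⁻¹) = 0 := by
      have := hf.fourierCoef_nonpos le_rfl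
      simpa [fourierCoef] using this
    have h2 : (circleMean fun ξ => (ξ : ℂ)⁻¹) = 1 := by simpa using circleMean_zpow (-1)
    have h3 : (circleMean fun ξ => ((ξ : ℂ) - a)⁻¹) = 1 := by
      simpa using circleMean_cauchy hz 0
    have e1 : (fun ξ => (f ξ - f w) * ρ ξ) = fun ξ : Circle =>
        (A * (w : ℂ)⁻¹ * (f ξ * (ξ : ℂ)⁻¹) + B * ((w : ℂ) - a)⁻¹ * (f ξ * ((ξ : ℂ) - a)⁻¹)) -
        (f w * (A * (w : ℂ)⁻¹) * (ξ : ℂ)⁻¹ + f w * (B * ((w : ℂ) - a)⁻¹) * ((ξ : ℂ) - a)⁻¹) := by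
      funext ξ
      rw [hρ]
      ring
    rw [e1, circleMean_sub (CircleInt.of_continuous (by fun_prop))
      (CircleInt.of_continuous (by fun_prop)),
      circleMean_add (CircleInt.of_continuous (by fun_prop))
      (CircleInt.of_continuous (by fun_prop)),
      circleMean_add (CircleInt.of_continuous (by fun_prop))
      (CircleInt.of_continuous (by fun_prop))]
    simp only [circleMean_const_mul, h1, h2, h3, ← hfa]
    ring
  have i1' : CircleInt fun ξ => diffQuot f w ξ * R := i1.mul_continuous continuous_const
  rw [bracket1, e, circleMean_sub (((i2.add (CircleInt.of_continuous cσ)).add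
    (CircleInt.of_continuous cψ'))) (i1'.sub (CircleInt.of_continuous cτ)),
    circleMean_add (i2.add (CircleInt.of_continuous cσ)) (CircleInt.of_continuous cψ'),
    circleMean_add i2 (CircleInt.of_continuous cσ), hT2, m1, hψ,
    circleMean_sub i1' (CircleInt.of_continuous cτ), circleMean_mul_const, hT1, m2, twoOmega,
    ellipseDeriv, hA, hB]
  have h4 : (w : ℂ) ^ 2 - Q ≠ 0 := by
    intro h
    apply hwa
    rw [ha, sub_eq_zero]
    field_simp
    linear_combination h
  have h6 : (w : ℂ) - a = ((w : ℂ) ^ 2 - Q) * (w : ℂ)⁻¹ := by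
    rw [ha]
    field_simp
  rw [h6, ha]
  push_cast
  field_simp
  ring

/-- The analytic function whose imaginary part is the linearization of `F(Q, ·)` in the direction
`h`, with derivative `h'`. In terms of `p(w) = (1/w - Q w) h(w)` it is
`p(w) + p(Q w) - (1 - Q²)/2 · w p'(w)`, where the value of `h` at `Q w` is a Cauchy integral. -/
noncomputable def linSymbol (Q : ℝ) (h h' : Circle → ℂ) (w : Circle) : ℂ :=
  (1 - (Q : ℂ) ^ 2) / 2 * (Q * (w : ℂ) ^ 2 - 1) * h' w +
    ((1 - (Q : ℂ) ^ 2) * (w : ℂ)⁻¹ +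
      (1 - (1 - (Q : ℂ) ^ 2) / 2) * ((w : ℂ)⁻¹ - Q * w)) * h w +
    ((w : ℂ)⁻¹ / Q - (Q : ℂ) ^ 2 * w) * circleMean fun ξ => h ξ * ((ξ : ℂ) - Q * w)⁻¹

theorem linearPart_eq {Q : ℝ} (hQ0 : 0 < Q) (hQ1 : Q < 1) {a : ℕ → ℝ} {f f' : Circle → ℂ}
    (hf : AbsSeries (fun n => (a n : ℂ)) f) (H : HasCircleDeriv f f') (hf' : Continuous f')
    (w : Circle) : linearPart Q f f' w = (linSymbol Q f f' w).im := by
  have hw0 := Circle.coe_ne_zero w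
  have e1 : (circleMean fun ξ => f ξ * ((ξ : ℂ) - Q * w)⁻¹) =
      (starRingEnd ℂ) (circleMean fun ξ => f ξ * ((ξ : ℂ) - Q * (w : ℂ)⁻¹)⁻¹) := by
    have h1 := hf.hasSum_cauchy (z := (Q : ℂ) * w) (by rwa [norm_mul_coe hQ0])
    have h2 := (hf.hasSum_cauchy (z := (Q : ℂ) * (w : ℂ)⁻¹)
      (by rwa [norm_mul_inv_coe hQ0])).map (starRingEnd ℂ) Complex.continuous_conj
    refine h1.unique (h2.congr_fun fun n => ?_)
    simp only [Function.comp_def, map_mul, map_pow, map_inv₀, Complex.conj_ofReal, conj_coe,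
      inv_inv]
  have e2 : (bracket0 Q w * f' w + bracket1 Q f f' w * ellipseDeriv Q w) * (w : ℂ) =
      bracket0 Q w * w * f' w + bracket1 Q f f' w * (ellipseDeriv Q w * w) := by ring
  rw [linearPart, e2, bracket0_eq hQ0 hQ1, bracket1_eq hQ0 hQ1 hf H hf', linSymbol, e1]
  generalize (circleMean fun ξ => f ξ * ((ξ : ℂ) - Q * (w : ℂ)⁻¹)⁻¹) = z
  -- the two sides differ by replacing two terms by minus their conjugates
  have e3 : ∀ x : ℂ, ((starRingEnd ℂ) x).im = -x.im := Complex.conj_im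
  have h1 := e3 (((1 - (Q : ℂ) ^ 2) / 2 - 1) * (w - Q * (w : ℂ)⁻¹) * (starRingEnd ℂ) (f w))
  have h2 := e3 (((Q : ℂ) ^ 2 * (w : ℂ)⁻¹ - w / Q) * z)
  simp only [map_mul, map_sub, map_div₀, map_pow, map_one, map_ofNat, map_inv₀, conj_coe,
    Complex.conj_ofReal, Complex.conj_conj, inv_inv] at h1 h2
  rw [Complex.add_im, Complex.add_im, Complex.add_im, Complex.add_im, Complex.add_im,
    ← neg_eq_iff_eq_neg.2 h1, ← neg_eq_iff_eq_neg.2 h2, ← Complex.neg_im, ← Complex.neg_im,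
    ← Complex.add_im, ← Complex.add_im, ← Complex.add_im, ← Complex.add_im, ← Complex.add_im]
  congr 1
  field_simp
  ring

/-! ### Action on the coefficients -/

/-- The coefficients `b_n = a_{n+1} - Q a_{n-1}` of `(1/z - Q z) ∑ a_n z^n`. -/
theorem hasSum_shift (Q : ℝ) {a : ℕ → ℝ} (h0 : a 0 = 0) (h1 : a 1 = 0) {z s : ℂ} (hz : z ≠ 0)
    (hs : HasSum (fun n => (a (n + 1) : ℂ) * z ^ (n + 1)) s) :
    HasSum (fun n : ℕ => ((a (n + 1 + 1) - Q * a (n + 1 - 1) : ℝ) : ℂ) * z ^ (n + 1))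
      ((z⁻¹ - Q * z) * s) := by
  have e1 : HasSum (fun n => (a n : ℂ) * z ^ n) s := by
    refine (hasSum_nat_add_iff' 1).1 ?_
    simpa [h0] using hs
  have e2 : HasSum (fun n => (a (n + 2) : ℂ) * z ^ (n + 2)) s := by
    have := (hasSum_nat_add_iff' 2).2 e1
    simpa [h0, h1, Finset.sum_range_succ] using this
  have e3 := (e2.mul_left z⁻¹).sub (e1.mul_left ((Q : ℂ) * z))
  rw [← sub_mul] at e3
  refine e3.congr_fun fun n => ?_
  rw [Nat.add_sub_cancel]
  push_cast
  field_simp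
  ring

theorem summable_shift (Q : ℝ) {a : ℕ → ℝ} (hs : Summable fun n => |a (n + 1)|) :
    Summable fun n : ℕ => ‖((a (n + 1 + 1) - Q * a (n + 1 - 1) : ℝ) : ℂ)‖ := by
  have h1 : Summable fun n => |a n| := (summable_nat_add_iff 1).1 hs
  have h2 : Summable fun n => |a (n + 2)| := (summable_nat_add_iff 2).2 h1
  refine Summable.of_nonneg_of_le (fun _ => norm_nonneg _) (fun n => ?_)
    (h2.add (h1.mul_left |Q|))
  rw [Complex.norm_real, Real.norm_eq_abs, Nat.add_sub_cancel, ← abs_mul]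
  exact abs_sub _ _

theorem AbsSeries.shift (Q : ℝ) {a : ℕ → ℝ} (h0 : a 0 = 0) (h1 : a 1 = 0) {h : Circle → ℂ}
    (hh : AbsSeries (fun n => (a n : ℂ)) h) :
    AbsSeries (fun n => ((a (n + 1) - Q * a (n - 1) : ℝ) : ℂ))
      fun w => ((w : ℂ)⁻¹ - Q * w) * h w :=
  ⟨summable_shift Q (by simpa using hh.1),
    fun w => hasSum_shift Q h0 h1 (Circle.coe_ne_zero w) (hh.2 w)⟩

/-- Differentiation multiplies the coefficients by `n`; the differentiated series still converges
boundedly, because the derivative is Hölder. -/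
theorem AbsSeries.boundedSeries_deriv {α A : ℝ} (hα0 : 0 < α) (hα1 : α < 1) {c : ℕ → ℂ}
    {p p' : Circle → ℂ} (hp : AbsSeries c p) (H : HasCircleDeriv p p')
    (hp' : HolderBound α A p') : BoundedSeries (fun n => n * c n) fun w => w * p' w := by
  have hφ := (HolderBound.coe hα0.le hα1.le).mul hp'
  have hcp' := hp'.continuous hα0
  have hcp := H.continuous
  have hz := continuous_coe_zpow
  have key : ∀ n : ℤ, fourierCoef (fun w => w * p' w) n = n * fourierCoef p n := by
    intro n
    have d1 : HasCircleDeriv (fun w => (w : ℂ) ^ (-n)) fun w => (-n : ℤ) * (w : ℂ) ^ (-n - 1) := by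
      refine hasCircleDeriv_of_angular fun θ => ?_
      have h1 := (hasDerivAt_zpow (-n) (Circle.exp θ : ℂ)
        (Or.inl (Circle.coe_ne_zero _))).comp θ (HasCircleDeriv.coe.angular θ)
      simpa [Function.comp_def] using h1
    have h1 := (H.mul d1).circleMean_eq_zero
      ((hcp'.mul (hz _)).add (hcp.mul (continuous_const.mul (hz _))))
    have i1 : CircleInt fun ξ => p' ξ * (ξ : ℂ) ^ (-n) := CircleInt.of_continuous (hcp'.mul (hz _))
    have i2 : CircleInt fun ξ => p ξ * ((-n : ℤ) * (ξ : ℂ) ^ (-n - 1)) :=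
      CircleInt.of_continuous (hcp.mul (continuous_const.mul (hz _)))
    rw [circleMean_add i1 i2] at h1
    have e1 : (fun ξ => p ξ * ((-n : ℤ) * (ξ : ℂ) ^ (-n - 1))) =
        fun ξ => ((-n : ℤ) : ℂ) * (p ξ * (ξ : ℂ) ^ (-n - 1)) := by
      funext ξ
      ring
    have e2 : (fun ξ : Circle => (ξ : ℂ) * p' ξ * (ξ : ℂ) ^ (-n - 1)) =
        fun ξ => p' ξ * (ξ : ℂ) ^ (-n) := by
      funext ξ
      rw [zpow_sub_one₀ (Circle.coe_ne_zero _)]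
      have := Circle.coe_ne_zero ξ
      field_simp
    rw [e1, circleMean_const_mul] at h1
    rw [fourierCoef, fourierCoef, e2]
    push_cast at h1
    linear_combination h1
  have h1 := hφ.boundedSeries hα0 hα1 (by rw [key, Int.cast_zero, zero_mul])
  have h2 := hφ.circleMean_diffQuot_eq_zero hα0 hα1 fun n hn => by
    rw [key, hp.fourierCoef_nonpos hn.le, mul_zero]
  simp only [h2, add_zero] at h1
  refine h1.congr fun n => ?_
  rw [key, hp.fourierCoef_succ]
  push_cast
  ring

/-- The symbol has the coefficients `(1 + Q^n - (1 - Q²) n / 2) (a_{n+1} - Q a_{n-1})`. -/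
theorem boundedSeries_linSymbol {Q : ℝ} (hQ0 : 0 < Q) (hQ1 : Q < 1) {α A : ℝ} (hα0 : 0 < α)
    (hα1 : α < 1) {a : ℕ → ℝ} (h0 : a 0 = 0) (h1 : a 1 = 0) {h h' : Circle → ℂ}
    (hh : AbsSeries (fun n => (a n : ℂ)) h) (H : HasCircleDeriv h h') (hh' : HolderBound α A h') :
    BoundedSeries (fun n => ((dispersion n Q * (a (n + 1) - Q * a (n - 1)) : ℝ) : ℂ))
      (linSymbol Q h h') := by
  have hQ0' : (Q : ℂ) ≠ 0 := by exact_mod_cast hQ0.ne'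
  have hp := hh.shift Q h0 h1
  have Hp := (hasCircleDeriv_inv_coe.add (HasCircleDeriv.coe.const_mul (-(Q : ℂ)))).mul H
  have hw := HolderBound.coe hα0.le hα1.le
  have hwi := HolderBound.inv_coe hα0.le hα1.le
  obtain ⟨B, hB⟩ := isCompact_univ.exists_bound_of_continuousOn H.continuous.continuousOn
  have hhb := H.holderBound hα0.le hα1.le (fun w => (hB w trivial).trans (le_max_left B A))
    (fun w => (hh'.1 w).trans (le_max_right B A))
  have hpb := (((hwi.mul hwi).neg.add ((HolderBound.const (-(Q : ℂ))).mul
    (HolderBound.const 1))).mul hhb).add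
      ((hwi.add ((HolderBound.const (-(Q : ℂ))).mul hw)).mul hh')
  simp only [← sq, inv_pow] at hpb
  have e : (fun w : Circle => ((w : ℂ)⁻¹ + -(Q : ℂ) * w) * h w) =
      fun w : Circle => ((w : ℂ)⁻¹ - Q * w) * h w := by
    funext w
    ring
  rw [e] at Hp
  have s1 := hp.boundedSeries
  have s2 := hp.boundedSeries_deriv hα0 hα1 Hp hpb
  have hz : ∀ w : Circle, (Q : ℂ) * w ≠ 0 := fun w => mul_ne_zero hQ0' (Circle.coe_ne_zero w)
  have s3 : AbsSeries (fun n => (Q : ℂ) ^ n * ((a (n + 1) - Q * a (n - 1) : ℝ) : ℂ))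
      fun w => (((Q : ℂ) * w)⁻¹ - Q * (Q * w)) *
        circleMean fun ξ => h ξ * ((ξ : ℂ) - Q * w)⁻¹ := by
    refine ⟨Summable.of_nonneg_of_le (fun _ => norm_nonneg _) (fun n => ?_) hp.1, fun w => ?_⟩
    · rw [norm_mul, norm_pow, Complex.norm_real, Real.norm_of_nonneg hQ0.le]
      exact mul_le_of_le_one_left (norm_nonneg _) (pow_le_one₀ hQ0.le hQ1.le)
    · refine (hasSum_shift Q h0 h1 (hz w)
        (hh.hasSum_cauchy (by rwa [norm_mul_coe hQ0]))).congr_fun fun n => ?_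
      rw [mul_pow]
      ring
  have s4 := (s1.add s3.boundedSeries).add (s2.const_mul (-((1 - (Q : ℂ) ^ 2) / 2)))
  convert s4 using 1
  · funext n
    rw [dispersion]
    push_cast
    ring
  · funext w
    have := Circle.coe_ne_zero w
    rw [linSymbol]
    field_simp
    ring

/-- A sequence with its first two terms, which play no role in `HasPowerSeries`, replaced
by zero. -/
def dropTwo (a : ℕ → ℝ) (n : ℕ) : ℝ := if n < 2 then 0 else a n

theorem HasPowerSeries.absSeries {a : ℕ → ℝ} {h : Circle → ℂ} (ha : HasPowerSeries a h) :
    AbsSeries (fun n => (dropTwo a n : ℂ)) h := by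
  have hs : ∀ w : Circle, HasSum (fun n : ℕ => (dropTwo a (n + 1) : ℂ) * (w : ℂ) ^ (n + 1))
      (h w) := by
    intro w
    refine (hasSum_nat_add_iff' 1).1 ?_
    simpa [dropTwo] using ha w
  refine ⟨?_, hs⟩
  simpa using (hs 1).summable.norm

theorem AbsSeries.hasPowerSeries {a : ℕ → ℝ} (h1 : a 1 = 0) {h : Circle → ℂ}
    (hh : AbsSeries (fun n => (a n : ℂ)) h) : HasPowerSeries a h := by
  intro w
  have := (hasSum_nat_add_iff' 1).2 (hh.2 w)
  simpa [h1] using this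

/-! ### The linearized operator -/

section LinearizedOperator

variable {α : ℝ≥0}

theorem spaceX.hasCircleDeriv (h : spaceX α) :
    HasCircleDeriv (h : Circle → ℂ) (circleDeriv (h : Circle → ℂ)) := h.2.1.hasCircleDeriv

theorem spaceX.continuous (h : spaceX α) : Continuous (h : Circle → ℂ) :=
  (spaceX.hasCircleDeriv h).continuous

theorem spaceX.linearPart_eq (hα0 : 0 < α) {Q : ℝ} (hQ0 : 0 < Q) (hQ1 : Q < 1) (h : spaceX α) :
    linearPart Q h (circleDeriv h) = fun w => (linSymbol Q h (circleDeriv h) w).im := by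
  obtain ⟨a, ha⟩ := h.2.2
  funext w
  exact RotatingPatch.linearPart_eq hQ0 hQ1 ha.absSeries (spaceX.hasCircleDeriv h)
    (h.2.1.continuous_deriv hα0) w

theorem spaceX.hasSineSeries (hα0 : 0 < α) (hα1 : α < 1) {Q : ℝ} (hQ0 : 0 < Q) (hQ1 : Q < 1)
    (h : spaceX α) {a : ℕ → ℝ} (ha : HasPowerSeries a (h : Circle → ℂ)) :
    HasSineSeries (fun n => dispersion n Q * (dropTwo a (n + 1) - Q * dropTwo a (n - 1)))
      fun w => (linSymbol Q h (circleDeriv h) w).im :=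
  (boundedSeries_linSymbol hQ0 hQ1 hα0 hα1 (by simp [dropTwo]) (by simp [dropTwo]) ha.absSeries
    (spaceX.hasCircleDeriv h) (h.2.1.holderBound_deriv hα0)).hasSineSeries

theorem spaceX.linSymbol_mem (hα0 : 0 < α) (hα1 : α < 1) {Q : ℝ} (hQ0 : 0 < Q) (hQ1 : Q < 1)
    (h : spaceX α) : (fun w => (linSymbol Q h (circleDeriv h) w).im) ∈ spaceY α := by
  obtain ⟨C, δ, -, -, hC⟩ := exists_expansion_bound hQ0 hQ1 hα0 hα1
  obtain ⟨a, ha⟩ := h.2.2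
  have hb := (hC h (circleDeriv h) _ (spaceX.hasCircleDeriv h) (h.2.1.norm_le hα0)
    (h.2.1.holderBound_deriv hα0)).1
  rw [spaceX.linearPart_eq hα0 hQ0 hQ1] at hb
  exact ⟨hb.continuous hα0, hb.memHolder, _, spaceX.hasSineSeries hα0 hα1 hQ0 hQ1 h ha⟩

theorem circleInt_mul_inv_sub {Q : ℝ} (hQ0 : 0 < Q) (hQ1 : Q < 1) (h : spaceX α) (w : Circle) :
    CircleInt fun ξ => (h : Circle → ℂ) ξ * ((ξ : ℂ) - Q * w)⁻¹ :=
  CircleInt.of_continuous ((spaceX.continuous h).mul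
    (continuous_inv_coe_sub (by rwa [norm_mul_coe hQ0])))

/-- The linearized operator for `0 < Q < 1`, and `0` for other `Q`. -/
noncomputable def linOp (hα0 : 0 < α) (hα1 : α < 1) (Q : ℝ) : spaceX α →ₗ[ℝ] spaceY α :=
  if hQ : 0 < Q ∧ Q < 1 then
    { toFun := fun h => ⟨fun w => (linSymbol Q h (circleDeriv h) w).im,
        spaceX.linSymbol_mem hα0 hα1 hQ.1 hQ.2 h⟩
      map_add' := by
        intro h k
        refine Subtype.ext (funext fun w => ?_)
        have e1 : circleDeriv ((h + k : spaceX α) : Circle → ℂ) =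
            circleDeriv h + circleDeriv k := circleDeriv_add h.2.1.1 k.2.1.1
        have e2 := circleMean_add (circleInt_mul_inv_sub hQ.1 hQ.2 h w)
          (circleInt_mul_inv_sub hQ.1 hQ.2 k w)
        simp only [← add_mul] at e2
        change (linSymbol Q _ _ w).im = (linSymbol Q _ _ w).im + (linSymbol Q _ _ w).im
        rw [e1, ← Complex.add_im]
        simp only [linSymbol, Submodule.coe_add, Pi.add_apply, e2]
        congr 1
        ring
      map_smul' := by
        intro t h
        refine Subtype.ext (funext fun w => ?_)
        have e1 : circleDeriv ((t • h : spaceX α) : Circle → ℂ) = t • circleDeriv h :=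
          circleDeriv_smul t h.2.1.1
        change (linSymbol Q _ _ w).im = t * (linSymbol Q _ _ w).im
        rw [e1, ← Complex.im_ofReal_mul]
        simp only [linSymbol, Submodule.coe_smul, Pi.smul_apply, Complex.real_smul, mul_assoc,
          circleMean_const_mul]
        congr 1
        ring }
  else 0

variable {hα0 : 0 < α} {hα1 : α < 1} {Q : ℝ}

theorem linOp_apply (hQ0 : 0 < Q) (hQ1 : Q < 1) (h : spaceX α) :
    (linOp hα0 hα1 Q h : Circle → ℝ) = fun w => (linSymbol Q h (circleDeriv h) w).im := by
  rw [linOp, dif_pos ⟨hQ0, hQ1⟩]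
  rfl

theorem linOp_hasSineSeries (hQ0 : 0 < Q) (hQ1 : Q < 1) (h : spaceX α) {a : ℕ → ℝ}
    (ha : HasPowerSeries a (h : Circle → ℂ)) :
    HasSineSeries (fun n => dispersion n Q * (dropTwo a (n + 1) - Q * dropTwo a (n - 1)))
      (linOp hα0 hα1 Q h : Circle → ℝ) := by
  rw [linOp_apply hQ0 hQ1]
  exact spaceX.hasSineSeries hα0 hα1 hQ0 hQ1 h ha

theorem c1HolderENorm_smul_le (hα0 : 0 < α) (t : ℝ) (h : spaceX α) :
    c1HolderENorm α (t • (h : Circle → ℂ)) ≤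
      ENNReal.ofReal |t| * ENNReal.ofReal (3 * (c1HolderENorm α (h : Circle → ℂ)).toReal) := by
  set N := (c1HolderENorm α (h : Circle → ℂ)).toReal with hN
  have hb : HolderBound α (|t| * N) (t • circleDeriv (h : Circle → ℂ)) := by
    have h1 := h.2.1.holderBound_deriv hα0
    refine ⟨fun w => ?_, fun w w' => ?_⟩
    · rw [Pi.smul_apply, norm_smul, Real.norm_eq_abs]
      exact mul_le_mul_of_nonneg_left (h1.1 w) (abs_nonneg t)
    · rw [Pi.smul_apply, Pi.smul_apply, ← smul_sub, norm_smul, Real.norm_eq_abs, mul_assoc]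
      exact mul_le_mul_of_nonneg_left (h1.2 w w') (abs_nonneg t)
  have h2 : (⨆ w, ‖(t • (h : Circle → ℂ)) w‖ₑ) ≤ ENNReal.ofReal (|t| * N) := by
    refine iSup_le fun w => ?_
    rw [← ofReal_norm, Pi.smul_apply, norm_smul, Real.norm_eq_abs]
    exact ENNReal.ofReal_le_ofReal (mul_le_mul_of_nonneg_left (h.2.1.norm_le hα0 w) (abs_nonneg t))
  rw [c1HolderENorm, circleDeriv_smul t h.2.1.1, ← ENNReal.ofReal_mul (abs_nonneg t)]
  refine (add_le_add h2 hb.holderENorm_le).trans (le_of_eq ?_)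
  have h0 : 0 ≤ |t| * N := hb.nonneg
  rw [← ENNReal.ofReal_add h0 (by positivity)]
  congr 1
  ring

theorem isLinearization_linOp (hα0 : 0 < α) (hα1 : α < 1) (hQ0 : 0 < Q) (hQ1 : Q < 1) :
    IsLinearization α Q (linOp hα0 hα1 Q) := by
  obtain ⟨C, δ, hC0, hδ, hC⟩ := exists_expansion_bound hQ0 hQ1 hα0 hα1
  have hb := fun h : spaceX α => hC h (circleDeriv h) _ (spaceX.hasCircleDeriv h)
    (h.2.1.norm_le hα0) (h.2.1.holderBound_deriv hα0)
  have hL : ∀ h : spaceX α, linearPart Q h (circleDeriv h) = (linOp hα0 hα1 Q h : Circle → ℝ) :=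
    fun h => by rw [spaceX.linearPart_eq hα0 hQ0 hQ1, linOp_apply hQ0 hQ1]
  have hfin : ∀ h : spaceX α, c1HolderENorm α (h : Circle → ℂ) =
      ENNReal.ofReal (c1HolderENorm α (h : Circle → ℂ)).toReal := fun h =>
    (ENNReal.ofReal_toReal (h.2.1.c1HolderENorm_ne_top hα0)).symm
  have hfre : ∀ ε : ℝ≥0, 0 < ε → ∃ δ : ℝ≥0, 0 < δ ∧ ∀ h : spaceX α,
      c1HolderENorm α (h : Circle → ℂ) < δ →
        holderENorm α (F Q (h : Circle → ℂ) - F Q 0 - (linOp hα0 hα1 Q h : Circle → ℝ)) ≤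
          ε * c1HolderENorm α (h : Circle → ℂ) := by
    intro ε hε
    set η : ℝ := min δ (ε / (2 * C + 1)) with hη
    have hη0 : 0 < η := lt_min hδ (by positivity)
    refine ⟨η.toNNReal, Real.toNNReal_pos.2 hη0, fun h hh => ?_⟩
    have h1 : (c1HolderENorm α (h : Circle → ℂ)).toReal < η := by
      have := (ENNReal.toReal_lt_toReal (h.2.1.c1HolderENorm_ne_top hα0)
        ENNReal.coe_ne_top).2 hh
      rwa [ENNReal.coe_toReal, Real.coe_toNNReal _ hη0.le] at this
    have h2 := (hb h).2 (h1.le.trans (min_le_left _ _))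
    rw [hL h] at h2
    refine h2.holderENorm_le.trans ?_
    have hN0 : 0 ≤ (c1HolderENorm α (h : Circle → ℂ)).toReal := ENNReal.toReal_nonneg
    have h3 : ENNReal.ofReal (2 * (C * (c1HolderENorm α (h : Circle → ℂ)).toReal ^ 2)) ≤
        ENNReal.ofReal (ε * (c1HolderENorm α (h : Circle → ℂ)).toReal) := by
      refine ENNReal.ofReal_le_ofReal ?_
      have h4 := h1.le.trans (min_le_right _ _)
      rw [le_div_iff₀ (by positivity)] at h4
      nlinarith [mul_le_mul_of_nonneg_right h4 hN0, mul_nonneg hN0 hN0]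
    refine h3.trans (le_of_eq ?_)
    rw [ENNReal.ofReal_mul ε.coe_nonneg, ENNReal.ofReal_coe_nnreal, ← hfin]
  refine ⟨⟨(2 * C).toNNReal, fun h => ?_⟩, hfre, fun h w => ?_⟩
  · have h1 := (hb h).1
    rw [hL h] at h1
    refine h1.holderENorm_le.trans (le_of_eq ?_)
    rw [← mul_assoc, ENNReal.ofReal_mul (by positivity), ← hfin]
    rfl
  · -- the pointwise derivative along the line `t ↦ t h` follows from the Fréchet estimate
    rw [hasDerivAt_iff_isLittleO_nhds_zero, Asymptotics.isLittleO_iff]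
    intro κ hκ
    set N := (c1HolderENorm α (h : Circle → ℂ)).toReal with hN
    have hN0 : 0 ≤ N := ENNReal.toReal_nonneg
    obtain ⟨η, hη, hη'⟩ := hfre (κ / (3 * N + 1)).toNNReal (Real.toNNReal_pos.2 (by positivity))
    have hev : ∀ᶠ t : ℝ in 𝓝 0, |t| < η / (3 * N + 1) := by
      have : Tendsto (fun t : ℝ => |t|) (𝓝 0) (𝓝 0) := by
        simpa using continuous_abs.tendsto (0 : ℝ)
      exact this.eventually (gt_mem_nhds (by positivity))
    filter_upwards [hev] with t ht
    have hs := c1HolderENorm_smul_le hα0 t h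
    rw [← ENNReal.ofReal_mul (abs_nonneg t), ← hN] at hs
    rw [lt_div_iff₀ (by positivity)] at ht
    have h1 : c1HolderENorm α ((t • h : spaceX α) : Circle → ℂ) < η := by
      refine hs.trans_lt ?_
      rw [← ENNReal.ofReal_coe_nnreal]
      refine (ENNReal.ofReal_lt_ofReal_iff (by positivity)).2 ?_
      nlinarith [abs_nonneg t]
    have h2 := hη' (t • h) h1
    have h3 : ‖F Q (t • (h : Circle → ℂ)) w - F Q 0 w - t * (linOp hα0 hα1 Q h : Circle → ℝ) w‖ₑ ≤
        ENNReal.ofReal (κ * |t|) := by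
      have h4 := (le_iSup (fun w => ‖(F Q ((t • h : spaceX α) : Circle → ℂ) - F Q 0 -
        (linOp hα0 hα1 Q (t • h) : Circle → ℝ)) w‖ₑ) w).trans (le_self_add.trans h2)
      rw [map_smul] at h4
      refine h4.trans ((mul_le_mul_right hs _).trans ?_)
      rw [← ENNReal.ofReal, ← ENNReal.ofReal_mul (by positivity)]
      refine ENNReal.ofReal_le_ofReal ?_
      rw [div_mul_eq_mul_div, div_le_iff₀ (by positivity)]
      have := mul_nonneg hκ.le (abs_nonneg t)
      nlinarith
    rw [← ofReal_norm, ENNReal.ofReal_le_ofReal_iff (by positivity)] at h3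
    simpa using h3

end LinearizedOperator

/-! ### Privalov's theorem -/

/-- `∫ |w - ξ|^{α-1} min(1, δ / |w - ξ|) |dξ| = O(δ^α)`, from splitting the integral at the
distance `δ`. -/
theorem circleInt_truncated {α : ℝ} (hα0 : 0 < α) (hα1 : α < 1) :
    ∃ K : ℝ, 0 ≤ K ∧ ∀ δ : ℝ, 0 < δ → δ ≤ 1 → ∀ w : Circle,
      CircleInt (fun ξ => |dist w ξ| ^ (α - 1) * min 1 (δ / |dist w ξ|)) ∧
      (2 * Real.pi)⁻¹ * ∫ θ in (0 : ℝ)..(2 * Real.pi),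
        |dist w (Circle.exp θ)| ^ (α - 1) * min 1 (δ / |dist w (Circle.exp θ)|) ≤ K * δ ^ α := by
  have hpi := Real.pi_pos
  have h1α : 0 < 1 - α := by linarith
  refine ⟨(2 * Real.pi)⁻¹ * (2 * (Real.pi / 2 * (1 / α + 1 / (1 - α)))), by positivity,
    fun δ hδ hδ1 w => ?_⟩
  set ρ : ℝ → ℝ := fun x => |x| ^ (α - 1) * min 1 (δ / |x|) with hρ
  have hm : Measurable ρ := by
    rw [hρ]
    fun_prop
  have h0 : ∀ x, 0 ≤ ρ x := fun x => by positivity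
  have hle1 : ∀ x, 0 < x → ρ x ≤ x ^ (α - 1) := fun x hx => by
    rw [hρ]
    simp only [abs_of_pos hx]
    exact mul_le_of_le_one_right (by positivity) (min_le_left _ _)
  have hle2 : ∀ x, 0 < x → ρ x ≤ δ * x ^ (α - 2) := fun x hx => by
    rw [hρ]
    simp only [abs_of_pos hx]
    refine (mul_le_mul_of_nonneg_left (min_le_right _ _) (by positivity)).trans (le_of_eq ?_)
    have e : α - 1 = (α - 2) + 1 := by ring
    rw [e, Real.rpow_add_one hx.ne']
    field_simp
  have hint : ∀ b, 0 ≤ b → IntervalIntegrable ρ volume 0 b := by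
    intro b hb
    have h1 : IntervalIntegrable (fun x : ℝ => x ^ (α - 1)) volume 0 b :=
      intervalIntegral.intervalIntegrable_rpow' (by linarith)
    refine h1.mono_fun hm.aestronglyMeasurable ?_
    rw [Set.uIoc_of_le hb]
    refine (ae_restrict_iff' measurableSet_Ioc).2 (Eventually.of_forall fun x hx => ?_)
    simp only [Real.norm_of_nonneg (h0 _)]
    exact (hle1 x hx.1).trans (le_abs_self _)
  have hint' : IntervalIntegrable ρ volume δ 2 := (hint δ hδ.le).symm.trans (hint 2 zero_le_two)
  have hanti : AntitoneOn ρ (Set.Ioi 0) := by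
    intro x hx y hy hxy
    rw [hρ]
    simp only [abs_of_pos (Set.mem_Ioi.1 hx), abs_of_pos (Set.mem_Ioi.1 hy)]
    have hx' : 0 < x := hx
    have hy' : 0 < y := hy
    refine mul_le_mul (Real.rpow_le_rpow_of_nonpos hx hxy (by linarith))
      (min_le_min_left _ (div_le_div_of_nonneg_left hδ.le hx hxy)) (by positivity) (by positivity)
  have hc : (2 : ℝ) / Real.pi ≠ 0 := by positivity
  have e1 : (2 : ℝ) / (2 / Real.pi) = Real.pi := by field_simp
  have hi : IntervalIntegrable (fun θ => ρ (2 / Real.pi * θ)) volume 0 Real.pi := by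
    have h2 := (hint 2 zero_le_two).comp_mul_left (c := 2 / Real.pi)
    rwa [zero_div, e1] at h2
  have key := circleInt_radial hm h0 hanti hi w
  refine ⟨key.1, (mul_le_mul_of_nonneg_left key.2 (by positivity)).trans ?_⟩
  have e2 : ∫ θ in (0 : ℝ)..Real.pi, ρ (2 / Real.pi * θ) =
      Real.pi / 2 * ∫ x in (0 : ℝ)..2, ρ x := by
    rw [intervalIntegral.integral_comp_mul_left ρ hc, mul_zero, smul_eq_mul]
    congr 2
    · field_simp
    · field_simp
  have i1 : ∫ x in (0 : ℝ)..δ, ρ x ≤ 1 / α * δ ^ α := by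
    have h1 : ∫ x in (0 : ℝ)..δ, ρ x ≤ ∫ x in (0 : ℝ)..δ, x ^ (α - 1) := by
      refine intervalIntegral.integral_mono_ae_restrict hδ.le (hint δ hδ.le)
        (intervalIntegral.intervalIntegrable_rpow' (by linarith)) ?_
      rw [← restrict_Ioc_eq_restrict_Icc]
      exact (ae_restrict_iff' measurableSet_Ioc).2
        (Eventually.of_forall fun x hx => hle1 x hx.1)
    rw [integral_rpow (Or.inl (by linarith)), sub_add_cancel, Real.zero_rpow hα0.ne', sub_zero]
      at h1
    refine h1.trans (le_of_eq ?_)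
    ring
  have i2 : ∫ x in δ..2, ρ x ≤ 1 / (1 - α) * δ ^ α := by
    have h0' : (0 : ℝ) ∉ Set.uIcc δ 2 := by
      rw [Set.uIcc_of_le (by linarith)]
      exact fun h => absurd h.1 (by linarith)
    have h1 : ∫ x in δ..2, ρ x ≤ ∫ x in δ..2, δ * x ^ (α - 2) := by
      refine intervalIntegral.integral_mono_on (by linarith) hint'
        ((intervalIntegral.intervalIntegrable_rpow (Or.inr h0')).const_mul δ) fun x hx => ?_
      exact hle2 x (hδ.trans_le hx.1)
    rw [intervalIntegral.integral_const_mul, integral_rpow (Or.inr ⟨by linarith, h0'⟩)] at h1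
    refine h1.trans ?_
    have e3 : α - 2 + 1 = -(1 - α) := by ring
    have e4 : δ ^ α = δ * δ ^ (-(1 - α)) := by
      rw [mul_comm, ← Real.rpow_add_one hδ.ne']
      congr 1
      ring
    rw [e3, e4]
    have h2 : (0 : ℝ) < 2 ^ (-(1 - α)) := by positivity
    rw [div_neg, ← neg_div, neg_sub, one_div, inv_mul_eq_div, mul_div_assoc']
    exact div_le_div_of_nonneg_right (mul_le_mul_of_nonneg_left (by linarith) hδ.le) h1α.le
  rw [e2, ← intervalIntegral.integral_add_adjacent_intervals (hint δ hδ.le) hint', mul_assoc]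
  refine mul_le_mul_of_nonneg_left ?_ (by positivity)
  rw [mul_assoc, mul_assoc]
  refine mul_le_mul_of_nonneg_left (mul_le_mul_of_nonneg_left ?_ (by positivity)) zero_le_two
  rw [add_mul]
  exact add_le_add i1 i2

/-- The boundary value at `w` of the Cauchy integral differs by `O(δ^α)` from its value at a point
`z` which is at distance at least `δ` from the circle and at most `2δ` from `w`. -/
theorem HolderBound.norm_cauchy_sub_le {α A K δ : ℝ} (hα0 : 0 < α) (hα1 : α < 1)
    {φ : Circle → ℂ} (h : HolderBound α A φ) {w : Circle} (hδ : 0 < δ)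
    (hi : CircleInt (fun ξ => |dist w ξ| ^ (α - 1) * min 1 (δ / |dist w ξ|)))
    (hK : (2 * Real.pi)⁻¹ * ∫ θ in (0 : ℝ)..(2 * Real.pi),
      |dist w (Circle.exp θ)| ^ (α - 1) * min 1 (δ / |dist w (Circle.exp θ)|) ≤ K * δ ^ α)
    {z : ℂ} (hz : ‖z‖ ≤ 1 - δ) (hwz : ‖(w : ℂ) - z‖ ≤ 2 * δ) :
    ‖φ w + circleMean (diffQuot φ w) - circleMean fun ξ => φ ξ * ((ξ : ℂ) - z)⁻¹‖ ≤
      6 * A * K * δ ^ α := by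
  have hz1 : ‖z‖ < 1 := by linarith
  have hA := h.nonneg
  have hcz := continuous_inv_coe_sub hz1
  have e1 : (circleMean fun ξ => ((ξ : ℂ) - z)⁻¹) = 1 := by simpa using circleMean_cauchy hz1 0
  have i1 : CircleInt fun ξ => φ w * ((ξ : ℂ) - z)⁻¹ :=
    CircleInt.of_continuous (continuous_const.mul hcz)
  have i2 : CircleInt fun ξ => φ ξ * ((ξ : ℂ) - z)⁻¹ :=
    CircleInt.of_continuous ((h.continuous hα0).mul hcz)
  have i3 := h.circleInt_diffQuot hα0 hα1 w
  have e2 : φ w + circleMean (diffQuot φ w) - (circleMean fun ξ => φ ξ * ((ξ : ℂ) - z)⁻¹) =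
      circleMean fun ξ => φ w * ((ξ : ℂ) - z)⁻¹ + diffQuot φ w ξ - φ ξ * ((ξ : ℂ) - z)⁻¹ := by
    rw [circleMean_sub (i1.add i3) i2, circleMean_add i1 i3, circleMean_const_mul, e1, mul_one]
  have hb : ∀ ξ, ξ ≠ w → ‖φ w * ((ξ : ℂ) - z)⁻¹ + diffQuot φ w ξ - φ ξ * ((ξ : ℂ) - z)⁻¹‖ ≤
      6 * A * (|dist w ξ| ^ (α - 1) * min 1 (δ / |dist w ξ|)) := by
    intro ξ hξ
    have h1 := coe_sub_ne_zero hξ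
    have h2 := coe_sub_ne_zero_of_norm_lt hz1 ξ
    have hd : 0 < dist w ξ := dist_pos.2 hξ.symm
    have e3 : φ w * ((ξ : ℂ) - z)⁻¹ + diffQuot φ w ξ - φ ξ * ((ξ : ℂ) - z)⁻¹ =
        diffQuot φ w ξ * (((w : ℂ) - z) / ((ξ : ℂ) - z)) := by
      rw [diffQuot]
      field_simp
      ring
    have h3 : δ ≤ ‖(ξ : ℂ) - z‖ := by
      have := norm_sub_norm_le (ξ : ℂ) z
      rw [Circle.norm_coe] at this
      linarith
    have h4 : dist w ξ ≤ 3 * ‖(ξ : ℂ) - z‖ := by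
      rw [circle_dist]
      have := norm_sub_le ((w : ℂ) - z) ((ξ : ℂ) - z)
      rw [sub_sub_sub_cancel_right] at this
      linarith
    have h5 : ‖((w : ℂ) - z) / ((ξ : ℂ) - z)‖ ≤ 6 * min 1 (δ / |dist w ξ|) := by
      rw [norm_div, abs_of_pos hd, mul_min_of_nonneg _ _ (by norm_num : (0 : ℝ) ≤ 6)]
      refine le_min ?_ ?_
      · rw [div_le_iff₀ (hδ.trans_le h3)]
        linarith
      · rw [mul_div_assoc', div_le_div_iff₀ (hδ.trans_le h3) hd]
        nlinarith [norm_nonneg ((w : ℂ) - z)]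
    rw [e3, norm_mul]
    have h6 := h.norm_diffQuot_le w ξ hξ
    rw [neg_sub] at h6
    refine (mul_le_mul h6 h5 (norm_nonneg _) (by positivity)).trans (le_of_eq ?_)
    ring
  rw [e2]
  refine (norm_circleMean_le w (hi.const_mul (6 * A)) hb).trans ?_
  rw [intervalIntegral.integral_const_mul, mul_left_comm, mul_assoc (6 * A)]
  exact mul_le_mul_of_nonneg_left hK (by positivity)

/-- Privalov's theorem: the Cauchy projection preserves `C^α`, `0 < α < 1`. -/
theorem HolderBound.exists_cauchyProjection {α A : ℝ} (hα0 : 0 < α) (hα1 : α < 1)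
    {φ : Circle → ℂ} (h : HolderBound α A φ) :
    ∃ B, HolderBound α B fun w => φ w + circleMean (diffQuot φ w) := by
  obtain ⟨hi, K₀, hK₀, hK₀'⟩ := circleInt_rpow (s := 1 - α) (by linarith) (by linarith)
  obtain ⟨K, hK, hK'⟩ := circleInt_truncated hα0 hα1
  have hA := h.nonneg
  have hb : ∀ w, ‖φ w + circleMean (diffQuot φ w)‖ ≤ A + A * K₀ := by
    intro w
    refine (norm_add_le _ _).trans (add_le_add (h.1 w) ?_)
    refine (norm_circleMean_le w ((hi w).const_mul A) (h.norm_diffQuot_le w)).trans ?_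
    rw [intervalIntegral.integral_const_mul, mul_left_comm]
    exact mul_le_mul_of_nonneg_left (hK₀' w) hA
  refine ⟨2 * (A + A * K₀) + 12 * A * K, fun w => (hb w).trans ?_, fun w w' => ?_⟩
  · have : 0 ≤ A * K := mul_nonneg hA hK
    have : 0 ≤ A * K₀ := mul_nonneg hA hK₀
    linarith
  · rcases eq_or_ne w w' with rfl | hne
    · rw [sub_self, norm_zero, dist_self, Real.zero_rpow hα0.ne', mul_zero]
    have hδ : 0 < dist w w' := dist_pos.2 hne
    rw [add_mul]
    have hAK : 0 ≤ 12 * A * K * dist w w' ^ α := by positivity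
    have hAK₀ : 0 ≤ 2 * (A + A * K₀) * dist w w' ^ α := by positivity
    rcases le_total 1 (dist w w') with h1 | h1
    · have h2 : 1 ≤ dist w w' ^ α := Real.one_le_rpow h1 hα0.le
      have h3 := (norm_sub_le _ _).trans (add_le_add (hb w) (hb w'))
      have h4 : 0 ≤ 2 * (A + A * K₀) := by positivity
      nlinarith
    · set δ := dist w w' with hδ'
      set z : ℂ := ((1 - δ : ℝ) : ℂ) * w with hz
      have hz1 : ‖z‖ ≤ 1 - δ := by
        rw [hz, norm_mul, Circle.norm_coe, mul_one, Complex.norm_real,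
          Real.norm_of_nonneg (by linarith)]
      have h2 : ‖(w : ℂ) - z‖ = δ := by
        have : (w : ℂ) - z = (δ : ℂ) * w := by
          rw [hz]
          push_cast
          ring
        rw [this, norm_mul, Circle.norm_coe, mul_one, Complex.norm_real,
          Real.norm_of_nonneg hδ.le]
      have h3 : ‖(w' : ℂ) - z‖ ≤ 2 * δ := by
        have := norm_sub_le_norm_sub_add_norm_sub (w' : ℂ) w z
        rw [← circle_dist, h2, dist_comm, ← hδ'] at this
        linarith
      have k1 := h.norm_cauchy_sub_le hα0 hα1 hδ (hK' δ hδ h1 w).1 (hK' δ hδ h1 w).2 hz1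
        (by rw [h2]; linarith)
      have k2 := h.norm_cauchy_sub_le hα0 hα1 hδ (hK' δ hδ h1 w').1 (hK' δ hδ h1 w').2 hz1 h3
      have k3 := (norm_sub_le _ _).trans (add_le_add k1 k2)
      rw [sub_sub_sub_cancel_right] at k3
      linarith

/-! ### Coefficients of Hölder functions -/

theorem circleMean_rotate (f : Circle → ℂ) (u : Circle) :
    (circleMean fun ξ => f (ξ * u)) * (u : ℂ) = circleMean f := by
  have hper : Function.Periodic (fun θ : ℝ => f (Circle.exp θ) * (Circle.exp θ : ℂ))
      (2 * Real.pi) := fun θ => by simp only [Circle.periodic_exp θ]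
  have h1 := hper.intervalIntegral_add_eq (u : ℂ).arg 0
  rw [zero_add, add_comm] at h1
  rw [circleMean_eq, circleMean_eq, mul_assoc, ← intervalIntegral.integral_mul_const, ← h1]
  have h2 := intervalIntegral.integral_comp_add_right (a := 0) (b := 2 * Real.pi)
    (fun θ : ℝ => f (Circle.exp θ) * (Circle.exp θ : ℂ)) (u : ℂ).arg
  rw [zero_add] at h2
  rw [← h2]
  simp only [Circle.exp_add, Circle.exp_arg, Circle.coe_mul, mul_assoc]

/-- The coefficients of an `α`-Hölder function are `O(n^{-α})`: rotation by the angle `π / n`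
changes the sign of `ξ^n`. -/
theorem HolderBound.norm_fourierCoef_le {α A : ℝ} (hα0 : 0 < α) {φ : Circle → ℂ}
    (h : HolderBound α A φ) {n : ℕ} (hn : 1 ≤ n) :
    ‖fourierCoef φ n‖ ≤ A * (Real.pi / n) ^ α := by
  have hn0 : (0 : ℝ) < n := by exact_mod_cast hn
  have hpi := Real.pi_pos
  set u : Circle := Circle.exp (Real.pi / n) with hu
  have hun : (u : ℂ) ^ n = -1 := by
    rw [hu, Circle.coe_exp, ← Complex.exp_nat_mul, ← Complex.exp_pi_mul_I]
    congr 1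
    push_cast
    have : (n : ℂ) ≠ 0 := by exact_mod_cast hn0.ne'
    field_simp
  have hz := continuous_coe_zpow
  have hφ := h.continuous hα0
  have e1 : fourierCoef φ n = -circleMean fun ξ => φ (ξ * u) * (ξ : ℂ) ^ (-(n : ℤ) - 1) := by
    rw [fourierCoef, ← circleMean_rotate _ u, ← circleMean_mul_const,
      ← neg_one_mul (circleMean _), ← circleMean_const_mul]
    congr 1
    funext ξ
    have h1 : (u : ℂ) ^ (-(n : ℤ) - 1) * u = -1 := by
      rw [← zpow_add_one₀ (Circle.coe_ne_zero u), sub_add_cancel, zpow_neg, zpow_natCast, hun]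
      norm_num
    rw [Circle.coe_mul, mul_zpow]
    linear_combination φ (ξ * u) * (ξ : ℂ) ^ (-(n : ℤ) - 1) * h1
  have i1 : CircleInt fun ξ => φ ξ * (ξ : ℂ) ^ (-(n : ℤ) - 1) :=
    CircleInt.of_continuous (hφ.mul (hz _))
  have i2 : CircleInt fun ξ => φ (ξ * u) * (ξ : ℂ) ^ (-(n : ℤ) - 1) :=
    CircleInt.of_continuous ((hφ.comp (continuous_id.mul continuous_const)).mul (hz _))
  have e2 : 2 * fourierCoef φ n = circleMean fun ξ =>
      φ ξ * (ξ : ℂ) ^ (-(n : ℤ) - 1) - φ (ξ * u) * (ξ : ℂ) ^ (-(n : ℤ) - 1) := by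
    rw [circleMean_sub i1 i2, two_mul]
    nth_rewrite 2 [e1]
    rw [fourierCoef]
    ring
  have h1 : ‖2 * fourierCoef φ n‖ ≤ A * (Real.pi / n) ^ α := by
    rw [e2]
    refine norm_circleMean_le_of_bounded fun ξ => ?_
    rw [← sub_mul, norm_mul, norm_coe_zpow, mul_one]
    refine (h.2 _ _).trans (mul_le_mul_of_nonneg_left ?_ h.nonneg)
    refine Real.rpow_le_rpow dist_nonneg ?_ hα0.le
    have h2 : dist ξ (ξ * u) = dist (Circle.exp 0) (Circle.exp (Real.pi / n)) := by
      rw [circle_dist, circle_dist, Circle.coe_mul, ← mul_one_sub, norm_mul, Circle.norm_coe,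
        one_mul, Circle.exp_zero, Circle.coe_one]
    rw [h2, exp_dist_exp, sub_zero]
    have h3 := Real.abs_sin_le_abs (x := Real.pi / n / 2)
    rw [abs_of_pos (by positivity : 0 < Real.pi / n / 2)] at h3
    linarith
  rw [norm_mul] at h1
  have : ‖(2 : ℂ)‖ = 2 := by norm_num
  rw [this] at h1
  linarith [norm_nonneg (fourierCoef φ n)]

theorem HasSineSeries.apply_inv {c : ℕ → ℝ} {g : Circle → ℝ} (h : HasSineSeries c g)
    (w : Circle) : g w⁻¹ = -g w := by
  have h1 : ∀ n, eMode n w⁻¹ = -eMode n w := by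
    intro n
    rw [eMode, eMode, Circle.coe_inv, ← conj_coe, ← map_pow, Complex.conj_im]
  have h2 := h.1 w⁻¹
  simp only [h1, mul_neg, Finset.sum_neg_distrib] at h2
  exact tendsto_nhds_unique h2 (h.1 w).neg

/-- The nonnegative Fourier coefficients of `2 i g`, for `g = ∑ c_n Im(w^n)`. -/
theorem HasSineSeries.fourierCoef {c : ℕ → ℝ} {g : Circle → ℝ} (hg : Continuous g)
    (h : HasSineSeries c g) (n : ℕ) :
    fourierCoef (fun w => 2 * Complex.I * (g w : ℂ)) n = if n = 0 then 0 else (c n : ℂ) := by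
  set C : ℝ → ℝ := fun θ => g (Circle.exp θ) * ((Circle.exp θ : ℂ) ^ n).re with hC
  set S : ℝ → ℝ := fun θ => g (Circle.exp θ) * eMode n (Circle.exp θ) with hS
  have hge : Continuous fun θ : ℝ => g (Circle.exp θ) := hg.comp Circle.exp.continuous
  have hce := continuous_circle_coe.comp Circle.exp.continuous
  have hCc : Continuous C := hge.mul (Complex.continuous_re.comp (hce.pow n))
  have hSc : Continuous S := hge.mul ((continuous_eMode n).comp Circle.exp.continuous)
  have hCint : ∫ θ in (0 : ℝ)..(2 * Real.pi), C θ = 0 := by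
    have h1 := intervalIntegral.integral_comp_sub_left (a := 0) (b := 2 * Real.pi) C (2 * Real.pi)
    rw [sub_self, sub_zero] at h1
    have h2 : ∀ θ, C (2 * Real.pi - θ) = -C θ := by
      intro θ
      have h3 : Circle.exp (2 * Real.pi - θ) = (Circle.exp θ)⁻¹ := by
        rw [Circle.exp_sub, Circle.exp_two_pi, one_div]
      simp only [hC]
      rw [h3, h.apply_inv, Circle.coe_inv, ← conj_coe, ← map_pow, Complex.conj_re, neg_mul]
    simp only [h2, intervalIntegral.integral_neg] at h1
    linarith
  have e1 : ∀ θ : ℝ, 2 * Complex.I * (g (Circle.exp θ) : ℂ) * (Circle.exp θ : ℂ) ^ (-(n : ℤ) - 1) *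
      (Circle.exp θ : ℂ) = 2 * Complex.I * (C θ : ℂ) + 2 * (S θ : ℂ) := by
    intro θ
    have h1 : (Circle.exp θ : ℂ) ^ (-(n : ℤ) - 1) * (Circle.exp θ : ℂ) =
        (starRingEnd ℂ) ((Circle.exp θ : ℂ) ^ n) := by
      rw [← zpow_add_one₀ (Circle.coe_ne_zero _), sub_add_cancel, zpow_neg, zpow_natCast, map_pow,
        conj_coe, inv_pow]
    rw [mul_assoc, h1]
    have h2 : (starRingEnd ℂ) ((Circle.exp θ : ℂ) ^ n) =
        (((Circle.exp θ : ℂ) ^ n).re : ℂ) - (((Circle.exp θ : ℂ) ^ n).im : ℂ) * Complex.I := by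
      generalize (Circle.exp θ : ℂ) ^ n = ζ
      refine Complex.ext ?_ ?_ <;> simp
    rw [h2]
    simp only [hC, hS, eMode, Complex.ofReal_mul]
    linear_combination (-2 * (g (Circle.exp θ) : ℂ) * (((Circle.exp θ : ℂ) ^ n).im : ℂ)) *
      Complex.I_mul_I
  have hC1 : Continuous fun θ => 2 * Complex.I * (C θ : ℂ) :=
    continuous_const.mul (Complex.continuous_ofReal.comp hCc)
  have hS1 : Continuous fun θ => 2 * (S θ : ℂ) :=
    continuous_const.mul (Complex.continuous_ofReal.comp hSc)
  rw [RotatingPatch.fourierCoef, circleMean_eq]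
  simp only [e1]
  rw [intervalIntegral.integral_add (hC1.intervalIntegrable _ _) (hS1.intervalIntegrable _ _),
    intervalIntegral.integral_const_mul, intervalIntegral.integral_const_mul,
    intervalIntegral.integral_ofReal, intervalIntegral.integral_ofReal, hCint]
  rcases Nat.eq_zero_or_pos n with rfl | hn
  · simp [hS, eMode]
  · rw [if_neg hn.ne', ← h.2 n hn]
    have : (Real.pi : ℂ) ≠ 0 := by exact_mod_cast Real.pi_ne_zero
    push_cast
    field_simp
    simp [hS]

/-- A Hölder sine series is the imaginary part of a Hölder function without negative frequencies;
its coefficients decay like `n^{-α}`. -/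
theorem HasSineSeries.exists_analytic {α A : ℝ} (hα0 : 0 < α) (hα1 : α < 1) {c : ℕ → ℝ}
    {g : Circle → ℝ} (h : HasSineSeries c g) (hg : HolderBound α A g) :
    ∃ (G : Circle → ℂ) (B D : ℝ), HolderBound α B G ∧ BoundedSeries (fun n => (c n : ℂ)) G ∧
      ∀ n : ℕ, 1 ≤ n → |c n| ≤ D * (n : ℝ) ^ (-α) := by
  have hφ := (HolderBound.const (α := α) (2 * Complex.I)).mul hg.ofReal
  have hc := h.fourierCoef (hg.continuous hα0)
  obtain ⟨B, hB⟩ := hφ.exists_cauchyProjection hα0 hα1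
  refine ⟨_, B, 2 * ‖2 * Complex.I‖ * A * Real.pi ^ α, hB,
    (hφ.boundedSeries hα0 hα1 (by simpa using hc 0)).congr fun n => ?_, fun n hn => ?_⟩
  · rw [hc, if_neg n.succ_ne_zero]
  · have h1 := hφ.norm_fourierCoef_le hα0 hn
    rw [hc, if_neg (by omega), Complex.norm_real, Real.norm_eq_abs,
      Real.div_rpow Real.pi_pos.le (Nat.cast_nonneg n)] at h1
    refine h1.trans (le_of_eq ?_)
    rw [Real.rpow_neg (Nat.cast_nonneg n)]
    ring

/-! ### The dispersion relation -/

theorem hasDerivAt_dispersion (m : ℕ) (Q : ℝ) :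
    HasDerivAt (dispersion m) (m * Q ^ (m - 1) + m * Q) Q := by
  have h1 := ((hasDerivAt_pow m Q).const_add 1).sub
    ((((hasDerivAt_pow 2 Q).const_sub 1).div_const 2).mul_const (m : ℝ))
  refine h1.congr_deriv ?_
  norm_num
  ring

theorem dispersion_strictMonoOn {m : ℕ} (hm : 1 ≤ m) :
    StrictMonoOn (dispersion m) (Set.Icc 0 1) := by
  intro x hx y hy hxy
  have h1 : x ^ m < y ^ m := pow_lt_pow_left₀ hxy hx.1 (by omega)
  have h2 : x ^ 2 < y ^ 2 := pow_lt_pow_left₀ hxy hx.1 two_ne_zero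
  have h3 : (1 : ℝ) ≤ m := by exact_mod_cast hm
  simp only [dispersion]
  nlinarith

theorem existsUnique_dispersion {m : ℕ} (hm : 3 ≤ m) :
    ∃! Q : ℝ, (0 < Q ∧ Q < 1) ∧ dispersion m Q = 0 := by
  have h0 : dispersion m 0 < 0 := by
    have h3 : (3 : ℝ) ≤ m := by exact_mod_cast hm
    rw [dispersion, zero_pow (by omega)]
    linarith
  have h1 : 0 < dispersion m 1 := by
    rw [dispersion]
    norm_num
  have hc : ContinuousOn (dispersion m) (Set.Icc 0 1) := fun x _ =>
    (hasDerivAt_dispersion m x).continuousAt.continuousWithinAt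
  obtain ⟨Q, hQ, hQ'⟩ := intermediate_value_Ioo zero_le_one hc ⟨h0, h1⟩
  refine ⟨Q, ⟨hQ, hQ'⟩, fun q hq => ?_⟩
  exact (dispersion_strictMonoOn (by omega)).injOn ⟨hq.1.1.le, hq.1.2.le⟩ ⟨hQ.1.le, hQ.2.le⟩
    (hq.2.trans hQ'.symm)

theorem dispersion_add_le {Q : ℝ} (hQ0 : 0 < Q) (hQ1 : Q < 1) (n k : ℕ) :
    dispersion (n + k) Q + k * ((1 - Q ^ 2) / 2) ≤ dispersion n Q := by
  have h1 : Q ^ (n + k) ≤ Q ^ n := pow_le_pow_of_le_one hQ0.le hQ1.le (Nat.le_add_right _ _)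
  simp only [dispersion]
  push_cast
  linarith

theorem dispersion_one_pos {Q : ℝ} (hQ0 : 0 < Q) : 0 < dispersion 1 Q := by
  have : dispersion 1 Q = (1 + Q) ^ 2 / 2 := by
    rw [dispersion]
    push_cast
    ring
  rw [this]
  positivity

theorem dispersion_two_pos {Q : ℝ} (hQ0 : 0 < Q) : 0 < dispersion 2 Q := by
  have : dispersion 2 Q = 2 * Q ^ 2 := by
    rw [dispersion]
    push_cast
    ring
  rw [this]
  positivity

/-- Away from its zero `m`, the dispersion function grows linearly in `n`. -/
theorem le_abs_dispersion {Q : ℝ} (hQ0 : 0 < Q) (hQ1 : Q < 1) {m n : ℕ}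
    (hm : dispersion m Q = 0) (hn : n ≠ m) :
    (1 - Q ^ 2) / 2 / (m + 1) * n ≤ |dispersion n Q| := by
  set τ := (1 - Q ^ 2) / 2 with hτ
  have hτ0 : 0 < τ := by rw [hτ]; nlinarith
  have hm0 : (0 : ℝ) ≤ m := Nat.cast_nonneg m
  rw [div_mul_eq_mul_div, div_le_iff₀ (by positivity)]
  rcases lt_or_gt_of_ne hn with h | h
  · obtain ⟨k, rfl⟩ := Nat.exists_eq_add_of_lt h
    have h1 := dispersion_add_le hQ0 hQ1 n (k + 1)
    rw [show n + (k + 1) = n + k + 1 from rfl, hm, zero_add, ← hτ] at h1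
    have h2 := h1.trans (le_abs_self _)
    push_cast at h2 ⊢
    have h3 : (0 : ℝ) ≤ k := Nat.cast_nonneg k
    have h4 : (0 : ℝ) ≤ n := Nat.cast_nonneg n
    have h5 : τ ≤ |dispersion n Q| := by nlinarith
    nlinarith [mul_nonneg (abs_nonneg (dispersion n Q)) (add_nonneg h4 h3)]
  · obtain ⟨k, rfl⟩ := Nat.exists_eq_add_of_lt h
    have h1 := dispersion_add_le hQ0 hQ1 m (k + 1)
    rw [show m + (k + 1) = m + k + 1 from rfl, hm, ← hτ] at h1
    have h2 := neg_le_abs (dispersion (m + k + 1) Q)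
    push_cast at h1 h2 ⊢
    have h3 : (0 : ℝ) ≤ k := Nat.cast_nonneg k
    have h5 : (k + 1) * τ ≤ |dispersion (m + k + 1) Q| := by linarith
    have h6 := mul_le_mul_of_nonneg_right h5 (by positivity : (0 : ℝ) ≤ m + 1)
    have h7 : 0 ≤ τ * (k * m) := by positivity
    nlinarith

theorem dispersion_ne_zero {Q : ℝ} (hQ0 : 0 < Q) (hQ1 : Q < 1) {m n : ℕ}
    (hm : dispersion m Q = 0) (hn1 : 1 ≤ n) (hn : n ≠ m) : dispersion n Q ≠ 0 := by
  have h1 := le_abs_dispersion hQ0 hQ1 hm hn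
  have h2 : (0 : ℝ) < n := by exact_mod_cast hn1
  have h3 : 0 < (1 - Q ^ 2) / 2 := by nlinarith
  have : 0 < (1 - Q ^ 2) / 2 / (m + 1) * n := by positivity
  exact abs_pos.1 (this.trans_le h1)

/-! ### Series with smoothing multipliers -/

theorem norm_coe_pow_sub_le (w w' : Circle) (n : ℕ) :
    ‖(w : ℂ) ^ n - (w' : ℂ) ^ n‖ ≤ n * dist w w' := by
  induction n with
  | zero => simp
  | succ n ih =>
    have e : (w : ℂ) ^ (n + 1) - (w' : ℂ) ^ (n + 1) =
        ((w : ℂ) ^ n - (w' : ℂ) ^ n) * w + (w' : ℂ) ^ n * ((w : ℂ) - w') := by ring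
    rw [e]
    refine (norm_add_le _ _).trans ?_
    rw [norm_mul, norm_mul, norm_pow, Circle.norm_coe, Circle.norm_coe, one_pow, mul_one, one_mul,
      ← circle_dist]
    push_cast
    linarith

theorem AbsSeries.holderBound {α : ℝ} (hα0 : 0 ≤ α) (hα1 : α ≤ 1) {c : ℕ → ℂ} {p : Circle → ℂ}
    (hp : AbsSeries c p) (hs : Summable fun n : ℕ => ((n : ℝ) + 1) * ‖c (n + 1)‖) :
    HolderBound α (2 * ∑' n : ℕ, ((n : ℝ) + 1) * ‖c (n + 1)‖) p := by
  refine HolderBound.of_lipschitz hα0 hα1 (fun w => ?_) fun w w' => ?_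
  · rw [← (hp.2 w).tsum_eq]
    refine tsum_of_norm_bounded hs.hasSum fun n => ?_
    rw [norm_mul, norm_pow, Circle.norm_coe, one_pow, mul_one]
    have : (0 : ℝ) ≤ n * ‖c (n + 1)‖ := by positivity
    linarith
  · have h1 := (hp.2 w).sub (hp.2 w')
    rw [← h1.tsum_eq, mul_comm, ← tsum_mul_left]
    refine tsum_of_norm_bounded (hs.mul_left _).hasSum fun n => ?_
    rw [← mul_sub, norm_mul]
    have h2 := mul_le_mul_of_nonneg_left (norm_coe_pow_sub_le w w' (n + 1))
      (norm_nonneg (c (n + 1)))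
    push_cast at h2
    linarith

theorem AbsSeries.of_summable {c : ℕ → ℂ} (hs : Summable fun n => ‖c (n + 1)‖) :
    AbsSeries c fun w => ∑' n, c (n + 1) * (w : ℂ) ^ (n + 1) :=
  ⟨hs, fun w => (Summable.of_norm
    (by simpa only [norm_mul, norm_pow, Circle.norm_coe, one_pow, mul_one] using hs)).hasSum⟩

/-- Let `n b_n = κ₀ c_n + κ₁ c_n / n + O(c_n / n²)`, where the `c_n` are the coefficients of a
Hölder function. Then `∑ b_n w^n` is of class `C^{1+α}`: its derivative is a combination of the
given function, its antiderivative and an absolutely convergent Lipschitz remainder. -/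
theorem BoundedSeries.exists_antideriv {α A D κ₀ κ₁ K : ℝ} (hα0 : 0 < α) (hα1 : α < 1)
    {c b r : ℕ → ℝ} {g : Circle → ℂ} (hg : HolderBound α A g)
    (hs : BoundedSeries (fun n => (c n : ℂ)) g)
    (hD : ∀ n : ℕ, 1 ≤ n → |c n| ≤ D * (n : ℝ) ^ (-α))
    (hb : ∀ n : ℕ, 1 ≤ n → n * b n = κ₀ * c n + κ₁ * (c n / n) + r n)
    (hr : ∀ n : ℕ, 1 ≤ n → |r n| ≤ K * (|c n| / n ^ 2)) :
    ∃ (p p' : Circle → ℂ) (B : ℝ), AbsSeries (fun n => (b n : ℂ)) p ∧ HasCircleDeriv p p' ∧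
      HolderBound α B p' := by
  have hwi := HolderBound.inv_coe hα0.le hα1.le
  have S0 : Summable fun n : ℕ => |c (n + 1)| / ((n : ℝ) + 1) := by
    have h1 : Summable fun n : ℕ => D * (n : ℝ) ^ (-α - 1) :=
      (Real.summable_nat_rpow.2 (by linarith)).mul_left D
    refine Summable.of_nonneg_of_le (fun n => by positivity) (fun n => ?_)
      ((summable_nat_add_iff 1).2 h1)
    have h2 := hD (n + 1) (by omega)
    have h3 : (0 : ℝ) < ((n + 1 : ℕ) : ℝ) := by exact_mod_cast n.succ_pos
    rw [Real.rpow_sub_one h3.ne', mul_div_assoc']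
    push_cast at h2 h3 ⊢
    exact div_le_div_of_nonneg_right h2 h3.le
  -- the antiderivative
  have A1 := AbsSeries.of_summable (c := fun n => ((c n / n : ℝ) : ℂ)) (by
    refine S0.congr fun n => ?_
    rw [Complex.norm_real, Real.norm_eq_abs, abs_div]
    push_cast
    rw [abs_of_pos (by positivity : (0 : ℝ) < (n : ℝ) + 1)])
  have H1 := hs.hasCircleDeriv (hg.continuous hα0) (P := _) fun w => by
    refine (A1.2 w).congr_fun fun n => ?_
    push_cast
    rfl
  obtain ⟨B0, hB0⟩ := isCompact_univ.exists_bound_of_continuousOn A1.continuous.continuousOn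
  have hgb := hg.mul hwi
  have hb1 := H1.holderBound hα0.le hα1.le (fun w => (hB0 w trivial).trans (le_max_left _ _))
    (fun w => (hgb.1 w).trans (le_max_right B0 _))
  -- the remainder
  have S1 : Summable fun n : ℕ => ((n : ℝ) + 1) * ‖(r (n + 1) : ℂ)‖ := by
    refine Summable.of_nonneg_of_le (fun n => by positivity) (fun n => ?_) (S0.mul_left K)
    have h2 := hr (n + 1) (by omega)
    have h3 : (0 : ℝ) < (n : ℝ) + 1 := by positivity
    rw [Complex.norm_real, Real.norm_eq_abs]
    refine (mul_le_mul_of_nonneg_left h2 h3.le).trans (le_of_eq ?_)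
    push_cast
    field_simp
  have S2 : Summable fun n : ℕ => ‖(r (n + 1) : ℂ)‖ := by
    refine Summable.of_nonneg_of_le (fun n => norm_nonneg _) (fun n => ?_) S1
    have : (0 : ℝ) ≤ n * ‖(r (n + 1) : ℂ)‖ := by positivity
    linarith
  have A2 := AbsSeries.of_summable (c := fun n => (r n : ℂ)) S2
  have hb2 := A2.holderBound hα0.le hα1.le S1
  have hsum := ((hs.const_mul (κ₀ : ℂ)).add (A1.boundedSeries.const_mul (κ₁ : ℂ))).add
    A2.boundedSeries
  have hbsum := (((HolderBound.const (κ₀ : ℂ)).mul hg).add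
    ((HolderBound.const (κ₁ : ℂ)).mul hb1)).add hb2
  have hcoef : ∀ n : ℕ, (κ₀ : ℂ) * c (n + 1) +
      κ₁ * ((c (n + 1) / ((n + 1 : ℕ) : ℝ) : ℝ) : ℂ) + r (n + 1) =
        ((n : ℂ) + 1) * b (n + 1) := by
    intro n
    have h1 := hb (n + 1) (by omega)
    have h2 : (((((n + 1 : ℕ) : ℝ) * b (n + 1) : ℝ)) : ℂ) = ((κ₀ * c (n + 1) +
        κ₁ * (c (n + 1) / ((n + 1 : ℕ) : ℝ)) + r (n + 1) : ℝ) : ℂ) := by rw [h1]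
    push_cast at h2 ⊢
    exact h2.symm
  have S3 : Summable fun n : ℕ => ‖(b (n + 1) : ℂ)‖ := by
    have S4 := ((S0.mul_left |κ₀|).add (S0.mul_left |κ₁|)).add S2
    refine Summable.of_nonneg_of_le (fun n => norm_nonneg _) (fun n => ?_) S4
    have h1 := hb (n + 1) (by omega)
    have h3 : (1 : ℝ) ≤ (n : ℝ) + 1 := by
      have : (0 : ℝ) ≤ n := Nat.cast_nonneg n
      linarith
    have h4 : b (n + 1) = κ₀ * (c (n + 1) / (n + 1)) + κ₁ * (c (n + 1) / (n + 1)) / (n + 1) +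
        r (n + 1) / (n + 1) := by
      push_cast at h1
      have h5 : (n : ℝ) + 1 ≠ 0 := by positivity
      field_simp
      field_simp at h1
      linear_combination h1
    rw [Complex.norm_real, Complex.norm_real, Real.norm_eq_abs, Real.norm_eq_abs, h4]
    have e1 : |κ₀ * (c (n + 1) / (n + 1))| = |κ₀| * (|c (n + 1)| / (n + 1)) := by
      rw [abs_mul, abs_div, abs_of_pos (by positivity : (0 : ℝ) < (n : ℝ) + 1)]
    have e2 : |κ₁ * (c (n + 1) / (n + 1)) / (n + 1)| ≤ |κ₁| * (|c (n + 1)| / (n + 1)) := by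
      rw [abs_div, abs_mul, abs_div, abs_of_pos (by positivity : (0 : ℝ) < (n : ℝ) + 1)]
      exact div_le_self (by positivity) h3
    have e3 : |r (n + 1) / (n + 1)| ≤ |r (n + 1)| := by
      rw [abs_div, abs_of_pos (by positivity : (0 : ℝ) < (n : ℝ) + 1)]
      exact div_le_self (by positivity) h3
    refine (abs_add_le _ _).trans (add_le_add ((abs_add_le _ _).trans (add_le_add e1.le e2)) e3)
  have A3 := AbsSeries.of_summable (c := fun n => (b n : ℂ)) S3
  refine ⟨_, _, _, A3, hsum.hasCircleDeriv (hbsum.continuous hα0) fun w => ?_, hbsum.mul hwi⟩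
  refine (A3.2 w).congr_fun fun n => ?_
  have h5 : (n : ℂ) + 1 ≠ 0 := by exact_mod_cast n.succ_ne_zero
  rw [hcoef, mul_div_cancel_left₀ _ h5]

/-! ### Solving the recursion for the coefficients -/

/-- The solution of `a_{n+1} - Q a_{n-1} = b_n`, `n ≥ 1`, with `a_0 = a_1 = 0`. -/
def resolventCoef (Q : ℝ) (b : ℕ → ℝ) : ℕ → ℝ
  | 0 => 0
  | 1 => 0
  | n + 2 => Q * resolventCoef Q b n + b (n + 1)

theorem summable_resolventCoef {Q : ℝ} (hQ0 : 0 < Q) (hQ1 : Q < 1) {b : ℕ → ℝ}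
    (hb : Summable fun n => |b (n + 1)|) : Summable fun n => |resolventCoef Q b n| := by
  set B := ∑' n, |b (n + 1)| with hB
  have hB0 : 0 ≤ B := tsum_nonneg fun _ => abs_nonneg _
  have h1Q : 0 < 1 - Q := by linarith
  refine summable_of_sum_range_le (c := B / (1 - Q)) (fun _ => abs_nonneg _) fun N => ?_
  induction N using Nat.strong_induction_on with
  | _ N ih =>
    match N with
    | 0 => simpa using by positivity
    | 1 => simpa [resolventCoef] using by positivity
    | N + 2 =>
      rw [Finset.sum_range_succ', Finset.sum_range_succ']
      simp only [resolventCoef, abs_zero, add_zero]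
      have h1 : ∑ n ∈ Finset.range N, |Q * resolventCoef Q b n + b (n + 1)| ≤
          ∑ n ∈ Finset.range N, (Q * |resolventCoef Q b n| + |b (n + 1)|) := by
        refine Finset.sum_le_sum fun n _ => (abs_add_le _ _).trans (le_of_eq ?_)
        rw [abs_mul, abs_of_pos hQ0]
      rw [Finset.sum_add_distrib, ← Finset.mul_sum] at h1
      have h2 := mul_le_mul_of_nonneg_left (ih N (by omega)) hQ0.le
      have h3 : ∑ n ∈ Finset.range N, |b (n + 1)| ≤ B := hb.sum_le_tsum _ fun _ _ => abs_nonneg _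
      have h4 : B / (1 - Q) = Q * (B / (1 - Q)) + B := by
        field_simp
        ring
      linarith

theorem one_sub_mul_sq_ne_zero {Q : ℝ} (hQ0 : 0 < Q) (hQ1 : Q < 1) (w : Circle) :
    1 - (Q : ℂ) * (w : ℂ) ^ 2 ≠ 0 := by
  refine sub_ne_zero.2 fun h => ?_
  have := congrArg norm h
  rw [norm_one, norm_mul, norm_pow, Circle.norm_coe, one_pow, mul_one, Complex.norm_real,
    Real.norm_of_nonneg hQ0.le] at this
  linarith

/-- If `p = ∑_{n ≥ 1} b_n w^n` is of class `C^{1+α}`, then `w p(w) / (1 - Q w²)` is an element of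
`X`, with the coefficients that solve the recursion. -/
theorem exists_resolvent {α : ℝ≥0} (hα1 : α < 1) {Q : ℝ} (hQ0 : 0 < Q) (hQ1 : Q < 1)
    {b : ℕ → ℝ} {p p' : Circle → ℂ} {B : ℝ} (hp : AbsSeries (fun n => (b n : ℂ)) p)
    (H : HasCircleDeriv p p') (hp' : HolderBound α B p') :
    ∃ h : spaceX α, (∀ w, (h : Circle → ℂ) w = w * p w * (1 - (Q : ℂ) * (w : ℂ) ^ 2)⁻¹) ∧
      HasPowerSeries (resolventCoef Q b) (h : Circle → ℂ) := by
  have hs := summable_resolventCoef hQ0 hQ1 (b := b) (by simpa using hp.1)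
  have hA := AbsSeries.of_summable (c := fun n => (resolventCoef Q b n : ℂ))
    (by simpa using (summable_nat_add_iff 1).2 hs)
  set k : Circle → ℂ := fun w => ∑' n, (resolventCoef Q b (n + 1) : ℂ) * (w : ℂ) ^ (n + 1) with hk
  have hne := one_sub_mul_sq_ne_zero hQ0 hQ1
  have hkp : ∀ w, k w = w * p w * (1 - (Q : ℂ) * (w : ℂ) ^ 2)⁻¹ := by
    intro w
    have h1 := (hA.shift Q rfl rfl).2 w
    have h2 := (hp.2 w).congr_fun (g := fun n => ((resolventCoef Q b (n + 1 + 1) -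
      Q * resolventCoef Q b (n + 1 - 1) : ℝ) : ℂ) * (w : ℂ) ^ (n + 1)) fun n => by
        rw [Nat.add_sub_cancel, resolventCoef, add_sub_cancel_left]
    have h3 := h1.unique h2
    have hw := Circle.coe_ne_zero w
    have h4 : (((w : ℂ))⁻¹ - Q * w) * k w = p w := h3
    rw [eq_mul_inv_iff_mul_eq₀ (hne w), ← h4]
    field_simp
  have hw := HolderBound.coe (α := α) α.coe_nonneg hα1.le
  obtain ⟨B₀, hB₀⟩ := isCompact_univ.exists_bound_of_continuousOn H.continuous.continuousOn
  have hpb := H.holderBound α.coe_nonneg hα1.le (fun w => (hB₀ w trivial).trans (le_max_left B₀ B))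
    (fun w => (hp'.1 w).trans (le_max_right B₀ B))
  -- the derivative of the factor `w / (1 - Q w²)`
  have d0 := (HasCircleDeriv.const 1).add
    ((HasCircleDeriv.coe.mul HasCircleDeriv.coe).const_mul (-(Q : ℂ)))
  have e0 : ∀ w : Circle, (1 : ℂ) + -(Q : ℂ) * (w * w) = 1 - (Q : ℂ) * (w : ℂ) ^ 2 := fun w => by
    ring
  simp only [e0] at d0
  have d1 := (HasCircleDeriv.coe.mul H).mul (d0.inv hne)
  have b0 := (HolderBound.const (α := α) 1).add
    ((HolderBound.const (-(Q : ℂ))).mul (hw.mul hw))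
  simp only [e0] at b0
  have b1 := b0.inv (c := 1 - Q) (by linarith) fun w => by
    have := norm_sub_norm_le (1 : ℂ) ((Q : ℂ) * (w : ℂ) ^ 2)
    rwa [norm_one, norm_mul, norm_pow, Circle.norm_coe, one_pow, mul_one, Complex.norm_real,
      Real.norm_of_nonneg hQ0.le] at this
  have hone := HolderBound.const (α := α) 1
  have b2 := (((hone.mul hpb).add (hw.mul hp')).mul b1).add
    ((hw.mul hpb).mul ((((HolderBound.const (α := α) 0).add ((HolderBound.const (-(Q : ℂ))).mul
      ((hone.mul hw).add (hw.mul hone)))).neg).mul (b1.mul b1)))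
  have hkd := d1
  rw [show (fun w : Circle => (w : ℂ) * p w * (1 - (Q : ℂ) * (w : ℂ) ^ 2)⁻¹) = k from
    funext fun w => (hkp w).symm] at hkd
  have hkX : IsC1Holder α k := by
    refine hkd.isC1Holder ((congrArg (HolderBound α _) (funext fun w => ?_)).mp b2)
    rw [div_eq_mul_inv, ← mul_inv, ← sq]
  refine ⟨⟨k, hkX, resolventCoef Q b, hA.hasPowerSeries rfl⟩, hkp, hA.hasPowerSeries rfl⟩

/-! ### The linearized operator in terms of coefficients -/

section Spectrum

variable {α : ℝ≥0} {hα0 : 0 < α} {hα1 : α < 1} {Q : ℝ} {m : ℕ}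

theorem eq_resolventCoef {a b : ℕ → ℝ} (h0 : a 0 = 0) (h1 : a 1 = 0)
    (h : ∀ n, 1 ≤ n → a (n + 1) - Q * a (n - 1) = b n) (n : ℕ) : a n = resolventCoef Q b n := by
  induction n using Nat.strong_induction_on with
  | _ n ih =>
    match n with
    | 0 => exact h0
    | 1 => exact h1
    | n + 2 =>
      have h2 := h (n + 1) (by omega)
      rw [Nat.add_sub_cancel, ih n (by omega)] at h2
      rw [resolventCoef, ← h2]
      ring

theorem resolventCoef_succ_sub (b : ℕ → ℝ) {n : ℕ} (hn : 1 ≤ n) :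
    resolventCoef Q b (n + 1) - Q * resolventCoef Q b (n - 1) = b n := by
  obtain ⟨n, rfl⟩ := Nat.exists_eq_add_of_le' hn
  rw [Nat.add_sub_cancel, resolventCoef, add_sub_cancel_left]

/-- A right-hand side that decays geometrically, at a rate slower than `√Q`, gives a solution that
decays at the same rate. -/
theorem abs_resolventCoef_le (hQ0 : 0 ≤ Q) {r M : ℝ} (hr0 : 0 ≤ r) (hr : Q < r ^ 2) {b : ℕ → ℝ}
    (hb : ∀ n, |b (n + 1)| ≤ M * r ^ n) (n : ℕ) :
    |resolventCoef Q b n| ≤ M / (r ^ 2 - Q) * r ^ n := by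
  have hM : 0 ≤ M := by simpa using (abs_nonneg _).trans (hb 0)
  have hd : 0 < r ^ 2 - Q := sub_pos.2 hr
  induction n using Nat.strong_induction_on with
  | _ n ih =>
    match n with
    | 0 => simpa [resolventCoef] using by positivity
    | 1 => simpa [resolventCoef] using by positivity
    | n + 2 =>
      rw [resolventCoef]
      calc |Q * resolventCoef Q b n + b (n + 1)|
          ≤ Q * |resolventCoef Q b n| + |b (n + 1)| :=
            (abs_add_le _ _).trans (by rw [abs_mul, abs_of_nonneg hQ0])
        _ ≤ Q * (M / (r ^ 2 - Q) * r ^ n) + M * r ^ n :=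
            add_le_add (mul_le_mul_of_nonneg_left (ih n (by omega)) hQ0) (hb n)
        _ = M / (r ^ 2 - Q) * r ^ (n + 2) := by
            field_simp
            ring

theorem spaceX.exists_hasPowerSeries (h : spaceX α) :
    ∃ a : ℕ → ℝ, a 0 = 0 ∧ a 1 = 0 ∧ HasPowerSeries a (h : Circle → ℂ) := by
  obtain ⟨a, ha⟩ := h.2.2
  exact ⟨dropTwo a, by simp [dropTwo], by simp [dropTwo],
    ha.absSeries.hasPowerSeries (by simp [dropTwo])⟩

theorem dropTwo_of_eq_zero {a : ℕ → ℝ} (h0 : a 0 = 0) (h1 : a 1 = 0) : dropTwo a = a := by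
  funext n
  match n with
  | 0 => simp [dropTwo, h0]
  | 1 => simp [dropTwo, h1]
  | n + 2 => simp [dropTwo]

theorem spaceX.ext_of_coef {h k : spaceX α} {a b : ℕ → ℝ} (ha : HasPowerSeries a (h : Circle → ℂ))
    (hb : HasPowerSeries b (k : Circle → ℂ)) (hab : ∀ n, a n = b n) : h = k := by
  refine Subtype.ext (funext fun w => (ha w).unique ?_)
  simpa only [hab] using hb w

theorem linOp_hasSineSeries_of_eq_zero (hQ0 : 0 < Q) (hQ1 : Q < 1) {h : spaceX α} {a : ℕ → ℝ}
    (h0 : a 0 = 0) (h1 : a 1 = 0) (ha : HasPowerSeries a (h : Circle → ℂ)) :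
    HasSineSeries (fun n => dispersion n Q * (a (n + 1) - Q * a (n - 1)))
      (linOp hα0 hα1 Q h : Circle → ℝ) := by
  simpa only [dropTwo_of_eq_zero h0 h1] using linOp_hasSineSeries hQ0 hQ1 h ha

theorem linOp_eq_zero_iff (hQ0 : 0 < Q) (hQ1 : Q < 1) {h : spaceX α} {a : ℕ → ℝ}
    (h0 : a 0 = 0) (h1 : a 1 = 0) (ha : HasPowerSeries a (h : Circle → ℂ)) :
    linOp hα0 hα1 Q h = 0 ↔
      ∀ n, 1 ≤ n → dispersion n Q * (a (n + 1) - Q * a (n - 1)) = 0 := by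
  have hs := linOp_hasSineSeries_of_eq_zero (hα0 := hα0) (hα1 := hα1) hQ0 hQ1 h0 h1 ha
  have hz : HasSineSeries (fun _ => 0) (0 : Circle → ℝ) :=
    ⟨fun w => by simp, fun n _ => by simp⟩
  refine ⟨fun h2 n hn => ?_, fun h2 => Subtype.ext (hs.unique hz h2)⟩
  rw [h2] at hs
  exact hs.coef_eq hz hn

/-! ### The kernel -/

theorem exists_kernelVector (hα1 : α < 1) (hQ0 : 0 < Q) (hQ1 : Q < 1) (hm : 1 ≤ m) :
    ∃ v : spaceX α, (v : Circle → ℂ) = kernelVector m Q ∧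
      HasPowerSeries (resolventCoef Q (Pi.single m 1)) (v : Circle → ℂ) := by
  obtain ⟨k, rfl⟩ := Nat.exists_eq_add_of_le' hm
  have hcoe := HolderBound.coe (α := α) α.coe_nonneg hα1.le
  have key : ∀ n : ℕ, ∃ (p' : Circle → ℂ) (B : ℝ),
      HasCircleDeriv (fun w => (w : ℂ) ^ n) p' ∧ HolderBound α B p' ∧
        ∃ A, HolderBound α A fun w : Circle => (w : ℂ) ^ n := by
    intro n
    induction n with
    | zero =>
      simp only [pow_zero]
      exact ⟨_, _, HasCircleDeriv.const 1, HolderBound.const 0, _, HolderBound.const 1⟩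
    | succ n ih =>
      obtain ⟨p', B, h1, h2, A, h3⟩ := ih
      simp only [pow_succ]
      exact ⟨_, _, h1.mul HasCircleDeriv.coe, (h2.mul hcoe).add (h3.mul (HolderBound.const 1)), _,
        h3.mul hcoe⟩
  obtain ⟨p', B, h1, h2, -⟩ := key (k + 1)
  have hp : AbsSeries (fun n => ((Pi.single (k + 1) 1 : ℕ → ℝ) n : ℂ))
      fun w => (w : ℂ) ^ (k + 1) := by
    refine ⟨summable_of_ne_finset_zero (s := {k}) fun n hn => ?_, fun w => ?_⟩
    · rw [Finset.mem_singleton] at hn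
      simp [hn]
    · have := hasSum_single (f := fun n => ((Pi.single (k + 1) 1 : ℕ → ℝ) (n + 1) : ℂ) *
        (w : ℂ) ^ (n + 1)) k fun n hn => by simp [hn]
      simpa using this
  obtain ⟨v, hv, hv'⟩ := exists_resolvent hα1 hQ0 hQ1 hp h1 h2
  refine ⟨v, funext fun w => ?_, hv'⟩
  rw [hv, kernelVector, div_eq_mul_inv, pow_succ' (w : ℂ) (k + 1)]

theorem kernelVector_ne_zero (hQ0 : 0 < Q) (hQ1 : Q < 1) : kernelVector m Q ≠ 0 := by
  intro h
  have h1 := congrFun h 1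
  have h2 := one_sub_mul_sq_ne_zero hQ0 hQ1 1
  rw [kernelVector, Pi.zero_apply, div_eq_zero_iff] at h1
  exact h1.elim (fun h3 => by simp at h3) h2

/-- The kernel is spanned by the solution of the recursion with right-hand side supported at the
single index at which the dispersion function vanishes. -/
theorem ker_linOp_eq_span (hQ0 : 0 < Q) (hQ1 : Q < 1) (hm : 1 ≤ m) (hQ : dispersion m Q = 0)
    {v : spaceX α} (hv : HasPowerSeries (resolventCoef Q (Pi.single m 1)) (v : Circle → ℂ)) :
    LinearMap.ker (linOp hα0 hα1 Q) = Submodule.span ℝ {v} := by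
  refine le_antisymm (fun h hh => ?_) ((Submodule.span_singleton_le_iff_mem _ _).2 ?_)
  · obtain ⟨a, h0, h1, ha⟩ := spaceX.exists_hasPowerSeries h
    have h2 := (linOp_eq_zero_iff hQ0 hQ1 h0 h1 ha).1 hh
    refine Submodule.mem_span_singleton.2 ⟨a (m + 1) - Q * a (m - 1), ?_⟩
    have htv : HasPowerSeries (fun n => (a (m + 1) - Q * a (m - 1)) *
        resolventCoef Q (Pi.single m 1) n)
        (((a (m + 1) - Q * a (m - 1)) • v : spaceX α) : Circle → ℂ) := by
      intro w
      have := (hv w).mul_left ((a (m + 1) - Q * a (m - 1) : ℝ) : ℂ)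
      simp only [Complex.ofReal_mul, mul_assoc]
      exact this
    refine spaceX.ext_of_coef htv ha fun n => ?_
    rw [eq_resolventCoef (Q := Q) (b := Pi.single m (a (m + 1) - Q * a (m - 1))) h0 h1 ?_ n]
    · refine eq_resolventCoef (a := fun n => (a (m + 1) - Q * a (m - 1)) *
        resolventCoef Q (Pi.single m 1) n) (mul_zero _) (mul_zero _) (fun k hk => ?_) n
      have h3 := resolventCoef_succ_sub (Q := Q) (Pi.single m 1) hk
      have h4 : (Pi.single m (a (m + 1) - Q * a (m - 1)) : ℕ → ℝ) k =
          (a (m + 1) - Q * a (m - 1)) * (Pi.single m 1 : ℕ → ℝ) k := by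
        by_cases hkm : k = m
        · subst hkm
          simp
        · simp [hkm]
      rw [h4, ← h3]
      ring
    · intro k hk
      by_cases hkm : k = m
      · subst hkm
        simp
      · rw [Pi.single_apply, if_neg hkm]
        exact (mul_eq_zero.1 (h2 k hk)).resolve_left (dispersion_ne_zero hQ0 hQ1 hQ hk hkm)
  · refine (linOp_eq_zero_iff hQ0 hQ1 rfl rfl hv).2 fun n hn => ?_
    rw [resolventCoef_succ_sub _ hn]
    by_cases hnm : n = m
    · rw [hnm, hQ, zero_mul]
    · rw [Pi.single_apply, if_neg hnm, mul_zero]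

theorem ker_linOp_ne_bot_iff (hQ0 : 0 < Q) (hQ1 : Q < 1) :
    LinearMap.ker (linOp hα0 hα1 Q) ≠ ⊥ ↔ Q ∈ dispersionSet := by
  constructor
  · intro hne
    obtain ⟨h, hh, hh0⟩ := (Submodule.ne_bot_iff _).1 hne
    obtain ⟨a, h0, h1, ha⟩ := spaceX.exists_hasPowerSeries h
    have h2 := (linOp_eq_zero_iff hQ0 hQ1 h0 h1 ha).1 hh
    by_contra hQ
    refine hh0 (spaceX.ext_of_coef ha (b := resolventCoef Q fun _ => 0)
      (k := 0) (fun w => ?_) (eq_resolventCoef h0 h1 fun n hn => ?_))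
    · have h3 : ∀ n, 0 = resolventCoef Q (fun _ => 0) n :=
        eq_resolventCoef (a := fun _ => 0) rfl rfl fun n _ => by simp
      simp [← h3]
    · refine (mul_eq_zero.1 (h2 n hn)).resolve_left fun h3 => ?_
      rcases (by omega : n = 1 ∨ n = 2 ∨ 3 ≤ n) with rfl | rfl | h4
      · exact (dispersion_one_pos hQ0).ne' h3
      · exact (dispersion_two_pos hQ0).ne' h3
      · exact hQ ⟨hQ0, hQ1, n, h4, h3⟩
  · rintro ⟨-, -, m, hm, hQ⟩ hbot
    obtain ⟨v, hv, hv'⟩ := exists_kernelVector hα1 hQ0 hQ1 (m := m) (by omega)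
    rw [ker_linOp_eq_span hQ0 hQ1 (by omega) hQ hv', Submodule.span_singleton_eq_bot] at hbot
    rw [hbot] at hv
    exact kernelVector_ne_zero hQ0 hQ1 hv.symm

/-! ### The range -/

theorem natCast_mul_pow_le (hQ0 : 0 ≤ Q) (hQ1 : Q < 1) (n : ℕ) : n * Q ^ n ≤ 1 / (1 - Q) := by
  have h1 : n * Q ^ n ≤ ∑ k ∈ Finset.range n, Q ^ k := by
    rw [← nsmul_eq_mul, ← Finset.card_range n, ← Finset.sum_const, Finset.card_range]
    exact Finset.sum_le_sum fun k hk =>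
      pow_le_pow_of_le_one hQ0 hQ1.le (Finset.mem_range.1 hk).le
  refine h1.trans ?_
  rw [one_div, ← tsum_geometric_of_lt_one hQ0 hQ1]
  exact (summable_geometric_of_lt_one hQ0 hQ1).sum_le_tsum _ fun _ _ => by positivity

/-- Division by the dispersion function, away from its zero `m`: since
`n / f_n = -1/τ - 1/(τ² n) + O(1/n²)` with `τ = (1 - Q²)/2`, it gains one derivative. -/
theorem mem_range_linOp_of_coef_eq_zero (hQ0 : 0 < Q) (hQ1 : Q < 1) (hQ : dispersion m Q = 0)
    {g : spaceY α} {c : ℕ → ℝ} (hc : HasSineSeries c (g : Circle → ℝ)) (hcm : c m = 0) :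
    g ∈ LinearMap.range (linOp hα0 hα1 Q) := by
  obtain ⟨A, hA⟩ := exists_holderBound g.2.1 g.2.2.1
  obtain ⟨G, B, D, hG, hs, hD⟩ := hc.exists_analytic hα0 hα1 hA
  set τ := (1 - Q ^ 2) / 2 with hτ
  have hτ0 : 0 < τ := by rw [hτ]; nlinarith
  have h1Q : 0 < 1 - Q := by linarith
  have hr : ∀ n : ℕ, 1 ≤ n →
      |n * (c n / dispersion n Q) - (-1 / τ * c n + -1 / τ ^ 2 * (c n / n))| ≤
        (2 + τ * (1 / (1 - Q))) * (m + 1) / τ ^ 3 * (|c n| / n ^ 2) := by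
    intro n hn
    by_cases hnm : n = m
    · rw [hnm, hcm]
      simp
    have hf := dispersion_ne_zero hQ0 hQ1 hQ hn hnm
    have hf' := le_abs_dispersion hQ0 hQ1 hQ hnm
    rw [← hτ] at hf'
    have hn0 : (0 : ℝ) < n := by exact_mod_cast hn
    have e : n * (c n / dispersion n Q) - (-1 / τ * c n + -1 / τ ^ 2 * (c n / n)) =
        (1 + Q ^ n + τ * (n * Q ^ n)) / (τ ^ 2 * n * dispersion n Q) * c n := by
      have e1 : dispersion n Q = 1 + Q ^ n - τ * n := rfl
      field_simp
      rw [e1]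
      ring
    have h1 : |1 + Q ^ n + τ * (n * Q ^ n)| ≤ 2 + τ * (1 / (1 - Q)) := by
      rw [abs_of_nonneg (by positivity)]
      have h2 := mul_le_mul_of_nonneg_left (natCast_mul_pow_le hQ0.le hQ1 n) hτ0.le
      have h3 : Q ^ n ≤ 1 := pow_le_one₀ hQ0.le hQ1.le
      linarith
    have h2 : τ ^ 3 / (m + 1) * n ^ 2 ≤ |τ ^ 2 * n * dispersion n Q| := by
      rw [abs_mul, abs_of_pos (by positivity)]
      calc τ ^ 3 / (m + 1) * (n : ℝ) ^ 2 = τ ^ 2 * n * (τ / (m + 1) * n) := by ring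
        _ ≤ _ := mul_le_mul_of_nonneg_left hf' (by positivity)
    rw [e, abs_mul, abs_div]
    calc _ ≤ (2 + τ * (1 / (1 - Q))) / (τ ^ 3 / (m + 1) * n ^ 2) * |c n| :=
          mul_le_mul_of_nonneg_right (div_le_div₀ (by positivity) h1 (by positivity) h2)
            (abs_nonneg _)
      _ = _ := by field_simp
  obtain ⟨p, p', B', hp, H, hp'⟩ := hs.exists_antideriv (κ₀ := -1 / τ)
    (κ₁ := -1 / τ ^ 2) (b := fun n => c n / dispersion n Q)
    (r := fun n => n * (c n / dispersion n Q) - (-1 / τ * c n + -1 / τ ^ 2 * (c n / n)))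
    hα0 hα1 hG hD (fun n _ => by ring) hr
  obtain ⟨h, -, hh⟩ := exists_resolvent hα1 hQ0 hQ1 hp H hp'
  refine ⟨h, Subtype.ext ((linOp_hasSineSeries_of_eq_zero hQ0 hQ1 rfl rfl hh).unique hc
    fun n hn => ?_)⟩
  rw [resolventCoef_succ_sub _ hn]
  by_cases hnm : n = m
  · rw [hnm, hQ, hcm, zero_mul]
  · exact mul_div_cancel₀ _ (dispersion_ne_zero hQ0 hQ1 hQ hn hnm)

theorem mem_range_linOp_iff (hQ0 : 0 < Q) (hQ1 : Q < 1) (hm : 1 ≤ m) (hQ : dispersion m Q = 0)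
    {g : spaceY α} {c : ℕ → ℝ} (hc : HasSineSeries c (g : Circle → ℝ)) :
    g ∈ LinearMap.range (linOp hα0 hα1 Q) ↔ c m = 0 := by
  refine ⟨?_, mem_range_linOp_of_coef_eq_zero hQ0 hQ1 hQ hc⟩
  rintro ⟨h, rfl⟩
  obtain ⟨a, h0, h1, ha⟩ := spaceX.exists_hasPowerSeries h
  rw [hc.coef_eq (linOp_hasSineSeries_of_eq_zero hQ0 hQ1 h0 h1 ha) hm, hQ, zero_mul]

/-- Sine series whose coefficients are summable with weight `n` represent elements of `Y`, even
Lipschitz functions; the weighted sum controls the norm. -/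
theorem spaceY.exists_of_summable (hα1 : α < 1) {c : ℕ → ℝ}
    (hs : Summable fun n : ℕ => ((n : ℝ) + 1) * |c (n + 1)|) :
    ∃ g : spaceY α, HasSineSeries c (g : Circle → ℝ) ∧ holderENorm α (g : Circle → ℝ) ≤
      ENNReal.ofReal (4 * ∑' n : ℕ, ((n : ℝ) + 1) * |c (n + 1)|) := by
  have hA := AbsSeries.of_summable (c := fun n => (c n : ℂ)) (by
    refine Summable.of_nonneg_of_le (fun n => norm_nonneg _) (fun n => ?_) hs
    rw [Complex.norm_real, Real.norm_eq_abs]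
    have : (0 : ℝ) ≤ n * |c (n + 1)| := by positivity
    linarith)
  have hb := hA.holderBound (α := α) α.coe_nonneg hα1.le (by simpa using hs)
  simp only [Complex.norm_real, Real.norm_eq_abs] at hb
  have hS := hA.boundedSeries.hasSineSeries
  have hc := Complex.continuous_im.comp hA.continuous
  refine ⟨⟨_, hc, hb.im.memHolder, c, hS⟩, hS, hb.im.holderENorm_le.trans (le_of_eq ?_)⟩
  rw [← mul_assoc]
  norm_num

theorem HasSineSeries.sub_smul {g k : spaceY α} {c d : ℕ → ℝ} (t : ℝ)
    (hc : HasSineSeries c (g : Circle → ℝ)) (hd : HasSineSeries d (k : Circle → ℝ)) :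
    HasSineSeries (c - t • d) ((g - t • k : spaceY α) : Circle → ℝ) := by
  have := hc.add g.2.1 (k.2.1.const_smul (-t)) (hd.smul (-t))
  rwa [neg_smul, ← sub_eq_add_neg, neg_smul, ← sub_eq_add_neg] at this

theorem HasSineSeries.sub {g k : spaceY α} {c d : ℕ → ℝ} (hc : HasSineSeries c (g : Circle → ℝ))
    (hd : HasSineSeries d (k : Circle → ℝ)) :
    HasSineSeries (c - d) ((g - k : spaceY α) : Circle → ℝ) := by
  simpa only [one_smul] using hc.sub_smul 1 hd

theorem hasSum_mul_single (hm : 1 ≤ m) :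
    HasSum (fun n : ℕ => ((n : ℝ) + 1) * |(Pi.single m 1 : ℕ → ℝ) (n + 1)|) m := by
  obtain ⟨k, rfl⟩ := Nat.exists_eq_add_of_le' hm
  have := hasSum_single (f := fun n : ℕ => ((n : ℝ) + 1) *
    |(Pi.single (k + 1) 1 : ℕ → ℝ) (n + 1)|) k fun n hn => by simp [hn]
  simpa using this

theorem finrank_quotient_range_linOp (hQ0 : 0 < Q) (hQ1 : Q < 1) (hm : 1 ≤ m)
    (hQ : dispersion m Q = 0) :
    Module.finrank ℝ (spaceY α ⧸ LinearMap.range (linOp hα0 hα1 Q)) = 1 := by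
  obtain ⟨e, he, -⟩ := spaceY.exists_of_summable (α := α) hα1
    (c := (Pi.single m 1 : ℕ → ℝ)) (hasSum_mul_single hm).summable
  refine finrank_eq_one (Submodule.Quotient.mk e) ?_ fun w => ?_
  · rw [Ne, Submodule.Quotient.mk_eq_zero, mem_range_linOp_iff hQ0 hQ1 hm hQ he]
    simp
  · obtain ⟨g, rfl⟩ := Submodule.Quotient.mk_surjective _ w
    obtain ⟨c, hc⟩ := g.2.2.2
    refine ⟨c m, ?_⟩
    rw [← Submodule.Quotient.mk_smul, eq_comm, Submodule.Quotient.eq,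
      mem_range_linOp_iff hQ0 hQ1 hm hQ (hc.sub_smul _ he)]
    simp

/-! ### Transversality -/

theorem abs_dispersion_sub_le (n : ℕ) {q Q : ℝ} (hq0 : 0 < q) (hq1 : q < 1) (hQ0 : 0 < Q)
    (hQ1 : Q < 1) : |dispersion n q - dispersion n Q| ≤ 2 * n * |q - Q| := by
  have h1 := abs_pow_sub_pow_le q Q n
  have h2 : max |q| |Q| ^ (n - 1) ≤ 1 := by
    refine pow_le_one₀ (by positivity) (max_le ?_ ?_)
    · rw [abs_of_pos hq0]; exact hq1.le
    · rw [abs_of_pos hQ0]; exact hQ1.le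
  have h3 : |q ^ n - Q ^ n| ≤ n * |q - Q| :=
    (h1.trans (mul_le_of_le_one_right (by positivity) h2)).trans (le_of_eq (mul_comm _ _))
  have e : dispersion n q - dispersion n Q = (q ^ n - Q ^ n) + n * ((q + Q) / 2) * (q - Q) := by
    simp only [dispersion]
    ring
  rw [e]
  refine (abs_add_le _ _).trans ?_
  rw [abs_mul, abs_of_nonneg (by positivity : (0 : ℝ) ≤ n * ((q + Q) / 2))]
  have h4 : (n : ℝ) * ((q + Q) / 2) ≤ n :=
    mul_le_of_le_one_right (Nat.cast_nonneg n) (by linarith)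
  have h5 := mul_le_mul_of_nonneg_right h4 (abs_nonneg (q - Q))
  linarith

theorem abs_dispersion_le (hQ0 : 0 < Q) (hQ1 : Q < 1) (n : ℕ) :
    |dispersion (n + 1) Q| ≤ 3 * (n + 1) := by
  have h1 : Q ^ (n + 1) ≤ 1 := pow_le_one₀ hQ0.le hQ1.le
  have h2 : 0 < Q ^ (n + 1) := by positivity
  have hn : (0 : ℝ) ≤ n := Nat.cast_nonneg n
  rw [dispersion, abs_le]
  push_cast
  have h3 : 0 ≤ (1 - Q ^ 2) / 2 * ((n : ℝ) + 1) := mul_nonneg (by nlinarith) (by linarith)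
  have h4 : (1 - Q ^ 2) / 2 * ((n : ℝ) + 1) ≤ n + 1 :=
    mul_le_of_le_one_left (by linarith) (by nlinarith)
  constructor <;> linarith

theorem summable_sq_mul_resolventCoef (hQ0 : 0 < Q) (hQ1 : Q < 1) (m : ℕ) :
    Summable fun n : ℕ => ((n : ℝ) + 1) ^ 2 * |resolventCoef Q (Pi.single m 1) n| := by
  set r := (1 + Q) / 2 with hr
  have hr0 : 0 < r := by positivity
  have hr1 : r < 1 := by rw [hr]; linarith
  have hr2 : Q < r ^ 2 := by
    rw [hr]
    nlinarith [sq_pos_of_pos (sub_pos.2 hQ1)]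
  have h1 := abs_resolventCoef_le hQ0.le hr0.le hr2 (M := 1 / r ^ m) (b := Pi.single m 1) fun n => by
    by_cases h : n + 1 = m
    · rw [h, Pi.single_eq_same, abs_one, one_div, inv_mul_eq_div, one_le_div (by positivity)]
      exact pow_le_pow_of_le_one hr0.le hr1.le (by omega)
    · rw [Pi.single_apply, if_neg h, abs_zero]
      positivity
  have h2 : Summable fun n : ℕ => ((n : ℝ) + 1) ^ 2 * r ^ n := by
    have h3 := (summable_nat_add_iff 1).2
      (summable_pow_mul_geometric_of_norm_lt_one (R := ℝ) 2 (r := r)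
        (by rwa [Real.norm_of_nonneg hr0.le]))
    refine (h3.mul_left r⁻¹).congr fun n => ?_
    push_cast
    field_simp
    ring
  refine Summable.of_nonneg_of_le (fun n => by positivity) (fun n => ?_)
    (h2.mul_left (1 / r ^ m / (r ^ 2 - Q)))
  have := mul_le_mul_of_nonneg_left (h1 n) (by positivity : (0 : ℝ) ≤ ((n : ℝ) + 1) ^ 2)
  linarith

theorem diffQuot_hasSineSeries {q : ℝ} {u u' g : spaceY α} {c c' γ : ℕ → ℝ}
    (hu : HasSineSeries c (u : Circle → ℝ)) (hu' : HasSineSeries c' (u' : Circle → ℝ))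
    (hg : HasSineSeries γ (g : Circle → ℝ)) :
    HasSineSeries ((q - Q)⁻¹ • (c - c') - γ)
      (((q - Q)⁻¹ • (u - u') - g : spaceY α) : Circle → ℝ) :=
  HasSineSeries.sub (g := (q - Q)⁻¹ • (u - u')) ((hu.sub hu').smul _) hg

theorem summable_derivCoef (hQ0 : 0 < Q) (hQ1 : Q < 1) (hm : 1 ≤ m) (s : ℝ) :
    Summable fun n : ℕ => ((n : ℝ) + 1) * |s * (Pi.single m 1 : ℕ → ℝ) (n + 1) -
      dispersion (n + 1) Q * resolventCoef Q (Pi.single m 1) n| := by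
  refine Summable.of_nonneg_of_le (fun n => by positivity) (fun n => ?_)
    (((hasSum_mul_single hm).summable.mul_left |s|).add
      ((summable_sq_mul_resolventCoef hQ0 hQ1 m).mul_left 3))
  generalize resolventCoef Q (Pi.single m 1) n = x
  generalize (Pi.single m 1 : ℕ → ℝ) (n + 1) = y
  have h1 := abs_sub (s * y) (dispersion (n + 1) Q * x)
  have h2 := mul_le_mul_of_nonneg_right (abs_dispersion_le hQ0 hQ1 n) (abs_nonneg x)
  rw [abs_mul, abs_mul] at h1
  have h3 := mul_le_mul_of_nonneg_left (h1.trans (add_le_add_right h2 _))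
    (by positivity : (0 : ℝ) ≤ (n : ℝ) + 1)
  refine h3.trans (le_of_eq ?_)
  ring

/-- If `a_{n+1} - Q a_{n-1} = δ_{nm}`, then `L_q v` has the coefficients
`f_n(q) (δ_{nm} - (q - Q) a_{n-1})`. Their derivative at `q = Q` is approximated by the difference
quotients in a norm that controls `C^α`. -/
theorem holderENorm_diffQuot_linOp_sub_le {q : ℝ} (hq0 : 0 < q) (hq1 : q < 1) (hqQ : q ≠ Q)
    (hQ0 : 0 < Q) (hQ1 : Q < 1) (hm : 1 ≤ m) {s : ℝ} {v : spaceX α} {g : spaceY α}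
    (hv : HasPowerSeries (resolventCoef Q (Pi.single m 1)) (v : Circle → ℂ))
    (hg : HasSineSeries (fun n => s * (Pi.single m 1 : ℕ → ℝ) n -
      dispersion n Q * resolventCoef Q (Pi.single m 1) (n - 1)) (g : Circle → ℝ)) :
    holderENorm α
        (((q - Q)⁻¹ • (linOp hα0 hα1 q v - linOp hα0 hα1 Q v) - g : spaceY α) : Circle → ℝ) ≤
      ENNReal.ofReal (4 * (|slope (dispersion m) Q q - s| * m + 2 * |q - Q| *
        ∑' n : ℕ, ((n : ℝ) + 1) ^ 2 * |resolventCoef Q (Pi.single m 1) n|)) := by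
  have hqQ' : q - Q ≠ 0 := sub_ne_zero.2 hqQ
  set Δ := slope (dispersion m) Q q - s with hΔ
  have hdb : ∀ n : ℕ, ((n : ℝ) + 1) * |Δ * (Pi.single m 1 : ℕ → ℝ) (n + 1) -
      (dispersion (n + 1) q - dispersion (n + 1) Q) * resolventCoef Q (Pi.single m 1) n| ≤
      |Δ| * (((n : ℝ) + 1) * |(Pi.single m 1 : ℕ → ℝ) (n + 1)|) +
        2 * |q - Q| * (((n : ℝ) + 1) ^ 2 * |resolventCoef Q (Pi.single m 1) n|) := by
    intro n
    generalize resolventCoef Q (Pi.single m 1) n = x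
    generalize (Pi.single m 1 : ℕ → ℝ) (n + 1) = y
    have h1 := abs_sub (Δ * y) ((dispersion (n + 1) q - dispersion (n + 1) Q) * x)
    have h2 := mul_le_mul_of_nonneg_right (abs_dispersion_sub_le (n + 1) hq0 hq1 hQ0 hQ1)
      (abs_nonneg x)
    rw [abs_mul, abs_mul] at h1
    have h3 := mul_le_mul_of_nonneg_left (h1.trans (add_le_add_right h2 _))
      (by positivity : (0 : ℝ) ≤ (n : ℝ) + 1)
    refine h3.trans (le_of_eq ?_)
    push_cast
    ring
  have hsum := ((hasSum_mul_single hm).mul_left |Δ|).add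
    ((summable_sq_mul_resolventCoef hQ0 hQ1 m).hasSum.mul_left (2 * |q - Q|))
  have hds := Summable.of_nonneg_of_le (fun n => by positivity) hdb hsum.summable
  obtain ⟨k, hk, hkn⟩ := spaceY.exists_of_summable (α := α) hα1
    (c := fun n => Δ * (Pi.single m 1 : ℕ → ℝ) n -
      (dispersion n q - dispersion n Q) * resolventCoef Q (Pi.single m 1) (n - 1)) hds
  have h1 := linOp_hasSineSeries_of_eq_zero (hα0 := hα0) (hα1 := hα1) hq0 hq1 rfl rfl hv
  have h2 := linOp_hasSineSeries_of_eq_zero (hα0 := hα0) (hα1 := hα1) hQ0 hQ1 rfl rfl hv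
  have h5 := (diffQuot_hasSineSeries (q := q) (Q := Q) h1 h2 hg).unique hk fun n hn => by
    have h6 := resolventCoef_succ_sub (Q := Q) (Pi.single m 1) hn
    have h7 : (dispersion n q - dispersion n Q) * (Pi.single m 1 : ℕ → ℝ) n =
        (Δ + s) * (q - Q) * (Pi.single m 1 : ℕ → ℝ) n := by
      by_cases hnm : n = m
      · rw [hnm, hΔ, sub_add_cancel, slope_def_field, div_mul_cancel₀ _ hqQ']
      · rw [Pi.single_apply, if_neg hnm, mul_zero, mul_zero]
    simp only [Pi.sub_apply, Pi.smul_apply, smul_eq_mul]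
    rw [inv_mul_eq_div, sub_eq_iff_eq_add, div_eq_iff hqQ', ← sub_eq_zero]
    rw [sub_eq_iff_eq_add] at h6
    rw [h6]
    linear_combination h7
  rw [h5]
  refine hkn.trans (ENNReal.ofReal_le_ofReal ?_)
  have h9 := hds.tsum_le_tsum hdb hsum.summable
  rw [hsum.tsum_eq] at h9
  exact mul_le_mul_of_nonneg_left h9 (by norm_num)

/-- The coefficient of index `m` of the derivative of `L_q v` at `Q` is `f_m'(Q) ≠ 0`. -/
theorem exists_hasDeriv_linOp (hQ0 : 0 < Q) (hQ1 : Q < 1) (hm : 1 ≤ m) (hQ : dispersion m Q = 0)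
    {v : spaceX α} (hv : HasPowerSeries (resolventCoef Q (Pi.single m 1)) (v : Circle → ℂ)) :
    ∃ g : spaceY α, Tendsto (fun q : ℝ => holderENorm α
        (((q - Q)⁻¹ • (linOp hα0 hα1 q v - linOp hα0 hα1 Q v) - g : spaceY α) : Circle → ℝ))
        (𝓝[≠] Q) (𝓝 0) ∧ g ∉ LinearMap.range (linOp hα0 hα1 Q) := by
  obtain ⟨g, hg, -⟩ := spaceY.exists_of_summable (α := α) hα1
    (c := fun n => (m * Q ^ (m - 1) + m * Q) * (Pi.single m 1 : ℕ → ℝ) n -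
      dispersion n Q * resolventCoef Q (Pi.single m 1) (n - 1)) (summable_derivCoef hQ0 hQ1 hm _)
  refine ⟨g, ?_, ?_⟩
  · have h1 := (hasDerivAt_iff_tendsto_slope.1 (hasDerivAt_dispersion m Q)).sub_const
      (m * Q ^ (m - 1) + m * Q)
    have h2 : Tendsto (fun q : ℝ => q - Q) (𝓝[≠] Q) (𝓝 (Q - Q)) :=
      ((continuous_id.sub continuous_const).tendsto Q).mono_left nhdsWithin_le_nhds
    rw [sub_self] at h1 h2
    have hlim := ENNReal.tendsto_ofReal (((h1.abs.mul_const (m : ℝ)).add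
      ((h2.abs.const_mul 2).mul_const
        (∑' n : ℕ, ((n : ℝ) + 1) ^ 2 * |resolventCoef Q (Pi.single m 1) n|))).const_mul 4)
    simp only [abs_zero, zero_mul, mul_zero, add_zero, ENNReal.ofReal_zero] at hlim
    refine tendsto_of_tendsto_of_tendsto_of_le_of_le' tendsto_const_nhds hlim
      (Eventually.of_forall fun _ => zero_le) ?_
    filter_upwards [nhdsWithin_le_nhds (Ioo_mem_nhds hQ0 hQ1), self_mem_nhdsWithin] with q hq hqQ
    exact holderENorm_diffQuot_linOp_sub_le hq.1 hq.2 hqQ hQ0 hQ1 hm hv hg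
  · rw [mem_range_linOp_iff hQ0 hQ1 hm hQ hg, Pi.single_eq_same, mul_one, hQ, zero_mul, sub_zero]
    have : (0 : ℝ) < m := by exact_mod_cast hm
    positivity

end Spectrum

end RotatingPatch

theorem proposition2 (α : ℝ≥0) (hα0 : 0 < α) (hα1 : α < 1) :
    (∀ m : ℕ, 3 ≤ m → ∃! Q : ℝ, (0 < Q ∧ Q < 1) ∧ RotatingPatch.dispersion m Q = 0) ∧
    ∃ L : ℝ → (RotatingPatch.spaceX α →ₗ[ℝ] RotatingPatch.spaceY α),
      -- `L Q` is the linearized operator `∂_f F(Q, 0)`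
      (∀ Q : ℝ, 0 < Q → Q < 1 → RotatingPatch.IsLinearization α Q (L Q)) ∧
      -- the action of `L Q` on Fourier coefficients
      (∀ Q : ℝ, 0 < Q → Q < 1 → ∀ (h : RotatingPatch.spaceX α) (a : ℕ → ℝ),
        RotatingPatch.HasPowerSeries a (h : Circle → ℂ) →
        ∃ g : ℕ → ℝ,
          RotatingPatch.HasSineSeries (fun n => g (n + 1)) (L Q h : Circle → ℝ) ∧
          g 2 = (1 + Q) ^ 2 / 2 * a 2 ∧
          g 3 = 2 * Q ^ 2 * a 3 ∧
          ∀ n : ℕ, 3 ≤ n →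
            g (n + 1) =
              (1 + Q ^ n - (1 - Q ^ 2) / 2 * n) * (a (n + 1) - Q * a (n - 1))) ∧
      -- the kernel is nontrivial exactly on the dispersion set
      (∀ Q : ℝ, 0 < Q → Q < 1 →
        (LinearMap.ker (L Q) ≠ ⊥ ↔ Q ∈ RotatingPatch.dispersionSet)) ∧
      -- the kernel, the range and transversality at `Q = Q_m`
      ∀ (m : ℕ) (Q : ℝ), 3 ≤ m → 0 < Q → Q < 1 → RotatingPatch.dispersion m Q = 0 →
        ∃ v : RotatingPatch.spaceX α, (v : Circle → ℂ) = RotatingPatch.kernelVector m Q ∧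
          LinearMap.ker (L Q) = Submodule.span ℝ {v} ∧
          Module.finrank ℝ (LinearMap.ker (L Q)) = 1 ∧
          Module.finrank ℝ (RotatingPatch.spaceY α ⧸ LinearMap.range (L Q)) = 1 ∧
          (∀ g : RotatingPatch.spaceY α, g ∈ LinearMap.range (L Q) ↔
            ∃ c : ℕ → ℝ, c m = 0 ∧ RotatingPatch.HasSineSeries c (g : Circle → ℝ)) ∧
          ∃ g : RotatingPatch.spaceY α,
            Tendsto (fun q : ℝ => RotatingPatch.holderENorm α
                (((q - Q)⁻¹ • (L q v - L Q v) - g : RotatingPatch.spaceY α) : Circle → ℝ))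
              (𝓝[≠] Q) (𝓝 0) ∧
            g ∉ LinearMap.range (L Q) := by
  refine ⟨fun m hm => RotatingPatch.existsUnique_dispersion hm, RotatingPatch.linOp hα0 hα1,
    fun Q hQ0 hQ1 => RotatingPatch.isLinearization_linOp hα0 hα1 hQ0 hQ1,
    fun Q hQ0 hQ1 h a ha => ?_,
    fun Q hQ0 hQ1 => RotatingPatch.ker_linOp_ne_bot_iff hQ0 hQ1,
    fun m Q hm hQ0 hQ1 hQ => ?_⟩
  · -- `g` is indexed so that `g (n + 1)` is the coefficient of `e_n`
    refine ⟨fun n => RotatingPatch.dispersion (n - 1) Q *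
      (RotatingPatch.dropTwo a n - Q * RotatingPatch.dropTwo a (n - 2)),
      RotatingPatch.linOp_hasSineSeries hQ0 hQ1 h ha, ?_, ?_, fun n hn => ?_⟩
    -- in the two lowest modes the term `a (n - 1)` is absent, and `f_1`, `f_2` factor
    · simp only [RotatingPatch.dropTwo, RotatingPatch.dispersion]
      norm_num
      ring_nf
      simp
    · simp only [RotatingPatch.dropTwo, RotatingPatch.dispersion]
      norm_num
      ring_nf
      simp
    · simp only [RotatingPatch.dropTwo, Nat.add_sub_cancel]
      rw [if_neg (by omega), if_neg (by omega)]
      rfl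
  · obtain ⟨v, hv, hv'⟩ := RotatingPatch.exists_kernelVector hα1 hQ0 hQ1 (m := m) (by omega)
    have hker := RotatingPatch.ker_linOp_eq_span (hα0 := hα0) (hα1 := hα1) hQ0 hQ1
      (by omega) hQ hv'
    refine ⟨v, hv, hker, ?_, RotatingPatch.finrank_quotient_range_linOp hQ0 hQ1 (by omega) hQ,
      fun g => ⟨fun hg => ?_, fun ⟨c, hcm, hc⟩ =>
        RotatingPatch.mem_range_linOp_of_coef_eq_zero hQ0 hQ1 hQ hc hcm⟩,
      RotatingPatch.exists_hasDeriv_linOp hQ0 hQ1 (by omega) hQ hv'⟩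
    · rw [hker]
      refine finrank_span_singleton fun h0 => ?_
      rw [h0] at hv
      exact RotatingPatch.kernelVector_ne_zero hQ0 hQ1 hv.symm
    · obtain ⟨c, hc⟩ := g.2.2.2
      exact ⟨c, (RotatingPatch.mem_range_linOp_iff hQ0 hQ1 (by omega) hQ hc).1 hg, hc⟩
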